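/- **Setting.** Let $n\ge 2$. Let $\Sigma$ be obtained from a compact oriented surface $\overline\Sigma$ by removing finitely many points (punctures), all on $\partial\overline\Sigma$ and at least one on each component of $\partial\overline\Sigma$, where every connected component of $\Sigma$ has non-empty boundary and is neither a monogon nor a bigon. Let $\lambda$ be an ideal triangulation of $\Sigma$. Write $\#\partial\Sigma$ for the number of boundary edges (components of $\partial\Sigma$), $r=\#\partial\Sigma-\chi(\Sigma)$, $b$ for the number of components of $\partial\overline\Sigma$, and $t$ for the number of those containing an even number of punctures. **Matrices.** Each face of $\lambda$ is identified with the standard triangle with corners $v_1,v_3,v_2$ in counterclockwise order, barycentric coordinates $(i,j,k)$ with $i+j+k=n$, and sides $e_a=v_av_{a+1}$ (indices mod $3$). Its small vertices are the integral points with $i,j,k\ge0$ other than the corners. Its small edges between small vertices are directed parallel to $v_1\to v_3\to v_2\to v_1$, with weight $1$ on the boundary of the triangle and $2$ in the interior; this gives an anti-symmetric matrix on its small vertices. Let $\overline V_\lambda$ be the set of all small vertices of $\Sigma$ (those on glued sides being identified) and $\overline Q_\lambda$ the sum over the faces of the zero-extensions of this matrix. On the small vertices of the standard triangle let $\overline K(v,v')$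 be the $\mathbb Z/3$-invariant form with $\overline K(ijk,i'j'k')=jk'+ki'+i'j$ whenever $i'\le i$ and $j'\ge j$. For a small vertex $u=(i,j,k)$ of a face draw edges from $u$ of weights $i,j,k$ through $e_1,e_2,e_3$ respectively, discard those of weight $0$, and prolong each by turning left in every further face until it leaves $\Sigma$. To a prolonging segment of weight $w$ that enters a face through $e_{a}$ and leaves through $e_{a+1}$ attach the small vertex of that face whose coordinate is $n-w$ in position $a$, $w$ in position $a+1$ and $0$ in the remaining position; to the starting segment attach $u$. For $v$ in a face $\tau$, let $\overline K_\lambda(u,v)$ be the sum of $\overline K(y,v)$ over the small vertices $y$ attached to the segments in $\tau$ (this is well defined). Put $\overline P_\lambda=\overline K_\lambda\overline Q_\lambda\overline K_\lambda^{T}$. Let $\lambda^*$ be obtained from $\lambda$ by attaching a triangle along its side $e_1$ to each boundary edge of $\Sigma$. Let $V_\lambda$, resp. $V'_\lambda$, be the set of small vertices of $\lambda^*$ not on $e_3$, resp. not on $e_2$, of an attached triangle. Let $C$ be the $V'_\lambda\times\overline V_{\lambda^*}$ matrix with $C(v,v)=1$, with $C(v,p(v))=-1$ if $v=(i,j,k)$,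 $k\neq0$, lies in an attached triangle and $p(v)=(0,n-k,k)$ in the same triangle, and with all other entries $0$. Put $K_\lambda=(C\,\overline K_{\lambda^*})|_{V'_\lambda\times V_\lambda}$, $Q_\lambda=\overline Q_{\lambda^*}|_{V_\lambda\times V_\lambda}$ and $P_\lambda=K_\lambda Q_\lambda K_\lambda^{T}$. A *skew normal form* of an anti-symmetric integer matrix $M$ is a matrix $X^{T}MX=\mathrm{diag}\left\{\begin{pmatrix}0&h_1\\-h_1&0\end{pmatrix},\dots,\begin{pmatrix}0&h_k\\-h_k&0\end{pmatrix},0,\dots,0\right\}$ with $X$ integral, $\det X=\pm1$, the $h_i$ positive integers and $h_i\mid h_{i+1}$. Write $x\overset{(2)}{=}y$ if $x=2^ey$ for some $e\in\mathbb Z$. **Proposition.** (a) The numbers $\frac{r-t}2$ and $\frac{n^2r-tn-2r+2t}2$ are non-negative integers. In every skew normal form of $P_\lambda$, the number of $2\times2$ blocks is $k=\frac{r-t}2+\frac{n^2r-tn-2r+2t}2$, and $h_i=nz_i$ with integers $z_i$ such that $$z_i\overset{(2)}{=}\begin{cases}1&\text{for }1\le i\le\frac{r-t}2,\\ n&\text{for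 }\frac{r-t}2<i\le k.\end{cases}$$ (b) Assume that $\lambda$ is adapted to the boundary: for each component of $\partial\overline\Sigma$, its boundary edges can be labelled $e_1,\dots,e_R$, consecutively along the positive orientation, such that for $1\le i\le\lfloor R/2\rfloor$ the edges $e_{2i-1},e_{2i}$ are two sides of a face that meet inside it at their common puncture, and, if $R>1$ is odd, the third side of the face containing $e_{R-2},e_{R-1}$ either forms two sides of a further face together with $e_R$, meeting inside it at the common puncture of $e_{R-1}$ and $e_R$, or is $e_R$ itself (when the component of $\Sigma$ is a triangle). Then $|\overline V_\lambda|=(n^2-1)r-\binom n2\#\partial\Sigma$, and the numbers $\frac{r-t}2$ and $l=\frac12\left(|\overline V_\lambda|-t(n-1)-(b-t)\lfloor\frac n2\rfloor\right)$ are integers with $0\le\frac{r-t}2\le l$. In every skew normal form of $\overline P_\lambda$, the number of $2\times 2$ blocks is $k=l$, and $h_i=n\bar z_i$ with integers $\bar z_i$ such that $$\bar z_i\overset{(2)}{=}\begin{cases}1&\text{for }1\le i\le\frac{r-t}2,\\ n&\text{for }\frac{r-t}2<i\le l.\end{cases}$$ -/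

import Mathlib

/-- An ideally triangulated oriented punctured bordered surface, given by its finite set `F` of
faces and the way their sides are glued. Each face is a copy of the standard ideal triangle with
ideal corners `v 0, v 1, v 2`, the counterclockwise order being `v 0, v 2, v 1`. The pair `(f, a)`
is the side `e a` of the face `f`, which joins `v a` to `v (a + 1)`; `glue` sends it to the side it
is glued to (by the orientation compatible identification, which exchanges the two ends), and a side
fixed by `glue` is a boundary edge of the surface. -/
structure IdealTriangulation (F : Type*) where
  glue : F × Fin 3 → F × Fin 3
  glue_glue : ∀ h, glue (glue h) = h

/-- The small vertices of the `n`-triangulation of the standard triangle: integer barycentric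
coordinates with sum `n`, the three corners being left out (all coordinates are `< n`). -/
abbrev SmallVertex (n : ℕ) : Type :=
  {c : Fin 3 → Fin n // (c 0 : ℕ) + (c 1 : ℕ) + (c 2 : ℕ) = n}

namespace SmallVertex

/-- The barycentric coordinates as natural numbers. -/
def coord {n : ℕ} (c : SmallVertex n) : Fin 3 → ℕ := fun a => (c.1 a : ℕ)

end SmallVertex

/-- There is an arrow `c → d` along a small edge: the small edges are directed parallel to the
counterclockwise boundary arrows `v 0 → v 2 → v 1 → v 0`. -/
def SmallArrow (c d : Fin 3 → ℕ) : Prop :=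
  ∃ a : Fin 3, c a = d a + 1 ∧ d (a + 2) = c (a + 2) + 1 ∧ d (a + 1) = c (a + 1)

open Classical in
/-- The signed adjacency matrix of the weighted quiver of the standard triangle: boundary arrows
have weight `1`, interior arrows have weight `2`. -/
noncomputable def triQ (c d : Fin 3 → ℕ) : ℤ :=
  let w : ℤ := if ∃ a, c a = 0 ∧ d a = 0 then 1 else 2
  if SmallArrow c d then w else if SmallArrow d c then -w else 0

/-- The `ℤ/3`-invariant form on the small vertices of the standard triangle which is
`j k' + k i' + i' j` at `(i, j, k)`, `(i', j', k')` if `i' ≤ i` and `j ≤ j'`. One of the three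
rotations of this condition always holds, and where two hold the values agree. -/
def triK (c d : Fin 3 → ℕ) : ℤ :=
  let val : Fin 3 → ℤ := fun a =>
    (c (a + 1) : ℤ) * d (a + 2) + (c (a + 2) : ℤ) * d a + (d a : ℤ) * c (a + 1)
  if d 0 ≤ c 0 ∧ c 1 ≤ d 1 then val 0
  else if d 1 ≤ c 1 ∧ c 2 ≤ d 2 then val 1
  else val 2

/-- The small vertex of an arc segment of weight `w` that enters a triangle through the side
`e (b - 1)`, turns left and leaves through the side `e b`. -/
def arcCoord (n w : ℕ) (b : Fin 3) : Fin 3 → ℕ :=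
  fun a => if a = b then w else if a = b + 2 then n - w else 0

namespace IdealTriangulation

variable {F : Type*}

/-- The side following `e a` in the cyclic order of the labels, in the same face. -/
def rot (h : F × Fin 3) : F × Fin 3 := (h.1, h.2 + 1)

/-- Leaving a face through the side `h` into the adjacent face and turning left there, one leaves
the latter through the side `h'`. (Since the side `e a` also stands for the corner `v a`, this is
as well the passage from a corner to the next corner around the same puncture.) -/
def Step (T : IdealTriangulation F) (h h' : F × Fin 3) : Prop :=
  T.glue h ≠ h ∧ h' = rot (T.glue h)

/-- Every puncture lies on the boundary: turning around any corner one comes to a boundary edge.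
In particular every connected component has non-empty boundary. -/
def NoInteriorPuncture (T : IdealTriangulation F) : Prop :=
  ∀ h, ∃ b, T.glue b = b ∧ Relation.ReflTransGen T.Step h b

/-- The boundary edges, i.e. the connected components of the boundary of the punctured surface. -/
abbrev BoundaryEdge (T : IdealTriangulation F) : Type _ := {h : F × Fin 3 // T.glue h = h}

/-- The punctures (ideal points): classes of corners of faces. -/
abbrev Puncture (T : IdealTriangulation F) : Type _ := Quot T.Step

/-- The edges of the triangulation, boundary edges included. -/
abbrev Edge (T : IdealTriangulation F) : Type _ := Quot (fun h h' => T.glue h = h')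

/-- The Euler characteristic (of the compact surface, hence also of the punctured surface if all
punctures lie on the boundary). -/
noncomputable def eulerChar (T : IdealTriangulation F) : ℤ :=
  (Nat.card T.Puncture : ℤ) - Nat.card T.Edge + Nat.card F

/-- The number of boundary edges. -/
noncomputable def numBoundaryEdges (T : IdealTriangulation F) : ℕ := Nat.card T.BoundaryEdge

/-- `r = #(boundary edges) - (Euler characteristic)`. -/
noncomputable def r (T : IdealTriangulation F) : ℤ := (T.numBoundaryEdges : ℤ) - T.eulerChar

/-- `b'` is the boundary edge that follows `b` in the positive orientation of the boundary: the
puncture at the end of `b` is the one at the start of `b'`. -/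
def NextBoundary (T : IdealTriangulation F) (b b' : T.BoundaryEdge) : Prop :=
  Relation.ReflTransGen T.Step (rot b'.1) b.1

/-- The boundary components of the compact surface: cycles of boundary edges. -/
abbrev BoundaryComponent (T : IdealTriangulation F) : Type _ := Quot T.NextBoundary

/-- The boundary component of a boundary edge. -/
def component (T : IdealTriangulation F) (b : T.BoundaryEdge) : T.BoundaryComponent :=
  Quot.mk _ b

/-- The number of boundary edges, equivalently of punctures, on a boundary component. -/
noncomputable def componentSize (T : IdealTriangulation F) (C : T.BoundaryComponent) : ℕ :=
  Nat.card {b : T.BoundaryEdge // T.component b = C}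

/-- The number of boundary components. -/
noncomputable def numComponents (T : IdealTriangulation F) : ℕ := Nat.card T.BoundaryComponent

/-- The number of boundary components with an even number of punctures. -/
noncomputable def numEvenComponents (T : IdealTriangulation F) : ℕ :=
  Nat.card {C : T.BoundaryComponent // Even (T.componentSize C)}

/-- The identification of small vertices on two glued sides. -/
def Glued (T : IdealTriangulation F) (n : ℕ) (x y : F × SmallVertex n) : Prop :=
  ∃ a a' : Fin 3, T.glue (x.1, a) = (y.1, a') ∧ (y.1, a') ≠ (x.1, a) ∧
    x.2.coord (a + 2) = 0 ∧ y.2.coord (a' + 2) = 0 ∧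
    y.2.coord a' = x.2.coord (a + 1) ∧ y.2.coord (a' + 1) = x.2.coord a

/-- The set of small vertices of the `n`-triangulation of the surface (reduced vertex set). -/
abbrev Vbar (T : IdealTriangulation F) (n : ℕ) : Type _ := Quot (T.Glued n)

/-- The small vertex of the surface given by a small vertex of a face. -/
def vertex (T : IdealTriangulation F) {n : ℕ} (f : F) (c : SmallVertex n) : T.Vbar n :=
  Quot.mk _ (f, c)

noncomputable instance (T : IdealTriangulation F) [Fintype F] (n : ℕ) : Fintype (T.Vbar n) :=
  Fintype.ofFinite _

noncomputable instance (T : IdealTriangulation F) [Fintype F] : Fintype T.BoundaryEdge :=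
  Fintype.ofFinite _

open Classical in
/-- The signed adjacency matrix of the glued quiver: the sum over the faces of the zero-extensions
of the matrix of the standard triangle. -/
noncomputable def Qbar (T : IdealTriangulation F) [Fintype F] (n : ℕ) :
    Matrix (T.Vbar n) (T.Vbar n) ℤ :=
  fun u v => ∑ f : F, ∑ c : SmallVertex n, ∑ d : SmallVertex n,
    if T.vertex f c = u ∧ T.vertex f d = v then triQ c.coord d.coord else 0

open Classical in
/-- For a small vertex `c` of a face `f` and a small vertex `d` of a face `g`, the sum over the
segments `s` in `g` of the elongated weighted graph of `c` of `triK (Y s) d`. The main segment lies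
in `f` and has `Y = c`. For each `a` with `c a > 0` there is an edge of weight `c a` that leaves `f`
through `e a` and then turns left in every face it enters, until it leaves through a boundary edge;
its arc segments are recorded by the sides through which they leave. -/
noncomputable def faceK (T : IdealTriangulation F) [Fintype F] (n : ℕ)
    (f : F) (c : SmallVertex n) (g : F) (d : SmallVertex n) : ℤ :=
  (if f = g then triK c.coord d.coord else 0) +
    ∑ a : Fin 3, if 0 < c.coord a then
      ∑ b : Fin 3, (if Relation.TransGen T.Step (f, a) (g, b) then
        triK (arcCoord n (c.coord a) b) d.coord else 0)
    else 0

/-- The matrix `K̄` of the triangulation. The value does not depend on the faces in which the two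
small vertices are represented. -/
noncomputable def Kbar (T : IdealTriangulation F) [Fintype F] (n : ℕ) :
    Matrix (T.Vbar n) (T.Vbar n) ℤ :=
  fun u v => T.faceK n (Quot.out u).1 (Quot.out u).2 (Quot.out v).1 (Quot.out v).2

/-- The reduced anti-symmetric matrix `P̄ = K̄ Q̄ K̄ᵗ`. -/
noncomputable def Pbar (T : IdealTriangulation F) [Fintype F] (n : ℕ) :
    Matrix (T.Vbar n) (T.Vbar n) ℤ :=
  T.Kbar n * T.Qbar n * (T.Kbar n).transpose

open Classical in
/-- The gluing of the extended surface, see `extend`. -/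
noncomputable def extendGlue (T : IdealTriangulation F) :
    (F ⊕ T.BoundaryEdge) × Fin 3 → (F ⊕ T.BoundaryEdge) × Fin 3
  | (Sum.inl f, a) =>
      if h : T.glue (f, a) = (f, a) then (Sum.inr ⟨(f, a), h⟩, 0)
      else (Sum.inl (T.glue (f, a)).1, (T.glue (f, a)).2)
  | (Sum.inr b, a) => if a = 0 then (Sum.inl b.1.1, b.1.2) else (Sum.inr b, a)

theorem extendGlue_extendGlue (T : IdealTriangulation F) (h : (F ⊕ T.BoundaryEdge) × Fin 3) :
    T.extendGlue (T.extendGlue h) = h := by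
  obtain ⟨f | b, a⟩ := h
  · by_cases hb : T.glue (f, a) = (f, a)
    · simp [extendGlue, hb]
    · have h2 : T.glue (T.glue (f, a)) = (f, a) := T.glue_glue _
      have h3 : ¬ (f, a) = T.glue (f, a) := fun h => hb h.symm
      simp [extendGlue, hb, h2, h3]
  · by_cases ha : a = 0
    · subst ha
      simp [extendGlue, b.2]
    · simp [extendGlue, ha]

/-- The extended triangulation: a triangle is attached, along its side `e 0`, to each boundary
edge. -/
noncomputable def extend (T : IdealTriangulation F) : IdealTriangulation (F ⊕ T.BoundaryEdge) where
  glue := T.extendGlue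
  glue_glue := T.extendGlue_extendGlue

/-- The `X`-vertex set: the small vertices of the extended triangulation that do not lie on the
side `e 2` (joining `v 2` and `v 0`) of an attached triangle. -/
abbrev XVertex (T : IdealTriangulation F) (n : ℕ) : Type _ :=
  {v : T.extend.Vbar n // ∀ (b : T.BoundaryEdge) (c : SmallVertex n),
    v = T.extend.vertex (Sum.inr b) c → c.coord 1 ≠ 0}

/-- The `A`-vertex set: the small vertices of the extended triangulation that do not lie on the
side `e 1` (joining `v 1` and `v 2`) of an attached triangle. -/
abbrev AVertex (T : IdealTriangulation F) (n : ℕ) : Type _ :=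
  {v : T.extend.Vbar n // ∀ (b : T.BoundaryEdge) (c : SmallVertex n),
    v = T.extend.vertex (Sum.inr b) c → c.coord 0 ≠ 0}

noncomputable instance (T : IdealTriangulation F) [Fintype F] (n : ℕ) : Fintype (T.XVertex n) :=
  Fintype.ofFinite _

noncomputable instance (T : IdealTriangulation F) [Fintype F] (n : ℕ) : Fintype (T.AVertex n) :=
  Fintype.ofFinite _

/-- `u = p(v)`: `v` has coordinates `(i, j, k)` with `k ≠ 0` in an attached triangle and `u` has
coordinates `(0, n - k, k)` in the same triangle. -/
def IsShift (T : IdealTriangulation F) (n : ℕ) (v u : T.extend.Vbar n) : Prop :=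
  ∃ (b : T.BoundaryEdge) (c d : SmallVertex n),
    v = T.extend.vertex (Sum.inr b) c ∧ u = T.extend.vertex (Sum.inr b) d ∧
    c.coord 2 ≠ 0 ∧ d.coord 0 = 0 ∧ d.coord 2 = c.coord 2

open Classical in
/-- The change-of-variable matrix. -/
noncomputable def changeMatrix (T : IdealTriangulation F) (n : ℕ) :
    Matrix (T.AVertex n) (T.extend.Vbar n) ℤ :=
  fun v u => if u = v.1 then 1 else if T.IsShift n v.1 u then -1 else 0

/-- The matrix `K` of the triangulation: the restriction of `C K̄*` to `A`-vertices times
`X`-vertices, `K̄*` being the matrix of the extended triangulation. -/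
noncomputable def K (T : IdealTriangulation F) [Fintype F] (n : ℕ) :
    Matrix (T.AVertex n) (T.XVertex n) ℤ :=
  (T.changeMatrix n * T.extend.Kbar n).submatrix id Subtype.val

/-- The matrix `Q` of the triangulation: the restriction of `Q̄*` to the `X`-vertices. -/
noncomputable def Q (T : IdealTriangulation F) [Fintype F] (n : ℕ) :
    Matrix (T.XVertex n) (T.XVertex n) ℤ :=
  (T.extend.Qbar n).submatrix Subtype.val Subtype.val

/-- The anti-symmetric matrix `P = K Q Kᵗ`. -/
noncomputable def P (T : IdealTriangulation F) [Fintype F] (n : ℕ) :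
    Matrix (T.AVertex n) (T.AVertex n) ℤ :=
  T.K n * T.Q n * (T.K n).transpose

/-- The triangulation is adapted to the boundary. For each boundary component, with `R` punctures,
its boundary edges can be labelled consecutively `e 1, …, e R` along the positive orientation
(indices modulo `R`, so that `e` is periodic) such that
* for `2 ≤ 2 i ≤ R` the edges `e (2 i - 1)`, `e (2 i)` are two sides of a face that meet, inside this
  face, at the puncture between them;
* if `R > 1` is odd, the third side of the face with sides `e (R - 2)`, `e (R - 1)` and the edge
  `e R` are two sides of a face that meet, inside this face, at the puncture between `e (R - 1)` and
  `e R`, or this third side is `e R` itself (in which case the component of the surface is a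
  triangle). -/
def IsBoundaryAdapted (T : IdealTriangulation F) : Prop :=
  ∀ C : T.BoundaryComponent, ∃ e : ℕ → T.BoundaryEdge,
    (∀ j, T.component (e j) = C) ∧
    (∀ j, T.NextBoundary (e j) (e (j + 1))) ∧
    (∀ i, 1 ≤ i → 2 * i ≤ T.componentSize C → rot (e (2 * i)).1 = (e (2 * i - 1)).1) ∧
    (Odd (T.componentSize C) → 1 < T.componentSize C →
      T.glue (rot (e (T.componentSize C - 2)).1) = rot (e (T.componentSize C)).1 ∨
      rot (e (T.componentSize C - 2)).1 = (e (T.componentSize C)).1)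

end IdealTriangulation

open Classical in
/-- `h 0 ∣ h 1 ∣ ⋯ ∣ h (k - 1)` are the (positive) invariant factors of an anti-symmetric matrix
decomposition (skew normal form) of the integer matrix `M`: for some integer matrix `X` of
determinant `±1`, the matrix `Xᵗ M X` is, in a suitable ordering of the index set, the block
diagonal matrix with the blocks `(0, h i; -h i, 0)`, followed by zeros. -/
def IsSkewNormalForm {V : Type*} [Fintype V] (M : Matrix V V ℤ) (k : ℕ) (h : Fin k → ℕ) : Prop :=
  (∀ i, 0 < h i) ∧ (∀ i j, i ≤ j → h i ∣ h j) ∧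
  ∃ (m : ℕ) (e : (Fin 2 × Fin k) ⊕ Fin m ≃ V) (X : Matrix V V ℤ),
    (X.det = 1 ∨ X.det = -1) ∧
    (X.transpose * M * X).submatrix e e =
      Matrix.fromBlocks
        (Matrix.blockDiagonal fun i : Fin k => !![(0 : ℤ), (h i : ℤ); -(h i : ℤ), 0]) 0 0 0

/-- Equality of natural numbers up to an integral power of `2`. -/
def EqUpToTwo (a b : ℕ) : Prop := ∃ e : ℤ, (a : ℚ) = (2 : ℚ) ^ e * (b : ℚ)

/-!
The value of `Kbar` at two small vertices `u`, `v` is a sum, over the segments of the elongated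
graph of `u`, of the form `triK`. On a triangle, `triK` is up to a bilinear form `n` times a
concave piecewise linear function, so that `triK * triQ` can be computed by second differences
(`sum_triK_mul_triQ`). The contributions of consecutive segments telescope, and only those at the
vertex itself and at the ends of its elongated graph on the boundary are left:
`Kbar * Qbar = n • A` with the *end matrix* `A`, which is `-2` at the vertex and counts the ends
(`Kbar_mul_Qbar`). Since `Kbar` is Green's function of the second difference on the boundary, also
`Kbar * (bdryMatrix - Qbar) = 2 n` (`Kbar_mul_invMatrix`). Hence `Pbar = n • (A * Kbarᵀ)`, where `Kbar` is
invertible modulo the odd primes that do not divide `n`.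

Such a matrix is handled by `IsSkewNormalForm.eqUpToTwo`: up to powers of `2`, its invariant
factors are determined by the corank of `A` modulo the odd primes and by the size of the range of
`A * Kbarᵀ` modulo the odd divisors `d` of `n`.

* A vector in the kernel of `A` modulo an odd prime is determined by its values on the boundary.
  These may be arbitrary except for a symmetry under the passage from a boundary edge to the
  preceding one, `prevEdge`, so that they can be counted on each boundary component, the result
  depending on the parity of its length (`card_ker_modMul_endMatrix`).
* Modulo `d`, the rows of `Kbar` generate the *balanced* vectors: they are linear on each face,
  and correspond to the cocycles on the edges (`range_balancedHom`). Since every function on the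
  faces is a coboundary, there are `d ^ r` of them (`card_cocycles`). Those in the kernel of `A`
  are antiperiodic along the boundary and determined by their values there, and there are `d ^ t`
  of them (`card_boundaryDetermined`). This leaves `d ^ (r - t)` elements in the range.

As skew-symmetric matrices have even rank modulo odd primes, these counts show as well that
`r - t` and the difference of the number of vertices and the corank are even
(`Matrix.even_finrank_range_modMul`).

The matrix `P` is treated in the same way. In the extended triangulation, the change of variables
makes `Kbar` vanish on the sides `e 2` of the attached triangles, so that the identities for
`Kbar` carry over to `K`, with the end matrix replaced by its composition with the change of
variables. The vectors in the kernel of the latter are given by antiperiodic values on the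
boundary, in each of the `n - 1` positions (`card_ker_modMul_endMatrixX`), and the rows of `K`
modulo `d` correspond to the cocycles of the original triangulation (`range_balancedX`).
-/

open Finset

/-! ### The standard triangle -/

namespace SmallVertex

variable {n : ℕ}

theorem coord_sum (c : SmallVertex n) : c.coord 0 + c.coord 1 + c.coord 2 = n := c.2

theorem coord_sum' (c : SmallVertex n) (a : Fin 3) :
    c.coord a + c.coord (a + 1) + c.coord (a + 2) = n := by
  have := c.coord_sum
  fin_cases a <;> simp <;> omega

theorem coord_lt (c : SmallVertex n) (a : Fin 3) : c.coord a < n := (c.1 a).2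

theorem coord_injective : Function.Injective (coord : SmallVertex n → Fin 3 → ℕ) := by
  intro c d h
  apply Subtype.ext
  funext a
  exact Fin.ext (congrFun h a)

theorem eq_of_coord {c d : SmallVertex n} (a : Fin 3) (h : c.coord a = d.coord a)
    (h' : c.coord (a + 1) = d.coord (a + 1)) : c = d := by
  apply coord_injective
  have hc := c.coord_sum
  have hd := d.coord_sum
  funext b
  fin_cases a <;> fin_cases b <;> simp at * <;> omega

/-- The small vertex with given barycentric coordinates. -/
def ofCoord (c : Fin 3 → ℕ) (hc : ∀ a, c a < n) (hs : c 0 + c 1 + c 2 = n) : SmallVertex n :=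
  ⟨fun a => ⟨c a, hc a⟩, hs⟩

@[simp]
theorem coord_ofCoord (c : Fin 3 → ℕ) (hc : ∀ a, c a < n) (hs : c 0 + c 1 + c 2 = n) :
    (ofCoord c hc hs).coord = c := rfl

end SmallVertex

section LocalForms

variable {n : ℕ} {R : Type*} [CommRing R]

/-- A sum over the small vertices of a function supported at one integral point of the triangle. The
point may be a corner, where `F` vanishes, or lie outside of the triangle. -/
theorem sum_smallVertex_ite (F : ℤ → ℤ → ℤ → R) (h0 : F n 0 0 = 0) (h1 : F 0 n 0 = 0)
    (h2 : F 0 0 n = 0) {x y z : ℤ} (hs : x + y + z = n) (w : R) :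
    ∑ d : SmallVertex n, F (d.coord 0) (d.coord 1) (d.coord 2) *
      (if (d.coord 0 : ℤ) = x ∧ (d.coord 1 : ℤ) = y ∧ (d.coord 2 : ℤ) = z then w else 0) =
      if 0 ≤ x ∧ 0 ≤ y ∧ 0 ≤ z then F x y z * w else 0 := by
  by_cases h : (0 ≤ x ∧ 0 ≤ y ∧ 0 ≤ z) ∧ x < n ∧ y < n ∧ z < n
  · obtain ⟨⟨hx, hy, hz⟩, hx', hy', hz'⟩ := h
    lift x to ℕ using hx
    lift y to ℕ using hy
    lift z to ℕ using hz
    norm_cast at hx' hy' hz' hs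
    let d0 : SmallVertex n := SmallVertex.ofCoord ![x, y, z]
      (by intro a; fin_cases a <;> simpa) (by simpa using hs)
    rw [Finset.sum_eq_single d0]
    · simp [d0]
    · intro d _ hd
      rw [if_neg, mul_zero]
      rintro ⟨e0, e1, -⟩
      exact hd (SmallVertex.eq_of_coord 0 (by simpa [d0] using e0) (by simpa [d0] using e1))
    · simp
  · rw [Finset.sum_eq_zero]
    · split_ifs with hp
      · obtain ⟨hx, hy, hz⟩ := hp
        have : (x = n ∧ y = 0 ∧ z = 0) ∨ (x = 0 ∧ y = n ∧ z = 0) ∨ (x = 0 ∧ y = 0 ∧ z = n) := by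
          omega
        rcases this with ⟨rfl, rfl, rfl⟩ | ⟨rfl, rfl, rfl⟩ | ⟨rfl, rfl, rfl⟩ <;> simp [*]
      · rfl
    · intro d _
      rw [if_neg, mul_zero]
      rintro ⟨e0, e1, e2⟩
      have a0 := d.coord_lt 0
      have a1 := d.coord_lt 1
      have a2 := d.coord_lt 2
      omega

theorem smallArrow_iff (c d : Fin 3 → ℕ) : SmallArrow c d ↔
    (c 0 = d 0 + 1 ∧ d 2 = c 2 + 1 ∧ d 1 = c 1) ∨ (c 1 = d 1 + 1 ∧ d 0 = c 0 + 1 ∧ d 2 = c 2) ∨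
      (c 2 = d 2 + 1 ∧ d 1 = c 1 + 1 ∧ d 0 = c 0) := by
  simp [SmallArrow, Fin.exists_fin_succ]

/-- The weight of a small edge whose two ends have the same coordinate `x` in one position: it is
`1` on the boundary of the triangle. -/
def edgeWeight (x : ℤ) : ℤ := if x = 0 then 1 else 2

set_option maxHeartbeats 1000000 in
theorem triQ_eq_sum (c d : Fin 3 → ℕ) :
    triQ c d =
      (if (c 0 : ℤ) = d 0 + 1 ∧ (c 1 : ℤ) = d 1 ∧ (c 2 : ℤ) = d 2 - 1 then edgeWeight (d 1) else 0)
      + (if (c 0 : ℤ) = d 0 - 1 ∧ (c 1 : ℤ) = d 1 + 1 ∧ (c 2 : ℤ) = d 2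
          then edgeWeight (d 2) else 0)
      + (if (c 0 : ℤ) = d 0 ∧ (c 1 : ℤ) = d 1 - 1 ∧ (c 2 : ℤ) = d 2 + 1
          then edgeWeight (d 0) else 0)
      + (if (c 0 : ℤ) = d 0 - 1 ∧ (c 1 : ℤ) = d 1 ∧ (c 2 : ℤ) = d 2 + 1
          then -edgeWeight (d 1) else 0)
      + (if (c 0 : ℤ) = d 0 + 1 ∧ (c 1 : ℤ) = d 1 - 1 ∧ (c 2 : ℤ) = d 2
          then -edgeWeight (d 2) else 0)
      + (if (c 0 : ℤ) = d 0 ∧ (c 1 : ℤ) = d 1 + 1 ∧ (c 2 : ℤ) = d 2 - 1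
          then -edgeWeight (d 0) else 0)
      := by
  have hw : (∃ a, c a = 0 ∧ d a = 0) ↔
      (c 0 = 0 ∧ d 0 = 0) ∨ (c 1 = 0 ∧ d 1 = 0) ∨ (c 2 = 0 ∧ d 2 = 0) := by
    simp [Fin.exists_fin_succ]
  unfold triQ edgeWeight
  simp only [smallArrow_iff, hw]
  generalize c 0 = c0
  generalize c 1 = c1
  generalize c 2 = c2
  generalize d 0 = d0
  generalize d 1 = d1
  generalize d 2 = d2
  by_cases h1 : c0 = d0 + 1 ∧ d2 = c2 + 1 ∧ d1 = c1
  · obtain ⟨rfl, rfl, rfl⟩ := h1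
    have : (d1 : ℤ) ≠ d1 + 1 := by omega
    have : (d1 : ℤ) ≠ d1 - 1 := by omega
    have : (d0 : ℤ) + 1 ≠ d0 - 1 := by omega
    simp [*]
  by_cases h2 : c1 = d1 + 1 ∧ d0 = c0 + 1 ∧ d2 = c2
  · obtain ⟨rfl, rfl, rfl⟩ := h2
    have : (c0 : ℤ) ≠ c0 + 1 + 1 := by omega
    have : (d1 : ℤ) + 1 ≠ d1 - 1 := by omega
    have : (d2 : ℤ) ≠ d2 + 1 := by omega
    have : (d2 : ℤ) ≠ d2 - 1 := by omega
    simp [*]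
  by_cases h3 : c2 = d2 + 1 ∧ d1 = c1 + 1 ∧ d0 = c0
  · obtain ⟨rfl, rfl, rfl⟩ := h3
    have : (c1 : ℤ) ≠ c1 + 1 + 1 := by omega
    have : (d2 : ℤ) + 1 ≠ d2 - 1 := by omega
    have : (d0 : ℤ) ≠ d0 + 1 := by omega
    have : (d0 : ℤ) ≠ d0 - 1 := by omega
    simp [*]
  rw [if_neg (fun h => h.elim h1 fun h => h.elim h2 h3)]
  rw [if_neg (c := (c0 : ℤ) = d0 + 1 ∧ (c1 : ℤ) = d1 ∧ (c2 : ℤ) = d2 - 1) (by omega),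
    if_neg (c := (c0 : ℤ) = d0 - 1 ∧ (c1 : ℤ) = d1 + 1 ∧ (c2 : ℤ) = d2) (by omega),
    if_neg (c := (c0 : ℤ) = d0 ∧ (c1 : ℤ) = d1 - 1 ∧ (c2 : ℤ) = d2 + 1) (by omega)]
  by_cases h4 : d0 = c0 + 1 ∧ c2 = d2 + 1 ∧ c1 = d1
  · obtain ⟨rfl, rfl, rfl⟩ := h4
    have : (c0 : ℤ) ≠ c0 + 1 + 1 := by omega
    simp [*]
  by_cases h5 : d1 = c1 + 1 ∧ c0 = d0 + 1 ∧ c2 = d2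
  · obtain ⟨rfl, rfl, rfl⟩ := h5
    have : (d0 : ℤ) + 1 ≠ d0 - 1 := by omega
    simp [*]
  by_cases h6 : d2 = c2 + 1 ∧ c1 = d1 + 1 ∧ c0 = d0
  · obtain ⟨rfl, rfl, rfl⟩ := h6
    have : (c0 : ℤ) ≠ c0 - 1 := by omega
    simp [*]
  rw [if_neg (fun h => h.elim h4 fun h => h.elim h5 h6), if_neg (by omega), if_neg (by omega),
      if_neg (by omega)]
  simp

/-- A sum against a column of the matrix of the triangle, written out over the six neighbours. The
function `F` is zero at the three corners, which are not small vertices. -/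
theorem sum_mul_triQ (F : ℤ → ℤ → ℤ → R) (h0 : F n 0 0 = 0) (h1 : F 0 n 0 = 0)
    (h2 : F 0 0 n = 0) (v : SmallVertex n) {x y z : ℤ} (hx : (v.coord 0 : ℤ) = x)
    (hy : (v.coord 1 : ℤ) = y) (hz : (v.coord 2 : ℤ) = z) :
    ∑ d : SmallVertex n, F (d.coord 0) (d.coord 1) (d.coord 2) * (triQ d.coord v.coord : R) =
      (if 1 ≤ z then F (x + 1) y (z - 1) * (edgeWeight y : R) else 0)
      + (if 1 ≤ x then F (x - 1) (y + 1) z * (edgeWeight z : R) else 0)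
      + (if 1 ≤ y then F x (y - 1) (z + 1) * (edgeWeight x : R) else 0)
      - (if 1 ≤ x then F (x - 1) y (z + 1) * (edgeWeight y : R) else 0)
      - (if 1 ≤ y then F (x + 1) (y - 1) z * (edgeWeight z : R) else 0)
      - (if 1 ≤ z then F x (y + 1) (z - 1) * (edgeWeight x : R) else 0) := by
  have hs : x + y + z = n := by
    have := v.coord_sum
    omega
  have key : ∀ x' y' z' w : ℤ, x' + y' + z' = n →
      ∑ d : SmallVertex n, F (d.coord 0) (d.coord 1) (d.coord 2) *
      ((if (d.coord 0 : ℤ) = x' ∧ (d.coord 1 : ℤ) = y' ∧ (d.coord 2 : ℤ) = z'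
          then w else 0 : ℤ) : R)
      = if 0 ≤ x' ∧ 0 ≤ y' ∧ 0 ≤ z' then F x' y' z' * w else 0 := by
    intro x' y' z' w h
    rw [← sum_smallVertex_ite F h0 h1 h2 h]
    refine Finset.sum_congr rfl fun d _ => ?_
    split_ifs <;> simp
  simp only [triQ_eq_sum, Int.cast_add, mul_add, Finset.sum_add_distrib, hx, hy, hz]
  rw [key _ _ _ _ (by omega), key _ _ _ _ (by omega), key _ _ _ _ (by omega),
    key _ _ _ _ (by omega), key _ _ _ _ (by omega), key _ _ _ _ (by omega)]
  have e1 : (0 ≤ x + 1 ∧ 0 ≤ y ∧ 0 ≤ z - 1) ↔ 1 ≤ z := by omega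
  have e2 : (0 ≤ x - 1 ∧ 0 ≤ y + 1 ∧ 0 ≤ z) ↔ 1 ≤ x := by omega
  have e3 : (0 ≤ x ∧ 0 ≤ y - 1 ∧ 0 ≤ z + 1) ↔ 1 ≤ y := by omega
  have e4 : (0 ≤ x - 1 ∧ 0 ≤ y ∧ 0 ≤ z + 1) ↔ 1 ≤ x := by omega
  have e5 : (0 ≤ x + 1 ∧ 0 ≤ y - 1 ∧ 0 ≤ z) ↔ 1 ≤ y := by omega
  have e6 : (0 ≤ x ∧ 0 ≤ y + 1 ∧ 0 ≤ z - 1) ↔ 1 ≤ z := by omega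
  simp only [e1, e2, e3, e4, e5, e6]
  have hneg : ∀ (p : Prop) [Decidable p] (s : R) (w : ℤ),
      (if p then s * ((-w : ℤ) : R) else 0) = -(if p then s * (w : R) else 0) := by
    intro p _ s w
    split_ifs <;> simp
  simp only [hneg]
  ring

/-- Up to a bilinear form, `triK` is `n` times a minimum of linear functions, so that it can be
differentiated without distinguishing the cases of its definition. -/
theorem triK_eq_min (c d : Fin 3 → ℕ) (hcd : c 0 + c 1 + c 2 = n) (hd : d 0 + d 1 + d 2 = n) :
    triK c d = n * min ((d 0 : ℤ) + c 1) (min (d 0 + d 1) (c 0 + c 1)) -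
      (c 0 * d 0 + c 1 * d 0 + c 1 * d 1) := by
  have hn : (n : ℤ) = c 0 + c 1 + c 2 := by exact_mod_cast hcd.symm
  have hd2 : (d 2 : ℤ) = c 0 + c 1 + c 2 - d 0 - d 1 := by omega
  simp only [triK, Fin.isValue]
  simp only [show (1 : Fin 3) + 1 = 2 from rfl, show (1 : Fin 3) + 2 = 0 from rfl,
    show (2 : Fin 3) + 1 = 0 from rfl, show (2 : Fin 3) + 2 = 1 from rfl, zero_add]
  split_ifs with h1 h2
  · rw [min_eq_left (by omega), hd2, hn]; ring
  · rw [min_eq_left (by omega : (d 0 : ℤ) + d 1 ≤ c 0 + c 1), min_eq_right (by omega), hn]; ring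
  · rw [min_eq_right (by omega : (c 0 : ℤ) + c 1 ≤ d 0 + d 1), min_eq_right (by omega), hd2,
      hn]; ring

/-- The value of `triK` at a vertex of a side, as a function of one coordinate `p` of the first
argument and one coordinate `q` of the second one: Green's function of the second difference on
`0, …, n`. -/
def greenSide (n p q : ℕ) : ℤ := min (p : ℤ) q * (n - max (p : ℤ) q)

theorem triK_of_side (c d : Fin 3 → ℕ) (hc : c 0 + c 1 + c 2 = n) (hd : d 0 + d 1 + d 2 = n)
    (a : Fin 3) (ha : d (a + 2) = 0) : triK c d = greenSide n (c a) (d a) := by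
  rw [triK_eq_min c d hc hd, greenSide]
  have hn : (n : ℤ) = c 0 + c 1 + c 2 := by exact_mod_cast hc.symm
  have hd2 : (d 2 : ℤ) = c 0 + c 1 + c 2 - d 0 - d 1 := by omega
  fin_cases a
  · change d 2 = 0 at ha
    have hd1 : (d 1 : ℤ) = c 0 + c 1 + c 2 - d 0 := by omega
    simp only [Fin.zero_eta, Fin.isValue]
    rcases le_total (c 0) (d 0) with h | h
    · rw [min_eq_right (by omega : (c 0 : ℤ) + c 1 ≤ d 0 + d 1), min_eq_right (by omega),
        min_eq_left (by omega), max_eq_right (by omega), hd1, hn]; ring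
    · rw [min_eq_left (by omega), min_eq_right (by omega), max_eq_left (by omega), hd1, hn]; ring
  · change d 0 = 0 at ha
    simp only [Fin.mk_one, Fin.isValue, ha, Nat.cast_zero, zero_add] at hd2 ⊢
    rw [← min_assoc, min_eq_left (by omega : min (c 1 : ℤ) (d 1) ≤ c 0 + c 1)]
    rcases le_total (c 1) (d 1) with h | h
    · rw [min_eq_left (by omega), max_eq_right (by omega), hn]; ring
    · rw [min_eq_right (by omega), max_eq_left (by omega), hn]; ring
  · change d 1 = 0 at ha
    simp only [Fin.reduceFinMk, Fin.isValue, ha, Nat.cast_zero, add_zero] at hd2 ⊢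
    have hd0 : (d 0 : ℤ) = c 0 + c 1 + c 2 - d 2 := by omega
    rcases le_total (c 2) (d 2) with h | h
    · rw [min_eq_left (by omega : (d 0 : ℤ) ≤ c 0 + c 1), min_eq_right (by omega),
        min_eq_left (by omega), max_eq_right (by omega), hd0, hn]; ring
    · rw [min_eq_right (by omega : (c 0 : ℤ) + c 1 ≤ d 0), min_eq_right (by omega),
        min_eq_right (by omega), max_eq_left (by omega), hd0, hn]; ring

theorem greenSide_symm {p q p' q' : ℕ} (hp : p + p' = n) (hq : q + q' = n) :
    greenSide n p q = greenSide n p' q' := by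
  have hp' : (n : ℤ) = p + p' := by exact_mod_cast hp.symm
  have hq' : (q' : ℤ) = p + p' - q := by omega
  unfold greenSide
  rcases le_total p q with h | h
  · rw [min_eq_left (by omega), max_eq_right (by omega), min_eq_right (by omega),
      max_eq_left (by omega), hp', hq']; ring
  · rw [min_eq_right (by omega), max_eq_left (by omega), min_eq_left (by omega),
      max_eq_right (by omega), hp', hq']; ring

theorem greenSide_zero_left (n q : ℕ) : greenSide n 0 q = 0 := by simp [greenSide]

theorem greenSide_zero_right (n p : ℕ) : greenSide n p 0 = 0 := by simp [greenSide]

theorem greenSide_self_right {n p : ℕ} (hp : p ≤ n) : greenSide n p n = 0 := by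
  unfold greenSide
  rw [max_eq_right (by omega)]
  simp

/-- The second difference of Green's function. -/
theorem greenSide_second_difference {p q : ℕ} (hq : 1 ≤ q) :
    2 * greenSide n p q - greenSide n p (q - 1) - greenSide n p (q + 1) =
      if p = q then (n : ℤ) else 0 := by
  obtain ⟨q, rfl⟩ := Nat.exists_eq_add_of_le' hq
  unfold greenSide
  simp only [Nat.add_sub_cancel]
  push_cast
  rcases lt_trichotomy p (q + 1) with h | rfl | h
  · rw [min_eq_left (by omega), max_eq_right (by omega), min_eq_left (by omega),
      max_eq_right (by omega), min_eq_left (by omega), max_eq_right (by omega), if_neg (by omega)]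
    ring
  · push_cast
    rw [min_eq_left (by omega), max_eq_left (by omega), min_eq_right (by omega),
      max_eq_left (by omega), min_eq_left (by omega), max_eq_right (by omega), if_pos rfl]
    ring
  · rw [min_eq_right (by omega), max_eq_left (by omega), min_eq_right (by omega),
      max_eq_left (by omega), min_eq_right (by omega), max_eq_left (by omega), if_neg (by omega)]
    ring

/-- Linear functions are harmonic for the matrix of the triangle, also at its sides, provided that
they vanish at the corners. -/
theorem sum_linear_mul_triQ (p q s : R) (hp : n * p = 0) (hq : n * q = 0) (hs : n * s = 0)
    (v : SmallVertex n) :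
    ∑ d : SmallVertex n, (d.coord 0 * p + d.coord 1 * q + d.coord 2 * s : R) *
      (triQ d.coord v.coord : R) = 0 := by
  obtain ⟨x, hx⟩ : ∃ x : ℤ, (v.coord 0 : ℤ) = x := ⟨_, rfl⟩
  obtain ⟨y, hy⟩ : ∃ y : ℤ, (v.coord 1 : ℤ) = y := ⟨_, rfl⟩
  obtain ⟨z, hz⟩ : ∃ z : ℤ, (v.coord 2 : ℤ) = z := ⟨_, rfl⟩
  have := sum_mul_triQ (n := n) (fun x y z => (x * p + y * q + z * s : R)) (by simpa using hp)
    (by simpa using hq) (by simpa using hs) v hx hy hz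
  simp only [Int.cast_natCast] at this
  rw [this]
  have hv := v.coord_sum
  have b0 := v.coord_lt 0
  have b1 := v.coord_lt 1
  have b2 := v.coord_lt 2
  have h10 : ¬ (1 : ℤ) ≤ 0 := by norm_num
  by_cases h0 : x = 0
  · have h1 : 1 ≤ y := by omega
    have h2 : 1 ≤ z := by omega
    have hny : ¬ y = 0 := by omega
    have hnz : ¬ z = 0 := by omega
    simp only [h0, h1, h2, h10, edgeWeight, hny, hnz, if_true, if_false]
    push_cast
    ring
  by_cases h1 : y = 0
  · have h0 : 1 ≤ x := by omega
    have h2 : 1 ≤ z := by omega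
    have hnx : ¬ x = 0 := by omega
    have hnz : ¬ z = 0 := by omega
    simp only [h0, h1, h2, h10, edgeWeight, hnx, hnz, if_true, if_false]
    push_cast
    ring
  by_cases h2 : z = 0
  · have h0 : 1 ≤ x := by omega
    have h1 : 1 ≤ y := by omega
    have hnx : ¬ x = 0 := by omega
    have hny : ¬ y = 0 := by omega
    simp only [h0, h1, h2, h10, edgeWeight, hnx, hny, if_true, if_false]
    push_cast
    ring
  · simp only [(by omega : 1 ≤ x), (by omega : 1 ≤ y), (by omega : 1 ≤ z), edgeWeight, h0, h1, h2,
      if_true, if_false]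
    push_cast
    ring

/-- The concave piecewise linear function of `(d 0 - c 0, d 2 - c 2)` to which `triK c d` reduces,
up to a bilinear form. -/
def kink (X Z : ℤ) : ℤ := min 0 (min X (-Z))

theorem kink_of_nonneg {X Z : ℤ} (hX : 0 ≤ X) (hZ : Z ≤ 0) : kink X Z = 0 := by
  unfold kink; omega

theorem kink_eq_left {X Z : ℤ} (hX : X ≤ 0) (hZ : X + Z ≤ 0) : kink X Z = X := by
  unfold kink; omega

theorem kink_eq_right {X Z : ℤ} (hX : 0 ≤ Z) (hZ : 0 ≤ X + Z) : kink X Z = -Z := by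
  unfold kink; omega

/-! The following four identities are the alternating sums of `kink` over the neighbours of a point
in the interior of the triangle, and on its sides `x = 0`, `y = 0` and `z = 0`. -/

theorem kink_interior (X Z : ℤ) :
    kink (X + 1) (Z - 1) + kink (X - 1) Z + kink X (Z + 1) - kink (X - 1) (Z + 1) -
      kink (X + 1) Z - kink X (Z - 1) = -(if X = 0 ∧ Z = 0 then 1 else 0) := by
  rcases lt_trichotomy X 0 with hX | hX | hX <;> rcases lt_trichotomy Z 0 with hZ | hZ | hZ <;>
  rcases lt_trichotomy (X + Z) 0 with hY | hY | hY <;>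
  first
  | omega
  | (simp (disch := omega) only [kink_of_nonneg, kink_eq_left, kink_eq_right]
     split_ifs <;> omega)

theorem kink_side_zero (X Z : ℤ) (hs : X ≤ 0) :
    2 * kink (X + 1) (Z - 1) + kink X (Z + 1) - 2 * kink (X + 1) Z - kink X (Z - 1) =
      -2 * (if X = 0 ∧ Z = 0 then 1 else 0) + (if X + Z = 0 then 1 else 0) := by
  rcases lt_or_eq_of_le hs with hX | hX <;> rcases lt_trichotomy Z 0 with hZ | hZ | hZ <;>
  rcases lt_trichotomy (X + Z) 0 with hY | hY | hY <;>
  first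
  | omega
  | (simp (disch := omega) only [kink_of_nonneg, kink_eq_left, kink_eq_right]
     split_ifs <;> omega)

theorem kink_side_one (X Z : ℤ) (hs : 0 ≤ X + Z) :
    kink (X + 1) (Z - 1) + 2 * kink (X - 1) Z - kink (X - 1) (Z + 1) - 2 * kink X (Z - 1) =
      -2 * (if X = 0 ∧ Z = 0 then 1 else 0) + (if Z = 0 then 1 else 0) := by
  rcases lt_trichotomy X 0 with hX | hX | hX <;> rcases lt_trichotomy Z 0 with hZ | hZ | hZ <;>
  rcases lt_or_eq_of_le hs with hY | hY <;>
  first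
  | omega
  | (simp (disch := omega) only [kink_of_nonneg, kink_eq_left, kink_eq_right]
     split_ifs <;> omega)

theorem kink_side_two (X Z : ℤ) (hs : Z ≤ 0) :
    kink (X - 1) Z + 2 * kink X (Z + 1) - 2 * kink (X - 1) (Z + 1) - kink (X + 1) Z =
      -2 * (if X = 0 ∧ Z = 0 then 1 else 0) + (if X = 0 then 1 else 0) := by
  rcases lt_trichotomy X 0 with hX | hX | hX <;> rcases lt_or_eq_of_le hs with hZ | hZ <;>
  rcases lt_trichotomy (X + Z) 0 with hY | hY | hY <;>
  first
  | omega
  | (simp (disch := omega) only [kink_of_nonneg, kink_eq_left, kink_eq_right]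
     split_ifs <;> omega)

/-- The row of `c` in the product of the form `triK` and the matrix `triQ` of the triangle: up to
the factor `n`, it is `-2` at `c`, and `1` at the end points of the edges leaving from `c` on the
sides. -/
theorem sum_triK_mul_triQ (c : Fin 3 → ℕ) (hc : c 0 + c 1 + c 2 = n) (hlt : ∀ a, c a < n)
    (v : SmallVertex n) :
    ∑ d : SmallVertex n, triK c d.coord * triQ d.coord v.coord =
      n * (-2 * (if c = v.coord then 1 else 0) +
        ∑ a : Fin 3, if v.coord a = c a ∧ v.coord (a + 2) = 0 then 1 else 0) := by
  have hcz : (c 0 : ℤ) + c 1 + c 2 = n := by exact_mod_cast hc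
  have l0 := hlt 0
  have l1 := hlt 1
  have l2 := hlt 2
  obtain ⟨x, hx⟩ : ∃ x : ℤ, (v.coord 0 : ℤ) = x := ⟨_, rfl⟩
  obtain ⟨y, hy⟩ : ∃ y : ℤ, (v.coord 1 : ℤ) = y := ⟨_, rfl⟩
  obtain ⟨z, hz⟩ : ∃ z : ℤ, (v.coord 2 : ℤ) = z := ⟨_, rfl⟩
  have hv := v.coord_sum
  have b0 := v.coord_lt 0
  have b1 := v.coord_lt 1
  have b2 := v.coord_lt 2
  have h10 : ¬ (1 : ℤ) ≤ 0 := by norm_num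
  -- The form `triK c` is extended to the corners by its expression as a minimum, and is zero there.
  have key := sum_mul_triQ (n := n) (R := ℤ)
    (fun x y z => n * (c 0 + c 1 + kink (x - c 0) (z - c 2)) - (c 0 * x + c 1 * x + c 1 * y))
    (by rw [kink_of_nonneg (by omega) (by omega), ← hcz]; ring)
    (by rw [kink_eq_left (by omega) (by omega)]; ring)
    (by rw [kink_eq_right (by omega) (by omega), ← hcz]; ring) v hx hy hz
  have hl : ∑ d : SmallVertex n, triK c d.coord * triQ d.coord v.coord =
      ∑ d : SmallVertex n, ((n : ℤ) * (c 0 + c 1 + kink (d.coord 0 - c 0) (d.coord 2 - c 2)) -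
        (c 0 * d.coord 0 + c 1 * d.coord 0 + c 1 * d.coord 1)) * triQ d.coord v.coord := by
    refine Finset.sum_congr rfl fun d _ => ?_
    have hd := d.coord_sum
    have e : min ((d.coord 0 : ℤ) + c 1) (min (d.coord 0 + d.coord 1) (c 0 + c 1)) =
        c 0 + c 1 + kink (d.coord 0 - c 0) (d.coord 2 - c 2) := by
      unfold kink
      omega
    rw [triK_eq_min c d.coord hc d.coord_sum, e]
  rw [hl]
  simp only [Int.cast_id] at key
  rw [key]
  obtain ⟨X, hX⟩ : ∃ X : ℤ, x = X + c 0 := ⟨x - c 0, by omega⟩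
  obtain ⟨Z, hZ⟩ : ∃ Z : ℤ, z = Z + c 2 := ⟨z - c 2, by omega⟩
  have hcv : c = v.coord ↔ X = 0 ∧ Z = 0 := by
    constructor
    · rintro rfl
      omega
    · rintro ⟨h0, h2⟩
      funext a
      fin_cases a <;> simp <;> omega
  have f0 : v.coord 0 = c 0 ↔ X = 0 := by omega
  have f1 : v.coord 1 = c 1 ↔ X + Z = 0 := by omega
  have f2 : v.coord 2 = c 2 ↔ Z = 0 := by omega
  have g0 : v.coord 0 = 0 ↔ x = 0 := by omega
  have g1 : v.coord 1 = 0 ↔ y = 0 := by omega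
  have g2 : v.coord 2 = 0 ↔ z = 0 := by omega
  have p0 : x - c 0 = X := by omega
  have p1 : x + 1 - c 0 = X + 1 := by omega
  have p2 : x - 1 - c 0 = X - 1 := by omega
  have q0 : z - c 2 = Z := by omega
  have q1 : z + 1 - c 2 = Z + 1 := by omega
  have q2 : z - 1 - c 2 = Z - 1 := by omega
  rw [if_congr hcv rfl rfl, Fin.sum_univ_three]
  simp only [show (1 : Fin 3) + 2 = 0 from rfl, show (2 : Fin 3) + 2 = 1 from rfl, zero_add, f0, f1,
    f2, g0, g1, g2, p0, p1, p2, q0, q1, q2, edgeWeight]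
  by_cases h0 : x = 0
  · have h1 : 1 ≤ y := by omega
    have h2 : 1 ≤ z := by omega
    have hy0 : ¬ y = 0 := by omega
    have hz0 : ¬ z = 0 := by omega
    simp only [h1, h2, h10, h0, hy0, hz0, if_true, if_false, and_true, and_false, zero_add,
        add_zero]
    rw [← kink_side_zero X Z (by omega)]
    ring
  by_cases h1 : y = 0
  · have h2 : 1 ≤ x := by omega
    have h3 : 1 ≤ z := by omega
    have hz0 : ¬ z = 0 := by omega
    simp only [h2, h3, h10, h0, h1, hz0, if_true, if_false, and_true, and_false, zero_add, add_zero]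
    rw [← kink_side_one X Z (by omega)]
    ring
  by_cases h2 : z = 0
  · have h3 : 1 ≤ x := by omega
    have h4 : 1 ≤ y := by omega
    simp only [h3, h4, h10, h0, h1, h2, if_true, if_false, and_true, and_false, zero_add, add_zero]
    rw [← kink_side_two X Z (by omega)]
    ring
  · have h3 : 1 ≤ x := by omega
    have h4 : 1 ≤ y := by omega
    have h5 : 1 ≤ z := by omega
    simp only [h3, h4, h5, h0, h1, h2, if_true, if_false, and_false, add_zero]
    rw [neg_mul, ← mul_neg, ← kink_interior X Z]
    ring

end LocalForms

/-! ### Turning left until the boundary is reached -/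

namespace IdealTriangulation

variable {F : Type*} (T : IdealTriangulation F)

theorem rot_injective : Function.Injective (rot : F × Fin 3 → F × Fin 3) := by
  rintro ⟨f, a⟩ ⟨g, b⟩ h
  simp only [rot, Prod.mk.injEq, add_left_inj] at h
  simp [h.1, h.2]

theorem glue_injective : Function.Injective T.glue := fun x y h => by
  rw [← T.glue_glue x, h, T.glue_glue]

theorem glue_ne_iff {h : F × Fin 3} : T.glue (T.glue h) ≠ T.glue h ↔ T.glue h ≠ h := by
  rw [T.glue_glue, ne_comm]

theorem not_transGen_of_boundary {h h' : F × Fin 3} (hb : T.glue h = h) :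
    ¬ Relation.TransGen T.Step h h' := by
  rw [Relation.TransGen.head'_iff]
  rintro ⟨_, ⟨h1, _⟩, _⟩
  exact h1 hb

theorem transGen_iff {h h' : F × Fin 3} (hb : T.glue h ≠ h) :
    Relation.TransGen T.Step h h' ↔
      h' = rot (T.glue h) ∨ Relation.TransGen T.Step (rot (T.glue h)) h' := by
  rw [Relation.TransGen.head'_iff, ← Relation.reflTransGen_iff_eq_or_transGen]
  constructor
  · rintro ⟨c, ⟨_, rfl⟩, hc⟩
    exact hc
  · exact fun hc => ⟨_, ⟨hb, rfl⟩, hc⟩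

variable {T}

/-- Induction along the paths of left turns, which end at the boundary. -/
theorem side_induction (hT : T.NoInteriorPuncture) {p : F × Fin 3 → Prop}
    (hb : ∀ h, T.glue h = h → p h)
    (hs : ∀ h, T.glue h ≠ h → p (rot (T.glue h)) → p h) (h : F × Fin 3) : p h := by
  obtain ⟨b, hb', hr⟩ := hT h
  induction hr using Relation.ReflTransGen.head_induction_on with
  | refl => exact hb _ hb'
  | head hst _ ih =>
    obtain ⟨h1, rfl⟩ := hst
    exact hs _ h1 ih

theorem not_transGen_self (hT : T.NoInteriorPuncture) (h : F × Fin 3) :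
    ¬ Relation.TransGen T.Step h h := by
  induction h using side_induction hT with
  | hb h hb => exact T.not_transGen_of_boundary hb
  | hs h hb ih =>
    intro hh
    refine ih ?_
    rcases (T.transGen_iff hb).1 hh with h1 | h1
    · exact Relation.TransGen.single ⟨by rwa [← h1], by rw [← h1]; exact h1⟩
    · exact h1.tail ⟨hb, rfl⟩

variable (hT : T.NoInteriorPuncture)

/-- The boundary edge through which one leaves the surface if, from the side `h` on, one turns left
in every face. -/
noncomputable def exit (h : F × Fin 3) : T.BoundaryEdge :=
  ⟨(hT h).choose, (hT h).choose_spec.1⟩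

theorem reflTransGen_exit (h : F × Fin 3) : Relation.ReflTransGen T.Step h (exit hT h).1 :=
  (hT h).choose_spec.2

theorem exit_eq_of_reflTransGen {h : F × Fin 3} {b : T.BoundaryEdge}
    (hb : Relation.ReflTransGen T.Step h b.1) : exit hT h = b := by
  have hU : Relator.RightUnique T.Step := by
    rintro _ _ _ ⟨_, rfl⟩ ⟨_, rfl⟩
    rfl
  apply Subtype.ext
  rcases Relation.ReflTransGen.total_of_right_unique hU hb (reflTransGen_exit hT h) with h1 | h1
  · rcases Relation.reflTransGen_iff_eq_or_transGen.1 h1 with h2 | h2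
    · exact h2
    · exact (T.not_transGen_of_boundary b.2 h2).elim
  · rcases Relation.reflTransGen_iff_eq_or_transGen.1 h1 with h2 | h2
    · exact h2.symm
    · exact (T.not_transGen_of_boundary (exit hT h).2 h2).elim

theorem exit_eq_iff {h : F × Fin 3} {b : T.BoundaryEdge} :
    exit hT h = b ↔ Relation.ReflTransGen T.Step h b.1 :=
  ⟨fun e => e ▸ reflTransGen_exit hT h, exit_eq_of_reflTransGen hT⟩

theorem exit_boundary (b : T.BoundaryEdge) : exit hT b.1 = b :=
  exit_eq_of_reflTransGen hT .refl

theorem exit_of_boundary {h : F × Fin 3} (hb : T.glue h = h) : (exit hT h).1 = h :=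
  congrArg Subtype.val (exit_boundary hT ⟨h, hb⟩)

/-- The path of left turns from `h` continues in the adjacent face. -/
theorem exit_rot_glue {h : F × Fin 3} (hb : T.glue h ≠ h) :
    exit hT (rot (T.glue h)) = exit hT h :=
  ((exit_eq_iff hT).2 ((reflTransGen_exit hT (rot (T.glue h))).head ⟨hb, rfl⟩)).symm

open Classical in
/-- If what is gained on entering a face is what was gained on leaving the preceding one, then the
sum along a path of left turns telescopes. -/
theorem add_sum_transGen [Fintype F] {M : Type*} [AddCommGroup M] (out inn : F × Fin 3 → M)
    (hoi : ∀ h, T.glue h ≠ h → inn (rot (T.glue h)) = out h) (h : F × Fin 3) :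
    out h + ∑ h', (if Relation.TransGen T.Step h h' then out h' - inn h' else 0) =
      out (exit hT h).1 := by
  induction h using side_induction hT with
  | hb h hb =>
    rw [Finset.sum_eq_zero, exit_of_boundary hT hb, add_zero]
    exact fun h' _ => if_neg (T.not_transGen_of_boundary hb)
  | hs h hb ih =>
    rw [← exit_rot_glue hT hb, ← ih]
    have : ∀ h', (if Relation.TransGen T.Step h h' then out h' - inn h' else 0) =
        (if h' = rot (T.glue h) then out h' - inn h' else 0) +
        (if Relation.TransGen T.Step (rot (T.glue h)) h' then out h' - inn h' else 0) := by
      intro h'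
      by_cases e : h' = rot (T.glue h)
      · subst e
        rw [if_pos ((T.transGen_iff hb).2 (Or.inl rfl)), if_pos rfl,
          if_neg (not_transGen_self hT _), add_zero]
      · rw [if_neg e, zero_add]
        exact if_congr ((T.transGen_iff hb).trans (or_iff_right e)) rfl rfl
    simp only [this, Finset.sum_add_distrib, Finset.sum_ite_eq', Finset.mem_univ, if_true, hoi h hb]
    abel

/-! ### Sums over the segments of an elongated graph -/

theorem arcCoord_self (n w : ℕ) (b : Fin 3) : arcCoord n w b b = w := by simp [arcCoord]

theorem arcCoord_add_two (n w : ℕ) (b : Fin 3) : arcCoord n w b (b + 2) = n - w := by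
  simp [arcCoord]

theorem arcCoord_add_one (n w : ℕ) (b : Fin 3) : arcCoord n w b (b + 1) = 0 := by
  simp [arcCoord]

theorem arcCoord_sum {n w : ℕ} (hw : w ≤ n) (b : Fin 3) :
    arcCoord n w b 0 + arcCoord n w b 1 + arcCoord n w b 2 = n := by
  fin_cases b <;> simp [arcCoord] <;> omega

theorem arcCoord_lt {n w : ℕ} (h0 : 0 < w) (hw : w < n) (a b : Fin 3) : arcCoord n w b a < n := by
  unfold arcCoord
  split_ifs <;> omega

open Classical in
/-- The sum of the values of `Φ` over the segments of the elongated graph of a small vertex `c` of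
the face `f`. -/
noncomputable def segSum (T : IdealTriangulation F) [Fintype F] {M : Type*} [AddCommGroup M] (n : ℕ)
    (Φ : F → (Fin 3 → ℕ) → M) (f : F) (c : Fin 3 → ℕ) : M :=
  Φ f c + ∑ a : Fin 3, if 0 < c a then
    ∑ h' : F × Fin 3, (if Relation.TransGen T.Step (f, a) h'
        then Φ h'.1 (arcCoord n (c a) h'.2) else 0)
  else 0

open Classical in
/-- A segment meets the side `s` of its face if it leaves the face through `s`, with its weight as
coordinate, or if it enters through `s`, with the complementary coordinate. -/
theorem apply_arcCoord_eq {M : Type*} [AddCommGroup M] {n : ℕ} (θ : ℕ → M) (h0 : θ 0 = 0)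
    (s h' : F × Fin 3) (w : ℕ) :
    (if h'.1 = s.1 then θ (arcCoord n w h'.2 s.2) else 0) =
      (if h' = s then θ w else 0) + (if h' = rot s then θ (n - w) else 0) := by
  obtain ⟨g', b⟩ := h'
  obtain ⟨g, a⟩ := s
  by_cases hg : g' = g
  · subst hg
    simp only [if_true, rot, Prod.mk.injEq, true_and]
    have : b = a ∨ b = a + 1 ∨ b = a + 2 := by
      revert a b; decide
    rcases this with rfl | rfl | rfl
    · simp [arcCoord_self]
    · have := arcCoord_add_two n w (a + 1)
      rw [show a + 1 + 2 = a by fin_cases a <;> rfl] at this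
      simp [this]
    · have := arcCoord_add_one n w (a + 2)
      rw [show a + 2 + 1 = a by fin_cases a <;> rfl] at this
      have h2 : a + 2 ≠ a + 1 := by fin_cases a <;> decide
      simp [this, h0, h2]
  · simp [hg, rot]

open Classical in
theorem sum_side_eq {M : Type*} [AddCommGroup M] (θ : ℕ → M) (h0 : θ 0 = 0) (s : F × Fin 3) (f : F)
    (c : Fin 3 → ℕ) :
    (∑ a : Fin 3, if 0 < c a then (if (f, a) = s then θ (c a) else 0) else 0) =
      if f = s.1 then θ (c s.2) else 0 := by
  obtain ⟨g, b⟩ := s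
  rw [Finset.sum_eq_single b]
  · rcases Nat.eq_zero_or_pos (c b) with h | h
    · simp [h, h0]
    · simp [h]
  · intro a _ hab
    simp [hab]
  · simp

section segSum

variable [Fintype F] {M : Type*} [AddCommGroup M] {n : ℕ}

open Classical in
theorem faceK_eq_segSum (f : F) (c : SmallVertex n) (g : F) (d : SmallVertex n) :
    T.faceK n f c g d =
      T.segSum n (fun g' y => if g' = g then triK y d.coord else 0) f c.coord := by
  unfold faceK segSum
  congr 1
  refine Finset.sum_congr rfl fun a _ => ?_
  refine if_congr Iff.rfl ?_ rfl
  rw [Fintype.sum_prod_type, Finset.sum_eq_single g]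
  · simp
  · intro g' _ hg
    simp [hg]
  · simp

theorem segSum_sub (Φ Ψ : F → (Fin 3 → ℕ) → M) (f : F) (c : Fin 3 → ℕ) :
    T.segSum n (fun g y => Φ g y - Ψ g y) f c = T.segSum n Φ f c - T.segSum n Ψ f c := by
  unfold segSum
  rw [add_sub_add_comm, ← Finset.sum_sub_distrib]
  congr 1
  refine Finset.sum_congr rfl fun a _ => ?_
  split_ifs
  · rw [← Finset.sum_sub_distrib]
    refine Finset.sum_congr rfl fun a _ => ?_
    split_ifs <;> simp
  · simp

theorem segSum_sum {ι : Type*} (s : Finset ι) (Φ : ι → F → (Fin 3 → ℕ) → M) (f : F)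
    (c : Fin 3 → ℕ) :
    T.segSum n (fun g y => ∑ i ∈ s, Φ i g y) f c = ∑ i ∈ s, T.segSum n (Φ i) f c := by
  unfold segSum
  rw [Finset.sum_add_distrib]
  congr 1
  rw [Finset.sum_comm]
  refine Finset.sum_congr rfl fun a _ => ?_
  split_ifs
  · rw [Finset.sum_comm]
    refine Finset.sum_congr rfl fun a _ => ?_
    split_ifs <;> simp
  · simp

theorem map_segSum {N : Type*} [AddCommGroup N] (φ : M →+ N) (Φ : F → (Fin 3 → ℕ) → M) (f : F)
    (c : Fin 3 → ℕ) :
    φ (T.segSum n Φ f c) = T.segSum n (fun g y => φ (Φ g y)) f c := by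
  unfold segSum
  rw [map_add, map_sum]
  congr 1
  refine Finset.sum_congr rfl fun a _ => ?_
  split_ifs
  · rw [map_sum]
    refine Finset.sum_congr rfl fun a _ => ?_
    split_ifs <;> simp
  · simp

/-- Two functions which agree on small vertices have the same sums over segments. -/
theorem segSum_congr {Φ Ψ : F → (Fin 3 → ℕ) → M}
    (h : ∀ g (y : SmallVertex n),
        Φ g y.coord = Ψ g y.coord) (f : F) (c : SmallVertex n) : T.segSum n Φ f c.coord =
        T.segSum n Ψ f c.coord := by
  unfold segSum
  rw [h]
  congr 1
  refine Finset.sum_congr rfl fun a _ => ?_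
  split_ifs with ha
  · refine Finset.sum_congr rfl fun h' _ => ?_
    have := h h'.1 (SmallVertex.ofCoord (arcCoord n (c.coord a) h'.2)
      (fun b => arcCoord_lt ha (c.coord_lt a) b _) (arcCoord_sum (c.coord_lt a).le _))
    simp only [SmallVertex.coord_ofCoord] at this
    rw [this]
  · rfl

/-- If the terms of the arc segments telescope, only those at the boundary and those at the main
segment are left of a sum over segments. -/
theorem segSum_of_telescope {Φ : F → (Fin 3 → ℕ) → M} {out inn : ℕ → F × Fin 3 → M}
    (hΦ : ∀ w h', 0 < w → w < n → Φ h'.1 (arcCoord n w h'.2) = out w h' - inn w h')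
    (hoi : ∀ w h, 0 < w → w < n → T.glue h ≠ h → inn w (rot (T.glue h)) = out w h)
    (f : F) (c : SmallVertex n) :
    T.segSum n Φ f c.coord = Φ f c.coord + ∑ a : Fin 3, if 0 < c.coord a then
      out (c.coord a) (exit hT (f, a)).1 - out (c.coord a) (f, a) else 0 := by
  unfold segSum
  congr 1
  refine Finset.sum_congr rfl fun a _ => ?_
  refine if_ctx_congr Iff.rfl (fun ha => ?_) (fun _ => rfl)
  have hn := c.coord_lt a
  rw [← add_sum_transGen hT (out (c.coord a)) (inn (c.coord a)) (fun h => hoi _ h ha hn) (f, a),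
    add_sub_cancel_left]
  simp only [hΦ _ _ ha hn]

open Classical in
/-- On a boundary side, a sum over segments only sees the ends of the elongated graph. -/
theorem segSum_side_boundary (θ : ℕ → M) (h0 : θ 0 = 0) {s : F × Fin 3} (hs : T.glue s = s) (f : F)
    (c : SmallVertex n) :
    T.segSum n (fun g y => if g = s.1 then θ (y s.2) else 0) f c.coord =
      ∑ a : Fin 3, if (exit hT (f, a)).1 = s then θ (c.coord a) else 0 := by
  rw [segSum_of_telescope hT (out := fun w h' => if h' = s then θ w else 0)
    (inn := fun w h' => - if h' = rot s then θ (n - w) else 0)]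
  · rw [← sum_side_eq θ h0 s f c.coord, ← Finset.sum_add_distrib]
    refine Finset.sum_congr rfl fun a _ => ?_
    rcases Nat.eq_zero_or_pos (c.coord a) with h | h
    · simp [h, h0]
    · simp [h]
  · intro w h' _ _
    rw [apply_arcCoord_eq θ h0, sub_neg_eq_add]
  · intro w h _ _ hb
    have h1 : T.glue h ≠ s := fun e => hb (by rw [← T.glue_glue h, e, hs, hs])
    have h2 : h ≠ s := fun e => hb (by rw [e, hs])
    simp [rot_injective.eq_iff, h1, h2]

open Classical in
/-- On the two sides of an interior edge, sums over segments agree. -/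
theorem segSum_side_glue (hT : T.NoInteriorPuncture) (θ θ' : ℕ → M) (h0 : θ 0 = 0) (h0' : θ' 0 = 0)
    (hθ : ∀ w, w ≤ n → θ' (n - w) = θ w) {s : F × Fin 3} (hs : T.glue s ≠ s) (f : F)
    (c : SmallVertex n) :
    T.segSum n (fun g y => if g = s.1 then θ (y s.2) else 0) f c.coord =
      T.segSum n (fun g y => if g = (T.glue s).1 then θ' (y (T.glue s).2) else 0) f c.coord := by
  rw [← sub_eq_zero, ← segSum_sub]
  have hθ' : ∀ w, w ≤ n → θ (n - w) = θ' w := by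
    intro w hw
    rw [← hθ _ (Nat.sub_le n w), Nat.sub_sub_self hw]
  rw [segSum_of_telescope hT
    (out := fun w h' => (if h' = s then θ w else 0) - (if h' = T.glue s then θ' w else 0))
    (inn := fun w h' =>
      (if h' = rot (T.glue s) then θ' (n - w) else 0) - (if h' = rot s then θ (n - w) else 0))]
  · rw [← sum_side_eq θ h0 s f c.coord, ← sum_side_eq θ' h0' (T.glue s) f c.coord,
      ← Finset.sum_sub_distrib, ← Finset.sum_add_distrib]
    refine Finset.sum_eq_zero fun a _ => ?_
    have h1 : (exit hT (f, a)).1 ≠ s := fun e => hs (e ▸ (exit hT (f, a)).2)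
    have h2 : (exit hT (f, a)).1 ≠ T.glue s :=
      fun e => T.glue_ne_iff.2 hs (e ▸ (exit hT (f, a)).2)
    simp only [h1, h2, if_false]
    split_ifs <;> simp
  · intro w h' _ _
    rw [apply_arcCoord_eq θ h0, apply_arcCoord_eq θ' h0']
    abel
  · intro w h _ hw hb
    simp only [rot_injective.eq_iff, hθ w hw.le, hθ' w hw.le]
    have : T.glue h = s ↔ h = T.glue s := by
      constructor <;> rintro rfl <;> simp [T.glue_glue]
    rw [if_congr this rfl rfl, if_congr T.glue_injective.eq_iff rfl rfl]

end segSum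

end IdealTriangulation

/-! ### Small vertices of the surface -/

namespace IdealTriangulation

variable {F : Type*} {T : IdealTriangulation F} {n : ℕ}

/-- A small vertex lies on at most one side, the corners being left out. -/
theorem SmallVertex.side_unique {c : SmallVertex n} {a b : Fin 3} (ha : c.coord (a + 2) = 0)
    (hb : c.coord (b + 2) = 0) : a = b := by
  have h := c.coord_sum
  have h0 := c.coord_lt 0
  have h1 := c.coord_lt 1
  have h2 := c.coord_lt 2
  fin_cases a <;> fin_cases b <;> simp at * <;> omega

theorem Glued.symm {x y : F × SmallVertex n} (h : T.Glued n x y) : T.Glued n y x := by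
  obtain ⟨a, a', h1, h2, h3, h4, h5, h6⟩ := h
  exact ⟨a', a, by rw [← h1, T.glue_glue], h2.symm, h4, h3, h6.symm, h5.symm⟩

theorem Glued.eq_of_trans {x y z : F × SmallVertex n} (h : T.Glued n x y) (h' : T.Glued n y z) :
    x = z := by
  obtain ⟨a, a', h1, -, h3, h4, h5, h6⟩ := h
  obtain ⟨b, b', k1, -, k3, k4, k5, k6⟩ := h'
  obtain rfl := SmallVertex.side_unique h4 k3
  rw [← h1, T.glue_glue, Prod.mk.injEq] at k1
  obtain ⟨e, rfl⟩ := k1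
  exact Prod.ext e (SmallVertex.eq_of_coord a (by omega) (by omega))

theorem vertex_eq_iff {f g : F} {c d : SmallVertex n} :
    T.vertex f c = T.vertex g d ↔ (f, c) = (g, d) ∨ T.Glued n (f, c) (g, d) := by
  constructor
  · intro h
    have h' := Quot.eqvGen_exact h
    generalize (f, c) = x at h'
    generalize (g, d) = y at h'
    induction h' with
    | rel x y h => exact Or.inr h
    | refl x => exact Or.inl rfl
    | symm x y _ ih => exact ih.imp Eq.symm Glued.symm
    | trans x y z _ _ ih1 ih2 =>
      rcases ih1 with rfl | ih1
      · exact ih2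
      · rcases ih2 with rfl | ih2
        · exact Or.inr ih1
        · exact Or.inl (ih1.eq_of_trans ih2)
  · rintro (h | h)
    · rw [Prod.mk.injEq] at h
      rw [h.1, h.2]
    · exact Quot.sound h

theorem exists_vertex (u : T.Vbar n) : ∃ f c, T.vertex f c = u := by
  induction u using Quot.ind with
  | mk x => exact ⟨x.1, x.2, rfl⟩

theorem fin_three_cases (a b : Fin 3) : a = b ∨ a = b + 1 ∨ a = b + 2 := by
  revert a b
  decide

theorem sum_fin_three {M : Type*} [AddCommMonoid M] (g : Fin 3 → M) (a : Fin 3) :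
    ∑ x, g x = g a + g (a + 1) + g (a + 2) := by
  rw [Fin.sum_univ_three]
  fin_cases a
  · rfl
  · simp only [Fin.mk_one, Fin.isValue, Fin.reduceAdd]
    abel
  · simp only [Fin.reduceFinMk, Fin.isValue, Fin.reduceAdd]
    abel

section

variable [Fintype F] {M : Type*} [AddCommGroup M]

/-- The elongated graph of a vertex on an interior edge is the same from both sides of the edge. -/
theorem segSum_glued (hT : T.NoInteriorPuncture) (Φ : F → (Fin 3 → ℕ) → M) {f g : F}
    {c d : SmallVertex n} (h : T.Glued n (f, c) (g, d)) :
    T.segSum n Φ f c.coord = T.segSum n Φ g d.coord := by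
  classical
  obtain ⟨a, a', h1, h2, h3, h4, h5, h6⟩ := h
  dsimp only at h1 h2 h3 h4 h5 h6
  -- The first arc segment of the edge that leaves `f` through the side of `c` is the main segment
  -- of `d`, and the remaining ones are those of an edge that starts at `d`.
  have key : ∀ {f g : F} {c d : SmallVertex n} {a a' : Fin 3}, T.glue (f, a) = (g, a') →
      (g, a') ≠ (f, a) → d.coord (a' + 2) = 0 → d.coord a' = c.coord (a + 1) →
      d.coord (a' + 1) = c.coord a → 0 < c.coord a →
      (∑ h' : F × Fin 3, if Relation.TransGen T.Step (f, a) h' then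
        Φ h'.1 (arcCoord n (c.coord a) h'.2) else 0) = Φ g d.coord +
      ∑ h' : F × Fin 3, if Relation.TransGen T.Step (g, a' + 1) h' then
        Φ h'.1 (arcCoord n (d.coord (a' + 1)) h'.2) else 0 := by
    intro f g c d a a' h1 h2 h4 h5 h6 h7
    have hb : T.glue (f, a) ≠ (f, a) := by rwa [h1]
    have h8 : rot (T.glue (f, a)) = (g, a' + 1) := by rw [h1]; rfl
    have h9 : arcCoord n (c.coord a) (a' + 1) = d.coord := by
      have := d.coord_sum' a'
      funext b
      rcases fin_three_cases b a' with rfl | rfl | rfl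
      · have e := arcCoord_add_two n (c.coord a) (b + 1)
        rw [show b + 1 + 2 = b by fin_cases b <;> rfl] at e
        omega
      · rw [arcCoord_self, h6]
      · have e := arcCoord_add_one n (c.coord a) (a' + 1)
        rw [show a' + 1 + 1 = a' + 2 by fin_cases a' <;> rfl] at e
        rw [e, h4]
    have : ∀ h', (if Relation.TransGen T.Step (f, a) h' then
          Φ h'.1 (arcCoord n (c.coord a) h'.2) else 0) =
        (if h' = (g, a' + 1) then Φ h'.1 (arcCoord n (c.coord a) h'.2) else 0) +
        (if Relation.TransGen T.Step (g, a' + 1) h' then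
          Φ h'.1 (arcCoord n (c.coord a) h'.2) else 0) := by
      intro h'
      rw [← h8]
      by_cases e : h' = rot (T.glue (f, a))
      · subst e
        rw [if_pos ((T.transGen_iff hb).2 (Or.inl rfl)), if_pos rfl,
          if_neg (not_transGen_self hT _), add_zero]
      · rw [if_neg e, zero_add]
        exact if_congr ((T.transGen_iff hb).trans (or_iff_right e)) rfl rfl
    simp only [this, Finset.sum_add_distrib, Finset.sum_ite_eq', Finset.mem_univ, if_true]
    rw [h9, h6]
  have h1' : T.glue (g, a') = (f, a) := by rw [← h1, T.glue_glue]
  have hc := c.coord_sum' a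
  have hc0 := c.coord_lt a
  have hc1 := c.coord_lt (a + 1)
  unfold segSum
  rw [sum_fin_three _ a, sum_fin_three _ a', if_pos (by omega), if_pos (by omega),
    if_neg (by omega), if_pos (by omega), if_pos (by omega), if_neg (by omega),
    key h1 h2 h4 h5 h6 (by omega), key h1' h2.symm h3 h6.symm h5.symm (by omega)]
  abel

theorem faceK_glued_left (hT : T.NoInteriorPuncture) {f f' : F} {c c' : SmallVertex n}
    (h : T.Glued n (f, c) (f', c')) (g : F) (d : SmallVertex n) :
    T.faceK n f c g d = T.faceK n f' c' g d := by
  rw [faceK_eq_segSum, faceK_eq_segSum, segSum_glued hT _ h]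

open Classical in
/-- At a vertex of a side, `faceK` only depends on the points where the segments meet the side. -/
theorem faceK_side (f : F) (c : SmallVertex n) {g : F} {d : SmallVertex n} {a : Fin 3}
    (hd : d.coord (a + 2) = 0) :
    T.faceK n f c g d =
      T.segSum n (fun g' y => if g' = g then greenSide n (y a) (d.coord a) else 0) f c.coord := by
  rw [faceK_eq_segSum]
  exact segSum_congr (M := ℤ) (fun g' y => if_congr Iff.rfl
    (triK_of_side _ _ y.coord_sum d.coord_sum a hd) rfl) f c

theorem faceK_glued_right (hT : T.NoInteriorPuncture) (f : F) (c : SmallVertex n) {g g' : F}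
    {d d' : SmallVertex n} (h : T.Glued n (g, d) (g', d')) :
    T.faceK n f c g d = T.faceK n f c g' d' := by
  obtain ⟨a, a', h1, h2, h3, h4, h5, h6⟩ := h
  dsimp only at h1 h2 h3 h4 h5 h6
  rw [faceK_side f c h3, faceK_side f c h4]
  have := segSum_side_glue (n := n) hT (fun w => greenSide n w (d.coord a))
    (fun w => greenSide n w (d'.coord a')) (greenSide_zero_left _ _) (greenSide_zero_left _ _)
    (fun w hw => greenSide_symm (by omega) (by have := d.coord_sum' a; omega)) (s := (g, a))
    (by rwa [h1]) f c
  rw [h1] at this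
  exact this

/-- The matrix `Kbar` can be computed from any representatives of the two vertices. -/
theorem Kbar_vertex (hT : T.NoInteriorPuncture) (f : F) (c : SmallVertex n) (g : F)
    (d : SmallVertex n) : T.Kbar n (T.vertex f c) (T.vertex g d) = T.faceK n f c g d := by
  have hu : T.vertex (Quot.out (T.vertex f c)).1 (Quot.out (T.vertex f c)).2 = T.vertex f c :=
    Quot.out_eq (T.vertex f c)
  have hv : T.vertex (Quot.out (T.vertex g d)).1 (Quot.out (T.vertex g d)).2 = T.vertex g d :=
    Quot.out_eq (T.vertex g d)
  unfold Kbar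
  have e1 : ∀ g d, T.faceK n (Quot.out (T.vertex f c)).1 (Quot.out (T.vertex f c)).2 g d =
      T.faceK n f c g d := by
    intro g d
    rcases vertex_eq_iff.1 hu with h | h
    · rw [Prod.mk.injEq] at h
      rw [h.1, h.2]
    · exact faceK_glued_left hT h g d
  rw [e1]
  rcases vertex_eq_iff.1 hv with h | h
  · rw [Prod.mk.injEq] at h
    rw [h.1, h.2]
  · exact faceK_glued_right hT f c h

end

/-! ### The product of `Kbar` and `Qbar` -/

section sideVal

variable {M : Type*} [AddCommMonoid M]

/-- The value of a function at the small vertex on the side `h = (g, a)` whose coordinate in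
position `a` is `w`. It is `0` by convention if `w` is `0` or at least `n`, when there is no such
vertex. -/
def sideVal (x : T.Vbar n → M) (h : F × Fin 3) (w : ℕ) : M :=
  ∑ d : SmallVertex n, if d.coord h.2 = w ∧ d.coord (h.2 + 2) = 0 then x (T.vertex h.1 d) else 0

theorem sideVal_zero (x : T.Vbar n → M) (h : F × Fin 3) : sideVal x h 0 = 0 := by
  refine Finset.sum_eq_zero fun d _ => if_neg ?_
  rintro ⟨h1, h2⟩
  have := d.coord_sum' h.2
  have := d.coord_lt (h.2 + 1)
  omega

theorem sideVal_of_le (x : T.Vbar n → M) (h : F × Fin 3) {w : ℕ} (hw : n ≤ w) :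
    sideVal x h w = 0 := by
  refine Finset.sum_eq_zero fun d _ => if_neg ?_
  rintro ⟨h1, h2⟩
  have := d.coord_lt h.2
  omega

theorem sideVal_coord (x : T.Vbar n → M) (g : F) {a : Fin 3} {d : SmallVertex n}
    (hd : d.coord (a + 2) = 0) : sideVal x (g, a) (d.coord a) = x (T.vertex g d) := by
  unfold sideVal
  rw [Finset.sum_eq_single d]
  · simp [hd]
  · intro d' _ hd'
    refine if_neg ?_
    rintro ⟨h1, h2⟩
    dsimp only at h1 h2
    refine hd' (SmallVertex.eq_of_coord a h1 ?_)
    have := d.coord_sum' a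
    have := d'.coord_sum' a
    omega
  · simp

/-- The small vertex on the side `e a` with coordinate `w` in position `a`. -/
def sideVertex (a : Fin 3) {w : ℕ} (h0 : 0 < w) (hw : w < n) : SmallVertex n :=
  SmallVertex.ofCoord (arcCoord n (n - w) (a + 1))
    (fun _ => arcCoord_lt (by omega) (by omega) _ _) (arcCoord_sum (by omega) _)

theorem sideVertex_coord (a : Fin 3) {w : ℕ} (h0 : 0 < w) (hw : w < n) :
    (sideVertex a h0 hw).coord a = w := by
  have := arcCoord_add_two n (n - w) (a + 1)
  rw [show a + 1 + 2 = a by fin_cases a <;> rfl] at this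
  rw [sideVertex, SmallVertex.coord_ofCoord, this]
  omega

theorem sideVertex_coord_add_one (a : Fin 3) {w : ℕ} (h0 : 0 < w) (hw : w < n) :
    (sideVertex a h0 hw).coord (a + 1) = n - w := arcCoord_self _ _ _

theorem sideVertex_coord_add_two (a : Fin 3) {w : ℕ} (h0 : 0 < w) (hw : w < n) :
    (sideVertex a h0 hw).coord (a + 2) = 0 := by
  rw [show a + 2 = a + 1 + 1 by fin_cases a <;> rfl]
  exact arcCoord_add_one _ _ _

theorem sideVal_eq (x : T.Vbar n → M) (h : F × Fin 3) {w : ℕ} (h0 : 0 < w) (hw : w < n) :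
    sideVal x h w = x (T.vertex h.1 (sideVertex h.2 h0 hw)) := by
  rw [← sideVal_coord x h.1 (sideVertex_coord_add_two h.2 h0 hw), sideVertex_coord]

theorem vertex_sideVertex_glue {h : F × Fin 3} (hb : T.glue h ≠ h) {w : ℕ} (h0 : 0 < w)
    (hw : w < n) (h0' : 0 < n - w) (hw' : n - w < n) :
    T.vertex (T.glue h).1 (sideVertex (T.glue h).2 h0' hw') =
      T.vertex h.1 (sideVertex h.2 h0 hw) := by
  refine vertex_eq_iff.2 (Or.inr ⟨(T.glue h).2, h.2, ?_, ?_, sideVertex_coord_add_two _ h0' hw',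
    sideVertex_coord_add_two _ h0 hw, ?_, ?_⟩)
  · exact T.glue_glue h
  · exact hb.symm
  · rw [sideVertex_coord, sideVertex_coord_add_one]
    omega
  · rw [sideVertex_coord, sideVertex_coord_add_one]

theorem sideVal_glue (x : T.Vbar n → M) {h : F × Fin 3} (hb : T.glue h ≠ h) {w : ℕ} (hw : w ≤ n) :
    sideVal x (T.glue h) (n - w) = sideVal x h w := by
  rcases Nat.eq_zero_or_pos w with rfl | h0
  · rw [sideVal_zero, sideVal_of_le]
    omega
  rcases hw.eq_or_lt with rfl | hw
  · rw [Nat.sub_self, sideVal_zero, sideVal_of_le _ _ le_rfl]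
  have h0' : 0 < n - w := by omega
  have hw' : n - w < n := by omega
  rw [sideVal_eq x h h0 hw, sideVal_eq x (T.glue h) h0' hw', vertex_sideVertex_glue hb h0 hw]

theorem sum_sideVertex (a : Fin 3) (θ : ℕ → M) :
    (∑ d : SmallVertex n, if d.coord (a + 2) = 0 then θ (d.coord a) else 0) =
      ∑ p ∈ Finset.Ioo 0 n, θ p := by
  rw [← Finset.sum_filter]
  refine Finset.sum_bij' (fun d _ => d.coord a)
    (fun p hp => sideVertex a (Finset.mem_Ioo.1 hp).1 (Finset.mem_Ioo.1 hp).2) ?_ ?_ ?_ ?_ ?_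
  · intro d hd
    have h := (Finset.mem_filter.1 hd).2
    have := d.coord_sum' a
    have := d.coord_lt (a + 1)
    have := d.coord_lt a
    exact Finset.mem_Ioo.2 (by omega)
  · intro p hp
    simp [sideVertex_coord_add_two]
  · intro d hd
    have h := (Finset.mem_filter.1 hd).2
    refine SmallVertex.eq_of_coord a (sideVertex_coord _ _ _) ?_
    rw [sideVertex_coord_add_one]
    have := d.coord_sum' a
    omega
  · intro p hp
    exact sideVertex_coord _ _ _
  · intro d hd
    rfl

end sideVal

section

variable [Fintype F]

open Classical in
/-- The bilinear form of a matrix on the small vertices of the surface which is a sum of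
zero-extensions of matrices on the small vertices of faces. -/
theorem sum_pushforward {ι : Type*} [Fintype ι] (g : ι → F)
    (w : ι → SmallVertex n → SmallVertex n → ℤ) {R : Type*} [CommRing R] (y x : T.Vbar n → R) :
    ∑ v, (∑ u, y u * ((∑ i, ∑ c, ∑ d, if T.vertex (g i) c = u ∧ T.vertex (g i) d = v then w i c d
      else 0 : ℤ) : R)) * x v =
    ∑ i, ∑ d, (∑ c, y (T.vertex (g i) c) * (w i c d : R)) * x (T.vertex (g i) d) := by
  simp only [Finset.mul_sum, Finset.sum_mul, Int.cast_sum]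
  have e1 : ∀ (v u : T.Vbar n) (i : ι) (c d : SmallVertex n),
      y u * ((if T.vertex (g i) c = u ∧ T.vertex (g i) d = v then w i c d else 0 : ℤ) : R) * x v =
      if T.vertex (g i) c = u then (if T.vertex (g i) d = v then
        y (T.vertex (g i) c) * (w i c d : R) * x (T.vertex (g i) d) else 0) else 0 := by
    intro v u i c d
    by_cases h1 : T.vertex (g i) c = u
    · by_cases h2 : T.vertex (g i) d = v
      · subst h1 h2
        simp
      · simp [h2]
    · simp [h1]
  simp only [e1]
  calc _ = ∑ v : T.Vbar n, ∑ i : ι, ∑ c : SmallVertex n, ∑ d : SmallVertex n,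
        (if T.vertex (g i) d = v then
          y (T.vertex (g i) c) * (w i c d : R) * x (T.vertex (g i) d) else 0) := by
          refine Finset.sum_congr rfl fun v _ => ?_
          rw [Finset.sum_comm]
          refine Finset.sum_congr rfl fun i _ => ?_
          rw [Finset.sum_comm]
          refine Finset.sum_congr rfl fun c _ => ?_
          rw [Finset.sum_comm]
          refine Finset.sum_congr rfl fun d _ => ?_
          simp
    _ = _ := by
          rw [Finset.sum_comm]
          refine Finset.sum_congr rfl fun i _ => ?_
          rw [Finset.sum_comm]
          conv_rhs => rw [Finset.sum_comm]
          refine Finset.sum_congr rfl fun c _ => ?_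
          rw [Finset.sum_comm]
          refine Finset.sum_congr rfl fun d _ => ?_
          simp

open Classical in
theorem sum_Kbar_mul_Qbar (hT : T.NoInteriorPuncture) (x : T.Vbar n → ℤ) (f : F)
    (c : SmallVertex n) :
    ∑ v, (T.Kbar n * T.Qbar n) (T.vertex f c) v * x v =
      T.segSum n (fun g y => ∑ d : SmallVertex n, (∑ c' : SmallVertex n,
        triK y c'.coord * triQ c'.coord d.coord) * x (T.vertex g d)) f c.coord := by
  have hL : ∑ v, (T.Kbar n * T.Qbar n) (T.vertex f c) v * x v =
      ∑ g : F, ∑ d : SmallVertex n, ∑ c' : SmallVertex n,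
        T.faceK n f c g c' * triQ c'.coord d.coord * x (T.vertex g d) := by
    have := sum_pushforward (fun g : F => g) (fun _ c d => triQ c.coord d.coord)
      (T.Kbar n (T.vertex f c)) x
    simp only [Int.cast_id, Kbar_vertex hT, Finset.sum_mul _ _ (x _)] at this
    rw [← this]
    simp only [Matrix.mul_apply, Qbar, Finset.sum_mul]
  rw [hL]
  simp only [faceK_eq_segSum]
  have e2 : ∀ (g : F) (d c' : SmallVertex n),
      T.segSum n (fun g' y => if g' = g then triK y c'.coord else 0) f c.coord *
        triQ c'.coord d.coord * x (T.vertex g d) =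
      T.segSum n (fun g' y => if g' = g then triK y c'.coord * triQ c'.coord d.coord *
        x (T.vertex g d) else 0) f c.coord := by
    intro g d c'
    rw [mul_assoc]
    have := map_segSum (T := T) (n := n) (AddMonoidHom.mulRight (triQ c'.coord d.coord *
        x (T.vertex g d)))
      (fun g' y => if g' = g then triK y c'.coord else 0) f c.coord
    simp only [AddMonoidHom.coe_mulRight] at this
    rw [this]
    congr 1
    funext g' y
    split_ifs <;> ring
  simp only [e2, ← segSum_sum]
  congr 1
  funext g' y
  rw [Finset.sum_eq_single g']
  · simp [Finset.sum_mul]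
  · intro g _ hg
    simp [hg.symm]
  · simp

/-- Multiplying by `Kbar * Qbar` only sees the vertex itself and the ends of its elongated graph. -/
theorem Kbar_mul_Qbar_apply (hT : T.NoInteriorPuncture) (x : T.Vbar n → ℤ) (f : F)
    (c : SmallVertex n) :
    ∑ v, (T.Kbar n * T.Qbar n) (T.vertex f c) v * x v =
      n * (-2 * x (T.vertex f c) + ∑ a, sideVal x (exit hT (f, a)).1 (c.coord a)) := by
  classical
  rw [sum_Kbar_mul_Qbar hT]
  have e1 : T.segSum n (fun g y => ∑ d : SmallVertex n, (∑ c' : SmallVertex n,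
        triK y c'.coord * triQ c'.coord d.coord) * x (T.vertex g d)) f c.coord =
      T.segSum n (fun g y => n * (-2 * (∑ d : SmallVertex n, if y = d.coord
          then x (T.vertex g d) else 0)
        + ∑ a, sideVal x (g, a) (y a))) f c.coord := by
    refine segSum_congr (fun g y => ?_) f c
    have : ∀ d : SmallVertex n, (∑ c' : SmallVertex n,
        triK y.coord c'.coord * triQ c'.coord d.coord) * x (T.vertex g d) =
        n * (-2 * (if y.coord = d.coord then x (T.vertex g d) else 0) +
        ∑ a : Fin 3, if d.coord a = y.coord a ∧ d.coord (a + 2) = 0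
            then x (T.vertex g d) else 0) := by
      intro d
      rw [sum_triK_mul_triQ _ y.coord_sum y.coord_lt, mul_assoc, add_mul, Finset.sum_mul]
      congr 2
      · split_ifs <;> simp
      · refine Finset.sum_congr rfl fun a _ => ?_
        split_ifs <;> simp
    simp only [this]
    rw [← Finset.mul_sum, Finset.sum_add_distrib, ← Finset.mul_sum, Finset.sum_comm]
    rfl
  rw [e1, segSum_of_telescope hT (out := fun w h => n * sideVal x h w)
    (inn := fun w h => n * sideVal x (h.1, h.2 + 2) (n - w))]
  · have e2 : (∑ d : SmallVertex n, if c.coord = d.coord then x (T.vertex f d) else 0) =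
        x (T.vertex f c) := by
      rw [Finset.sum_eq_single c]
      · simp
      · intro d _ hd
        exact if_neg fun h => hd (SmallVertex.coord_injective h.symm)
      · simp
    rw [e2, mul_add, add_assoc, mul_add]
    congr 1
    rw [Finset.mul_sum, Finset.mul_sum, ← Finset.sum_add_distrib]
    refine Finset.sum_congr rfl fun a _ => ?_
    rcases Nat.eq_zero_or_pos (c.coord a) with h | h
    · simp [h, sideVal_zero]
    · simp [h]
  · rintro w ⟨g, b⟩ h0 hw
    have e3 : (∑ d : SmallVertex n, if arcCoord n w b = d.coord then x (T.vertex g d) else 0) =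
        sideVal x (g, b + 2) (n - w) := by
      refine Finset.sum_congr rfl fun d _ => if_congr ?_ rfl rfl
      dsimp only
      rw [show b + 2 + 2 = b + 1 by fin_cases b <;> rfl]
      constructor
      · intro h
        rw [← h]
        exact ⟨arcCoord_add_two _ _ _, arcCoord_add_one _ _ _⟩
      · rintro ⟨h1, h2⟩
        have hd := d.coord_sum' b
        funext a
        rcases fin_three_cases a b with rfl | rfl | rfl
        · rw [arcCoord_self]; omega
        · rw [arcCoord_add_one, h2]
        · rw [arcCoord_add_two, h1]
    dsimp only
    rw [e3, sum_fin_three _ b, arcCoord_self, arcCoord_add_one, arcCoord_add_two, sideVal_zero]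
    ring
  · intro w h h0 hw hb
    rw [← sideVal_glue x hb hw.le]
    congr 2
    exact Prod.ext rfl (by simp only [rot]; rw [add_assoc]; simp)

end

end IdealTriangulation

/-! ### The inverse of `Kbar` up to a factor -/

namespace IdealTriangulation

variable {F : Type*} {T : IdealTriangulation F} {n : ℕ}

theorem pos_of_vbar (u : T.Vbar n) : 0 < n := by
  obtain ⟨f, c, -⟩ := exists_vertex u
  exact (Nat.zero_le _).trans_lt (c.coord_lt 0)

variable [Fintype F]

open Classical in
/-- The quotient of `Kbar * Qbar` by `n`: at a vertex `u`, it is `-2` at `u`, and counts the ends of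
the elongated graph of `u` on the boundary edges. -/
noncomputable def endMatrix (hT : T.NoInteriorPuncture) (n : ℕ) :
    Matrix (T.Vbar n) (T.Vbar n) ℤ := fun u v =>
  -2 * (if u = v then 1 else 0) + ∑ a, sideVal (fun w => if w = v then (1 : ℤ) else 0)
    (exit hT ((Quot.out u).1, a)).1 ((Quot.out u).2.coord a)

variable (hT : T.NoInteriorPuncture)

open Classical in
theorem Kbar_mul_Qbar_entry (hT : T.NoInteriorPuncture) (f : F) (c : SmallVertex n)
    (v : T.Vbar n) :
    (T.Kbar n * T.Qbar n) (T.vertex f c) v =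
      n * (-2 * (if T.vertex f c = v then 1 else 0) +
        ∑ a, sideVal (fun w => if w = v then (1 : ℤ) else 0) (exit hT (f, a)).1 (c.coord a)) := by
  have := Kbar_mul_Qbar_apply hT (fun w => if w = v then (1 : ℤ) else 0) f c
  simpa using this

theorem Kbar_mul_Qbar : T.Kbar n * T.Qbar n = (n : ℤ) • endMatrix hT n := by
  classical
  ext u v
  have hu : T.vertex (Quot.out u).1 (Quot.out u).2 = u := Quot.out_eq u
  have := Kbar_mul_Qbar_entry hT (Quot.out u).1 (Quot.out u).2 v
  rw [hu] at this
  rw [this, Matrix.smul_apply, smul_eq_mul]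
  rfl

open Classical in
theorem endMatrix_vertex (f : F) (c : SmallVertex n) (v : T.Vbar n) :
    endMatrix hT n (T.vertex f c) v = -2 * (if T.vertex f c = v then 1 else 0) +
      ∑ a, sideVal (fun w => if w = v then (1 : ℤ) else 0) (exit hT (f, a)).1 (c.coord a) := by
  have h1 := Kbar_mul_Qbar_entry hT f c v
  rw [Kbar_mul_Qbar hT, Matrix.smul_apply, smul_eq_mul] at h1
  have hn : (n : ℤ) ≠ 0 := by exact_mod_cast (pos_of_vbar v).ne'
  exact mul_left_cancel₀ hn h1

open Classical in
theorem sum_sideVal_single {R : Type*} [CommRing R] (x : T.Vbar n → R) (h : F × Fin 3) (w : ℕ) :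
    ∑ v, ((sideVal (fun u => if u = v then (1 : ℤ) else 0) h w : ℤ) : R) * x v = sideVal x h w := by
  simp only [sideVal, Int.cast_sum, Finset.sum_mul]
  rw [Finset.sum_comm]
  refine Finset.sum_congr rfl fun d _ => ?_
  split_ifs <;> simp

theorem endMatrix_mulVec {R : Type*} [CommRing R] (x : T.Vbar n → R) (f : F) (c : SmallVertex n) :
    ((endMatrix hT n).map (Int.cast : ℤ → R)).mulVec x (T.vertex f c) =
      -2 * x (T.vertex f c) + ∑ a, sideVal x (exit hT (f, a)).1 (c.coord a) := by
  classical
  simp only [Matrix.mulVec, dotProduct, Matrix.map_apply, endMatrix_vertex, Int.cast_add,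
    Int.cast_sum, add_mul, Finset.sum_mul, Finset.sum_add_distrib]
  congr 1
  · simp
  · rw [Finset.sum_comm]
    exact Finset.sum_congr rfl fun a _ => sum_sideVal_single x _ _

/-- The matrix of the second difference on `1, …, n - 1`. -/
def secondDiff (p q : ℕ) : ℤ := if p = q then 2 else if p + 1 = q ∨ q + 1 = p then -1 else 0

theorem sum_mul_secondDiff {R : Type*} [CommRing R] (θ : ℕ → R) (h0 : θ 0 = 0) (hn : θ n = 0)
    {q : ℕ} (hq : 0 < q) (hqn : q < n) :
    ∑ p ∈ Finset.Ioo 0 n, θ p * (secondDiff p q : R) = 2 * θ q - θ (q - 1) - θ (q + 1) := by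
  have e : ∀ p, θ p * (secondDiff p q : R) = (if p = q then 2 * θ p else 0) -
      (if p = q - 1 then θ p else 0) - (if p = q + 1 then θ p else 0) := by
    intro p
    unfold secondDiff
    rcases eq_or_ne p q with rfl | h1
    · rw [if_pos rfl, if_pos rfl, if_neg (by omega), if_neg (by omega)]
      push_cast
      ring
    rcases eq_or_ne p (q - 1) with rfl | h2
    · rw [if_neg h1, if_pos (by omega), if_neg h1, if_pos rfl, if_neg (by omega)]
      push_cast
      ring
    rcases eq_or_ne p (q + 1) with rfl | h3
    · rw [if_neg h1, if_pos (by omega), if_neg h1, if_neg h2, if_pos rfl]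
      push_cast
      ring
    · rw [if_neg h1, if_neg (by omega), if_neg h1, if_neg h2, if_neg h3]
      simp
  simp only [e, Finset.sum_sub_distrib, Finset.sum_ite_eq', Finset.mem_Ioo]
  rw [if_pos ⟨hq, hqn⟩]
  congr 1
  · congr 1
    split_ifs with h
    · rfl
    · rw [show q - 1 = 0 by omega, h0]
  · split_ifs with h
    · rfl
    · rw [show q + 1 = n by omega, hn]

open Classical in
/-- The sum over the boundary edges of the second difference along the edge. -/
noncomputable def bdryMatrix (T : IdealTriangulation F) (n : ℕ) : Matrix (T.Vbar n) (T.Vbar n) ℤ :=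
  fun u v => ∑ b : T.BoundaryEdge, ∑ c : SmallVertex n, ∑ d : SmallVertex n,
    if T.vertex b.1.1 c = u ∧ T.vertex b.1.1 d = v then
      (if c.coord (b.1.2 + 2) = 0 ∧ d.coord (b.1.2 + 2) = 0 then
        secondDiff (c.coord b.1.2) (d.coord b.1.2) else 0) else 0

theorem vecMul_bdryMatrix {R : Type*} [CommRing R] (y x : T.Vbar n → R) :
    ∑ v, (∑ u, y u * (bdryMatrix T n u v : R)) * x v =
      ∑ b : T.BoundaryEdge, ∑ d : SmallVertex n, if d.coord (b.1.2 + 2) = 0 then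
        (∑ p ∈ Finset.Ioo 0 n, sideVal y b.1 p * (secondDiff p (d.coord b.1.2) : R)) *
          x (T.vertex b.1.1 d) else 0 := by
  classical
  unfold bdryMatrix
  rw [sum_pushforward (fun b : T.BoundaryEdge => b.1.1)
    (fun b c d => if c.coord (b.1.2 + 2) = 0 ∧ d.coord (b.1.2 + 2) = 0 then
        secondDiff (c.coord b.1.2) (d.coord b.1.2) else 0) y x]
  refine Finset.sum_congr rfl fun b _ => Finset.sum_congr rfl fun d _ => ?_
  rw [← sum_sideVertex b.1.2]
  split_ifs with hd
  · congr 1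
    refine Finset.sum_congr rfl fun c _ => ?_
    by_cases hc : c.coord (b.1.2 + 2) = 0
    · rw [if_pos ⟨hc, hd⟩, if_pos hc, ← sideVal_coord y b.1.1 hc]
    · rw [if_neg fun h => hc h.1, if_neg hc]
      simp
  · rw [Finset.sum_eq_zero, zero_mul]
    intro c _
    rw [if_neg fun h => hd h.2]
    simp

open Classical in
/-- The value of `Kbar` at a vertex of the boundary. -/
theorem Kbar_boundary (hT : T.NoInteriorPuncture) (f : F) (c : SmallVertex n) (b : T.BoundaryEdge)
    {d : SmallVertex n} (hd : d.coord (b.1.2 + 2) = 0) :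
    T.Kbar n (T.vertex f c) (T.vertex b.1.1 d) =
      ∑ a, if exit hT (f, a) = b then greenSide n (c.coord a) (d.coord b.1.2) else 0 := by
  rw [Kbar_vertex hT, faceK_side f c hd]
  have := segSum_side_boundary (n := n) hT (fun w => greenSide n w (d.coord b.1.2))
    (greenSide_zero_left _ _) b.2 f c
  rw [this]
  refine Finset.sum_congr rfl fun a _ => if_congr ?_ rfl rfl
  exact Subtype.ext_iff.symm

theorem Kbar_mul_bdryMatrix_apply (hT : T.NoInteriorPuncture) (x : T.Vbar n → ℤ) (f : F)
    (c : SmallVertex n) :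
    ∑ v, (T.Kbar n * bdryMatrix T n) (T.vertex f c) v * x v =
      n * ∑ a, sideVal x (exit hT (f, a)).1 (c.coord a) := by
  classical
  have h1 := vecMul_bdryMatrix (T.Kbar n (T.vertex f c)) x
  simp only [Int.cast_id] at h1
  simp only [Matrix.mul_apply]
  rw [h1, Finset.mul_sum]
  have e1 : ∀ (b : T.BoundaryEdge) (d : SmallVertex n), (if d.coord (b.1.2 + 2) = 0 then
        (∑ p ∈ Finset.Ioo 0 n, sideVal (T.Kbar n (T.vertex f c)) b.1 p *
          secondDiff p (d.coord b.1.2)) * x (T.vertex b.1.1 d) else 0) =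
      ∑ a, if exit hT (f, a) = b then
        n * (if d.coord b.1.2 = c.coord a ∧ d.coord (b.1.2 + 2) = 0
            then x (T.vertex b.1.1 d) else 0)
        else 0 := by
    intro b d
    by_cases hd : d.coord (b.1.2 + 2) = 0
    · have hs := d.coord_sum' b.1.2
      have hl := d.coord_lt (b.1.2 + 1)
      rw [if_pos hd]
      have e2 : ∀ p ∈ Finset.Ioo 0 n, sideVal (T.Kbar n (T.vertex f c)) b.1 p *
          secondDiff p (d.coord b.1.2) = ∑ a, if exit hT (f, a) = b then
            greenSide n (c.coord a) p * secondDiff p (d.coord b.1.2) else 0 := by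
        intro p hp
        obtain ⟨hp0, hpn⟩ := Finset.mem_Ioo.1 hp
        rw [sideVal_eq _ _ hp0 hpn, Kbar_boundary hT f c b (sideVertex_coord_add_two _ _ _),
          sideVertex_coord, Finset.sum_mul]
        refine Finset.sum_congr rfl fun a _ => ?_
        split_ifs <;> simp
      rw [Finset.sum_congr rfl e2, Finset.sum_comm, Finset.sum_mul]
      refine Finset.sum_congr rfl fun a _ => ?_
      split_ifs with h1 h2
      · have := sum_mul_secondDiff (n := n) (R := ℤ) (fun p => greenSide n (c.coord a) p)
          (greenSide_zero_right _ _) (greenSide_self_right (c.coord_lt a).le)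
          (q := d.coord b.1.2) (by omega) (d.coord_lt _)
        simp only [Int.cast_id] at this
        rw [this, greenSide_second_difference (by omega), if_pos h2.1.symm]
      · have := sum_mul_secondDiff (n := n) (R := ℤ) (fun p => greenSide n (c.coord a) p)
          (greenSide_zero_right _ _) (greenSide_self_right (c.coord_lt a).le)
          (q := d.coord b.1.2) (by omega) (d.coord_lt _)
        simp only [Int.cast_id] at this
        rw [this, greenSide_second_difference (by omega), if_neg fun h => h2 ⟨h.symm, hd⟩]
        simp
      · simp
    · rw [if_neg hd, Finset.sum_eq_zero]
      intro a _
      simp [hd]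
  simp only [e1]
  rw [Finset.sum_congr rfl fun b _ => Finset.sum_comm, Finset.sum_comm]
  refine Finset.sum_congr rfl fun a _ => ?_
  rw [Finset.sum_eq_single (exit hT (f, a))]
  · simp only [if_true, sideVal, Finset.mul_sum]
  · intro b _ hb
    simp [hb.symm]
  · simp

/-- An integral inverse of `Kbar` up to the factor `2 n`. -/
noncomputable def invMatrix (T : IdealTriangulation F) (n : ℕ) : Matrix (T.Vbar n) (T.Vbar n) ℤ :=
  bdryMatrix T n - T.Qbar n

variable [DecidableEq (T.Vbar n)]

theorem Kbar_mul_invMatrix (hT : T.NoInteriorPuncture) :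
    T.Kbar n * invMatrix T n = (2 * n : ℤ) • (1 : Matrix (T.Vbar n) (T.Vbar n) ℤ) := by
  ext u v
  obtain ⟨f, c, rfl⟩ := exists_vertex u
  have h1 := Kbar_mul_bdryMatrix_apply hT (fun w => if w = v then (1 : ℤ) else 0) f c
  have h2 := Kbar_mul_Qbar_apply hT (fun w => if w = v then (1 : ℤ) else 0) f c
  simp only [mul_ite, mul_one, mul_zero, Finset.sum_ite_eq', Finset.mem_univ, if_true] at h1 h2
  rw [invMatrix, mul_sub, Matrix.sub_apply, h1, h2, Matrix.smul_apply, Matrix.one_apply]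
  split_ifs
  · simp
    ring
  · simp

/-- A left inverse up to a nonzero factor is a right inverse up to this factor, for integer matrices
that are square up to a relabelling. -/
theorem _root_.Matrix.mul_eq_smul_one_comm {V W : Type*} [Fintype V] [Fintype W] [DecidableEq V]
    [DecidableEq W] (hVW : Fintype.card V = Fintype.card W) {c : ℤ} (hc : c ≠ 0)
    {A : Matrix V W ℤ} {B : Matrix W V ℤ} (h : A * B = c • (1 : Matrix V V ℤ)) :
    B * A = c • (1 : Matrix W W ℤ) := by
  have hq : (c : ℚ) ≠ 0 := by exact_mod_cast hc
  have h1 : A.map (Int.cast : ℤ → ℚ) * ((c : ℚ)⁻¹ • B.map (Int.cast : ℤ → ℚ)) = 1 := by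
    have := congrArg (fun M : Matrix V V ℤ => M.map (Int.castRingHom ℚ)) h
    simp only [Matrix.map_mul] at this
    rw [Matrix.mul_smul]
    change (c : ℚ)⁻¹ • (A.map (Int.castRingHom ℚ) * B.map (Int.castRingHom ℚ)) = 1
    rw [this]
    ext i j
    simp only [Matrix.smul_apply, Matrix.map_apply, smul_eq_mul, Matrix.one_apply]
    split_ifs <;> simp [hq]
  have h2 := (Matrix.mul_eq_one_comm_of_card_eq V W ℚ hVW).1 h1
  rw [Matrix.smul_mul] at h2
  ext i j
  have h3 := congrFun (congrFun h2 i) j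
  rw [Matrix.smul_apply, smul_eq_mul, inv_mul_eq_iff_eq_mul₀ hq] at h3
  have h4 : (((B * A) i j : ℤ) : ℚ) = ((c • (1 : Matrix W W ℤ)) i j : ℤ) := by
    rw [Matrix.smul_apply, smul_eq_mul, Matrix.mul_apply]
    push_cast
    rw [Matrix.mul_apply] at h3
    simp only [Matrix.map_apply] at h3
    rw [h3, Matrix.one_apply, Matrix.one_apply]
    split_ifs <;> simp
  exact_mod_cast h4

end IdealTriangulation

/-! ### Cocycles -/

theorem AddMonoidHom.card_ker_mul_card_range {G H : Type*} [AddCommGroup G] [AddCommGroup H]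
    (f : G →+ H) : Nat.card f.ker * Nat.card f.range = Nat.card G := by
  rw [← AddSubgroup.index_ker, AddSubgroup.card_mul_index]

namespace IdealTriangulation

variable {F : Type*} (T : IdealTriangulation F) (R : Type*) [CommRing R]

/-- The functions on oriented edges: functions on the sides of the faces which change the sign when
one passes to the other side of an interior edge. -/
def cochains : Submodule R (F × Fin 3 → R) where
  carrier := {φ | ∀ h, T.glue h ≠ h → φ (T.glue h) = -φ h}
  add_mem' := fun {a b} ha hb h hh => by
    simp only [Pi.add_apply, ha h hh, hb h hh]
    ring
  zero_mem' := fun h _ => by simp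
  smul_mem' := fun r a ha h hh => by simp [ha h hh]

/-- The functions on oriented edges whose sum around each face is zero. -/
def cocycles : Submodule R (F × Fin 3 → R) where
  carrier := {φ | φ ∈ cochains T R ∧ ∀ f, φ (f, 0) + φ (f, 1) + φ (f, 2) = 0}
  add_mem' := fun {a b} ha hb => ⟨add_mem ha.1 hb.1, fun f => by
    have h1 := ha.2 f
    have h2 := hb.2 f
    simp only [Pi.add_apply]
    linear_combination h1 + h2⟩
  zero_mem' := ⟨zero_mem _, fun f => by simp⟩
  smul_mem' := fun r a ha => ⟨Submodule.smul_mem _ r ha.1, fun f => by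
    have h1 := ha.2 f
    simp only [Pi.smul_apply, smul_eq_mul]
    linear_combination r * h1⟩

variable {T R}

theorem edge_eq_iff {h h' : F × Fin 3} :
    (Quot.mk _ h : T.Edge) = Quot.mk _ h' ↔ h' = h ∨ h' = T.glue h := by
  constructor
  · intro e
    have h1 := Quot.eqvGen_exact e
    induction h1 with
    | rel x y h => exact Or.inr h.symm
    | refl x => exact Or.inl rfl
    | symm x y _ ih =>
      rcases ih (Quot.eqvGen_sound ‹_›) with rfl | rfl
      · exact Or.inl rfl
      · exact Or.inr (T.glue_glue x).symm
    | trans x y z h1 h2 ih1 ih2 =>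
      rcases ih1 (Quot.eqvGen_sound h1) with rfl | rfl
      · exact ih2 (Quot.eqvGen_sound h2)
      · rcases ih2 (Quot.eqvGen_sound h2) with rfl | rfl
        · exact Or.inr rfl
        · exact Or.inl (T.glue_glue x)
  · rintro (rfl | rfl)
    · rfl
    · exact Quot.sound rfl

theorem out_edge (h : F × Fin 3) : (Quot.mk _ h : T.Edge).out = h ∨
    (Quot.mk _ h : T.Edge).out = T.glue h := by
  have : (Quot.mk _ h : T.Edge) = Quot.mk _ (Quot.mk _ h : T.Edge).out := (Quot.out_eq _).symm
  exact edge_eq_iff.1 this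

open Classical in
/-- The cochain with given values on chosen orientations of the edges. -/
noncomputable def ofEdge (g : T.Edge → R) : F × Fin 3 → R := fun h =>
  if (Quot.mk _ h : T.Edge).out = h then g (Quot.mk _ h) else -g (Quot.mk _ h)

theorem ofEdge_mem (g : T.Edge → R) : ofEdge g ∈ cochains T R := by
  intro h hh
  have e : (Quot.mk _ (T.glue h) : T.Edge) = Quot.mk _ h :=
    (edge_eq_iff.2 (Or.inr rfl)).symm
  unfold ofEdge
  rw [e]
  rcases out_edge (T := T) h with h1 | h1
  · rw [h1, if_pos rfl, if_neg hh.symm]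
  · rw [h1, if_pos rfl, if_neg hh, neg_neg]

theorem ofEdge_out {φ : F × Fin 3 → R} (hφ : φ ∈ cochains T R) :
    ofEdge (fun e : T.Edge => φ e.out) = φ := by
  funext h
  unfold ofEdge
  dsimp only
  split_ifs with h1
  · rw [h1]
  · rcases out_edge (T := T) h with h2 | h2
    · exact (h1 h2).elim
    · rw [h2] at h1 ⊢
      rw [hφ h h1, neg_neg]

theorem card_cochains : Nat.card (cochains T R) = Nat.card (T.Edge → R) := by
  refine Nat.card_congr ⟨fun φ e => φ.1 e.out, fun g => ⟨ofEdge g, ofEdge_mem g⟩, ?_, ?_⟩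
  · intro φ
    exact Subtype.ext (ofEdge_out φ.2)
  · intro g
    funext e
    have : (Quot.mk _ e.out : T.Edge) = e := Quot.out_eq e
    simp only [ofEdge]
    rw [this, if_pos rfl]

open Classical in
/-- The coboundary map is onto: since the arcs around the punctures end at the boundary, the
function of a single face is the coboundary of such an arc. -/
theorem exists_cochain_single (hT : T.NoInteriorPuncture) (R : Type*) [CommRing R]
    (h : F × Fin 3) : ∃ φ ∈ cochains T R, ∀ f,
      φ (f, 0) + φ (f, 1) + φ (f, 2) = if f = h.1 then 1 else 0 := by
  have hsum : ∀ (h : F × Fin 3) (f : F), (if (f, (0 : Fin 3)) = h then (1 : R) else 0) +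
      (if (f, (1 : Fin 3)) = h then 1 else 0) + (if (f, (2 : Fin 3)) = h then 1 else 0) =
      if f = h.1 then 1 else 0 := by
    rintro ⟨g, a⟩ f
    by_cases hf : f = g
    · fin_cases a <;> simp [hf]
    · simp [hf]
  induction h using side_induction hT with
  | hb h hb =>
    refine ⟨fun h' => if h' = h then 1 else 0, ?_, fun f => hsum h f⟩
    intro h' hh
    have h1 : h' ≠ h := by
      rintro rfl
      exact hh hb
    have h2 : T.glue h' ≠ h := by
      rintro rfl
      exact T.glue_ne_iff.2 hh hb
    simp [h1, h2]
  | hs h hb ih =>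
    obtain ⟨φ, hφ, hs⟩ := ih
    refine ⟨φ + fun h' => (if h' = h then 1 else 0) - (if h' = T.glue h then 1 else 0),
      add_mem hφ ?_, ?_⟩
    · intro h' _
      have h1 : T.glue h' = h ↔ h' = T.glue h := by
        constructor <;> rintro rfl <;> simp [T.glue_glue]
      simp only [h1, T.glue_injective.eq_iff]
      ring
    · intro f
      have e1 : _ = if f = (T.glue h).1 then (1 : R) else 0 := hs f
      have e2 := hsum h f
      have e3 := hsum (T.glue h) f
      simp only [Pi.add_apply]
      linear_combination e1 + e2 - e3

/-- Every function on the faces is a coboundary, over any ring. -/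
theorem exists_cochain (hT : T.NoInteriorPuncture) [Finite F] (g : F → R) :
    ∃ φ ∈ cochains T R, ∀ f, φ (f, 0) + φ (f, 1) + φ (f, 2) = g f := by
  classical
  have := Fintype.ofFinite F
  choose φ hφ hs using fun f : F => exists_cochain_single hT R (f, 0)
  refine ⟨∑ f, g f • φ f, Submodule.sum_mem _ fun f _ => Submodule.smul_mem _ _ (hφ f), ?_⟩
  intro f
  simp only [Finset.sum_apply, Pi.smul_apply, smul_eq_mul, ← Finset.sum_add_distrib, ← mul_add, hs]
  simp

theorem card_cocycles (hT : T.NoInteriorPuncture) [Finite F] [Finite R] :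
    Nat.card (cocycles T R) * Nat.card R ^ Nat.card F = Nat.card R ^ Nat.card T.Edge := by
  let δ : cochains T R →+ (F → R) :=
    { toFun := fun φ f => φ.1 (f, 0) + φ.1 (f, 1) + φ.1 (f, 2)
      map_zero' := by funext f; simp
      map_add' := fun φ ψ => by funext f; simp; ring }
  have h1 := AddMonoidHom.card_ker_mul_card_range δ
  have h2 : δ.range = ⊤ := by
    rw [AddMonoidHom.range_eq_top]
    intro g
    obtain ⟨φ, hφ, hs⟩ := exists_cochain hT g
    exact ⟨⟨φ, hφ⟩, funext hs⟩
  have h3 : Nat.card δ.ker = Nat.card (cocycles T R) := by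
    refine Nat.card_congr ⟨fun φ => ⟨φ.1.1, φ.1.2, fun f => congrFun φ.2 f⟩,
      fun φ => ⟨⟨φ.1, φ.2.1⟩, funext φ.2.2⟩, fun _ => rfl, fun _ => rfl⟩
  rw [h2, h3, card_cochains, AddSubgroup.card_top, Nat.card_fun, Nat.card_fun] at h1
  exact h1

theorem map_mem_cocycles {S : Type*} [CommRing S] (ρ : R →+* S) {φ : F × Fin 3 → R}
    (hφ : φ ∈ cocycles T R) : (fun h => ρ (φ h)) ∈ cocycles T S := by
  refine ⟨fun h hh => ?_, fun f => ?_⟩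
  · dsimp only
    rw [hφ.1 h hh, map_neg]
  · rw [← map_add, ← map_add, hφ.2, map_zero]

/-- Cocycles modulo `d` lift to integral cocycles. -/
theorem exists_lift_cocycle (hT : T.NoInteriorPuncture) [Finite F] (d : ℕ)
    {φ : F × Fin 3 → ZMod d} (hφ : φ ∈ cocycles T (ZMod d)) :
    ∃ ψ ∈ cocycles T ℤ, ∀ h, (ψ h : ZMod d) = φ h := by
  choose g hg using fun e : T.Edge => ZMod.intCast_surjective (φ e.out)
  have h1 : ∀ h, ((ofEdge g h : ℤ) : ZMod d) = φ h := by
    intro h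
    rw [← ofEdge_out hφ.1]
    unfold ofEdge
    split_ifs <;> simp [hg]
  have h2 : ∀ f, (d : ℤ) ∣ ofEdge g (f, 0) + ofEdge g (f, 1) + ofEdge g (f, 2) := by
    intro f
    rw [← ZMod.intCast_zmod_eq_zero_iff_dvd]
    push_cast
    rw [h1, h1, h1, hφ.2]
  -- The coboundary of a lift as a cochain is divisible by `d`, and the quotient is a coboundary.
  choose k hk using h2
  obtain ⟨ψ, hψ, hs⟩ := exists_cochain hT (R := ℤ) k
  refine ⟨ofEdge g - (d : ℤ) • ψ,
    ⟨sub_mem (ofEdge_mem g) (Submodule.smul_mem _ _ hψ), fun f => ?_⟩, fun h => ?_⟩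
  · simp only [Pi.sub_apply, Pi.smul_apply, smul_eq_mul]
    linear_combination hk f - d * hs f
  · simp [h1]

/-! ### Balanced vectors -/

section balanced

variable {n : ℕ}

/-- The function on the small vertices which on each face is the linear function with the
differences given by a cocycle `φ`. It is well defined over rings in which `n = 0`. -/
noncomputable def balanced (n : ℕ) (φ : F × Fin 3 → R) (u : T.Vbar n) : R :=
  (Quot.out u).2.coord 0 * φ ((Quot.out u).1, 0) - (Quot.out u).2.coord 2 * φ ((Quot.out u).1, 1)

theorem coord_sum_cast (hn : (n : R) = 0) (c : SmallVertex n) (a : Fin 3) :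
    (c.coord a : R) + c.coord (a + 1) + c.coord (a + 2) = 0 := by
  have h := congrArg (Nat.cast : ℕ → R) (c.coord_sum' a)
  push_cast at h
  rw [h, hn]

/-- The coordinates can be permuted cyclically in the definition of `balanced`. -/
theorem balanced_rotate (hn : (n : R) = 0) {φ : F × Fin 3 → R} (hφ : φ ∈ cocycles T R) (f : F)
    (c : SmallVertex n) (a : Fin 3) :
    (c.coord 0 * φ (f, 0) - c.coord 2 * φ (f, 1) : R) =
      c.coord a * φ (f, a) - c.coord (a + 2) * φ (f, a + 1) := by
  have h1 := coord_sum_cast hn c 0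
  have h2 := hφ.2 f
  simp only [zero_add] at h1
  fin_cases a
  · simp
  · simp only [Fin.mk_one, Fin.isValue, show (1 : Fin 3) + 2 = 0 from rfl,
      show (1 : Fin 3) + 1 = 2 from rfl]
    linear_combination (c.coord 0 : R) * h2 - φ (f, 1) * h1
  · simp only [Fin.reduceFinMk, Fin.isValue, show (2 : Fin 3) + 2 = 1 from rfl,
      show (2 : Fin 3) + 1 = 0 from rfl]
    linear_combination φ (f, 0) * h1 - (c.coord 2 : R) * h2

theorem balanced_vertex (hn : (n : R) = 0) {φ : F × Fin 3 → R} (hφ : φ ∈ cocycles T R) (f : F)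
    (c : SmallVertex n) (a : Fin 3) :
    balanced (T := T) n φ (T.vertex f c) =
      c.coord a * φ (f, a) - c.coord (a + 2) * φ (f, a + 1) := by
  rw [← balanced_rotate hn hφ]
  have hu : T.vertex (Quot.out (T.vertex f c)).1 (Quot.out (T.vertex f c)).2 = T.vertex f c :=
    Quot.out_eq (T.vertex f c)
  unfold balanced
  rcases vertex_eq_iff.1 hu with h | h
  · rw [Prod.mk.injEq] at h
    rw [h.1, h.2]
  · obtain ⟨b, b', h1, h2, h3, h4, h5, h6⟩ := h
    dsimp only at h1 h2 h3 h4 h5 h6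
    rw [balanced_rotate hn hφ _ _ b, balanced_rotate hn hφ _ _ b', h3, h4]
    have h7 := hφ.1 _ (by rw [h1]; exact h2)
    rw [h1] at h7
    have h8 := coord_sum_cast hn c b'
    rw [h4, h6] at h8
    rw [h7]
    push_cast at h8 ⊢
    linear_combination φ ((Quot.out (T.vertex f c)).1, b) * h8

theorem sideVal_balanced (hn : (n : R) = 0) {φ : F × Fin 3 → R} (hφ : φ ∈ cocycles T R)
    (h : F × Fin 3) {w : ℕ} (hw : w ≤ n) :
    sideVal (balanced (T := T) n φ) h w = w * φ h := by
  rcases Nat.eq_zero_or_pos w with rfl | h0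
  · simp [sideVal_zero]
  rcases hw.eq_or_lt with rfl | hw
  · simp [sideVal_of_le, hn]
  rw [sideVal_eq _ _ h0 hw, balanced_vertex hn hφ _ _ h.2, sideVertex_coord,
    sideVertex_coord_add_two]
  simp

theorem balanced_add (φ ψ : F × Fin 3 → R) :
    balanced (T := T) n (φ + ψ) = balanced n φ + balanced n ψ := by
  funext u
  simp only [balanced, Pi.add_apply]
  ring

theorem balanced_smul (r : R) (φ : F × Fin 3 → R) :
    balanced (T := T) n (r • φ) = r • balanced n φ := by
  funext u
  simp only [balanced, Pi.smul_apply, smul_eq_mul]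
  ring

/-- The map from functions on oriented edges to functions on small vertices. -/
noncomputable def balancedHom (T : IdealTriangulation F) (R : Type*) [CommRing R] (n : ℕ) :
    (F × Fin 3 → R) →ₗ[R] (T.Vbar n → R) where
  toFun := balanced n
  map_add' := balanced_add
  map_smul' := balanced_smul

variable [Fintype F]

open Classical in
/-- The cocycle of a row of `Kbar`: its value on the side `(g, a)` is minus the sum of the
coordinates in position `a` of the segments in the face `g`. -/
noncomputable def rowCocycle (T : IdealTriangulation F) (R : Type*) [CommRing R] {n : ℕ} (f : F)
    (c : SmallVertex n) : F × Fin 3 → R := fun h =>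
  -T.segSum n (fun g y => if g = h.1 then (y h.2 : R) else 0) f c.coord

theorem rowCocycle_mem (hT : T.NoInteriorPuncture) (hn : (n : R) = 0) (f : F) (c : SmallVertex n) :
    rowCocycle T R f c ∈ cocycles T R := by
  classical
  refine ⟨fun h hh => ?_, fun g => ?_⟩
  · unfold rowCocycle
    rw [segSum_side_glue (n := n) hT (fun w => (w : R)) (fun w => -(w : R)) (by simp) (by simp)
      (fun w hw => by rw [Nat.cast_sub hw, hn]; ring) hh f c]
    have := map_segSum (T := T) (n := n) (negAddMonoidHom : R →+ R)
      (fun g y => if g = (T.glue h).1 then (y (T.glue h).2 : R) else 0) f c.coord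
    simp only [coe_negAddMonoidHom] at this
    rw [this, neg_neg]
    congr 1
    funext g y
    split_ifs <;> simp
  · unfold rowCocycle
    rw [← neg_add, ← neg_add, neg_eq_zero]
    have h1 := segSum_sum (T := T) (n := n) Finset.univ
      (fun (a : Fin 3) g' (y : Fin 3 → ℕ) => if g' = g then (y a : R) else 0) f c.coord
    rw [Fin.sum_univ_three] at h1
    rw [← h1]
    have h2 : T.segSum n (fun g' y => ∑ a, if g' = g then (y a : R) else 0) f c.coord =
        T.segSum n (fun _ _ => 0) f c.coord := by
      refine segSum_congr (fun g' y => ?_) f c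
      split_ifs
      · rw [Fin.sum_univ_three]
        exact coord_sum_cast hn y 0
      · simp
    rw [h2]
    unfold segSum
    simp

/-- Modulo `n`, the rows of `Kbar` are balanced. -/
theorem Kbar_row_eq_balanced (hT : T.NoInteriorPuncture) (hn : (n : R) = 0) (f : F)
    (c : SmallVertex n) (v : T.Vbar n) :
    (T.Kbar n (T.vertex f c) v : R) = balanced n (rowCocycle T R f c) v := by
  classical
  obtain ⟨g, d, rfl⟩ := exists_vertex v
  rw [balanced_vertex hn (rowCocycle_mem hT hn f c) g d 0, Kbar_vertex hT, faceK_eq_segSum]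
  have h0 := map_segSum (T := T) (n := n) (Int.castAddHom R)
    (fun g' y => if g' = g then triK y d.coord else 0) f c.coord
  refine h0.trans ?_
  have h1 := map_segSum (T := T) (n := n) (AddMonoidHom.mulLeft (d.coord 0 : R))
    (fun g' y => if g' = g then (y 0 : R) else 0) f c.coord
  have h2 := map_segSum (T := T) (n := n) (AddMonoidHom.mulLeft (d.coord 2 : R))
    (fun g' y => if g' = g then (y 1 : R) else 0) f c.coord
  simp only [AddMonoidHom.coe_mulLeft] at h1 h2
  simp only [rowCocycle, zero_add, mul_neg, h1, h2]
  rw [neg_sub_neg, ← segSum_sub]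
  refine segSum_congr (fun g' y => ?_) f c
  rw [Int.coe_castAddHom]
  split_ifs
  -- Modulo `n`, the form `triK` is bilinear.
  · rw [triK_eq_min _ _ y.coord_sum d.coord_sum]
    have h3 := coord_sum_cast hn d 0
    simp only [zero_add] at h3
    push_cast
    rw [hn]
    linear_combination (-(y.coord 1 : R)) * h3
  · simp

/-- Modulo `n`, balanced vectors are annihilated by `invMatrix`, since linear functions are
harmonic on the faces and have zero second differences along the boundary. -/
theorem balanced_vecMul_invMatrix (hn : (n : R) = 0) {φ : F × Fin 3 → R} (hφ : φ ∈ cocycles T R)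
    (v : T.Vbar n) : ∑ u, balanced n φ u * (invMatrix T n u v : R) = 0 := by
  classical
  have h1 := sum_pushforward (fun g : F => g) (fun _ c d => triQ c.coord d.coord)
    (balanced (T := T) n φ) (fun w => if w = v then 1 else 0)
  have h2 := vecMul_bdryMatrix (balanced (T := T) n φ) (fun w => if w = v then 1 else 0)
  simp only [mul_ite, mul_one, mul_zero, Finset.sum_ite_eq', Finset.mem_univ, if_true] at h1 h2
  have h3 : ∑ u, balanced n φ u * (T.Qbar n u v : R) = 0 := by
    refine h1.trans (Finset.sum_eq_zero fun g _ => Finset.sum_eq_zero fun d _ => ?_)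
    split_ifs
    · rw [← sum_linear_mul_triQ (φ (g, 0)) 0 (-φ (g, 1)) (by simp [hn]) (by simp) (by simp [hn]) d]
      refine Finset.sum_congr rfl fun c _ => ?_
      rw [balanced_vertex hn hφ g c 0]
      simp only [zero_add]
      ring
    · rfl
  have h4 : ∑ u, balanced n φ u * (bdryMatrix T n u v : R) = 0 := by
    refine h2.trans (Finset.sum_eq_zero fun b _ => Finset.sum_eq_zero fun d _ => ?_)
    split_ifs with hd
    · have hs := d.coord_sum' b.1.2
      have hl := d.coord_lt (b.1.2 + 1)
      have hl' := d.coord_lt b.1.2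
      rw [sum_mul_secondDiff _ (sideVal_zero _ _) (sideVal_of_le _ _ le_rfl) (by omega)
        (d.coord_lt _), sideVal_balanced hn hφ _ (by omega), sideVal_balanced hn hφ _ (by omega),
        sideVal_balanced hn hφ _ (by omega), Nat.cast_sub (by omega : 1 ≤ d.coord b.1.2)]
      push_cast
      ring
    · rfl
    · rfl
  simp only [invMatrix, Matrix.sub_apply, Int.cast_sub, mul_sub, Finset.sum_sub_distrib, h3, h4,
    sub_zero]

end balanced

end IdealTriangulation

/-! ### Boundary components -/

namespace IdealTriangulation

variable {F : Type*} {T : IdealTriangulation F} (hT : T.NoInteriorPuncture)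

theorem nextBoundary_iff {b b' : T.BoundaryEdge} :
    T.NextBoundary b b' ↔ exit hT (rot b'.1) = b := (exit_eq_iff hT).symm

/-- No left turn leads to the side following a boundary edge, so this side determines the whole path
of left turns that starts from it. -/
theorem exit_rot_injective :
    Function.Injective fun b : T.BoundaryEdge => exit hT (rot b.1) := by
  have key : ∀ {b b' : T.BoundaryEdge}, Relation.ReflTransGen T.Step (rot b.1) (rot b'.1) →
      b = b' := by
    intro b b' h
    rcases Relation.ReflTransGen.cases_tail h with h | ⟨c, -, h1, h2⟩
    · exact Subtype.ext (rot_injective h.symm)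
    · have e := rot_injective h2
      have e2 : T.glue b'.1 = c := by rw [e, T.glue_glue]
      rw [b'.2] at e2
      exact (h1 (by rw [← e, e2])).elim
  have hL : Relator.RightUnique (Function.swap T.Step) := by
    rintro a b c ⟨_, h1⟩ ⟨_, h2⟩
    exact T.glue_injective (rot_injective (h1.symm.trans h2))
  intro b b' h
  have h1 : Relation.ReflTransGen (Function.swap T.Step) (exit hT (rot b.1)).1 (rot b.1) :=
    Relation.reflTransGen_swap.2 (reflTransGen_exit hT _)
  have h2 : Relation.ReflTransGen (Function.swap T.Step) (exit hT (rot b.1)).1 (rot b'.1) := by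
    have := reflTransGen_exit hT (rot b'.1)
    rw [← show exit hT (rot b.1) = exit hT (rot b'.1) from h] at this
    exact Relation.reflTransGen_swap.2 this
  rcases Relation.ReflTransGen.total_of_right_unique hL h1 h2 with h3 | h3
  · exact (key (Relation.reflTransGen_swap.1 h3)).symm
  · exact key (Relation.reflTransGen_swap.1 h3)

theorem out_component (C : T.BoundaryComponent) : T.component C.out = C := Quot.out_eq C

variable [Fintype F]

/-- The permutation of the boundary edges that sends a boundary edge to the preceding one in the
positive orientation of the boundary. -/
noncomputable def prevEdge : Equiv.Perm T.BoundaryEdge :=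
  Equiv.ofBijective _ (Finite.injective_iff_bijective.1 (exit_rot_injective hT))

theorem prevEdge_apply (b : T.BoundaryEdge) : prevEdge hT b = exit hT (rot b.1) := rfl

theorem component_prevEdge (b : T.BoundaryEdge) : T.component (prevEdge hT b) = T.component b :=
  Quot.sound ((nextBoundary_iff hT).2 rfl)

theorem component_eq_iff {b b' : T.BoundaryEdge} :
    T.component b = T.component b' ↔ (prevEdge hT).SameCycle b b' := by
  constructor
  · intro h
    have h' := Quot.eqvGen_exact h
    clear h
    induction h' with
    | rel x y h =>
      rw [nextBoundary_iff hT, ← prevEdge_apply] at h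
      rw [← h]
      exact Equiv.Perm.sameCycle_apply_left.2 (Equiv.Perm.SameCycle.refl _ _)
    | refl x => exact Equiv.Perm.SameCycle.refl _ _
    | symm x y _ ih => exact ih.symm
    | trans x y z _ _ ih1 ih2 => exact ih1.trans ih2
  · rintro ⟨i, rfl⟩
    induction i using Int.induction_on with
    | zero => rfl
    | succ i ih => rw [add_comm, zpow_add, zpow_one, Equiv.Perm.mul_apply, component_prevEdge, ih]
    | pred i ih =>
      rw [ih, ← component_prevEdge hT ((prevEdge hT ^ (-(i : ℤ) - 1)) b), ← Equiv.Perm.mul_apply,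
        ← zpow_one_add]
      congr 3
      ring

theorem componentSize_eq (b : T.BoundaryEdge) :
    T.componentSize (T.component b) = Function.minimalPeriod (prevEdge hT • ·) b := by
  classical
  have := Fintype.ofFinite (MulAction.orbit (Subgroup.zpowers (prevEdge hT)) b)
  rw [MulAction.minimalPeriod_eq_card, componentSize, ← Nat.card_eq_fintype_card]
  refine Nat.card_congr (Equiv.subtypeEquivRight fun b' => ?_)
  rw [eq_comm, component_eq_iff hT, MulAction.mem_orbit_iff]
  constructor
  · rintro ⟨i, hi⟩
    exact ⟨⟨prevEdge hT ^ i, i, rfl⟩, hi⟩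
  · rintro ⟨⟨_, i, rfl⟩, hi⟩
    exact ⟨i, hi⟩

theorem zpow_prevEdge_eq_iff {b : T.BoundaryEdge} {i j : ℤ} :
    (prevEdge hT ^ i) b = (prevEdge hT ^ j) b ↔ (T.componentSize (T.component b) : ℤ) ∣ i - j := by
  rw [componentSize_eq hT, ← MulAction.zpow_smul_eq_iff_minimalPeriod_dvd, Equiv.Perm.smul_def,
    zpow_sub, Equiv.Perm.mul_apply]
  constructor
  · intro h
    rw [← Equiv.Perm.mul_apply, ← zpow_sub, sub_eq_neg_add, zpow_add, Equiv.Perm.mul_apply, h,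
      ← Equiv.Perm.mul_apply, ← zpow_add, neg_add_cancel]
    rfl
  · intro h
    rw [← Equiv.Perm.mul_apply, ← zpow_neg, ← zpow_add] at h
    conv_rhs => rw [← h]
    rw [← Equiv.Perm.mul_apply, ← zpow_add]
    congr 2
    ring

/-- On the boundary components of even length there is an alternating sign. -/
theorem exists_alternating_sign : ∃ ε : T.BoundaryEdge → ℤˣ,
    ∀ b, Even (T.componentSize (T.component b)) → ε (prevEdge hT b) = -ε b := by
  have h1 : ∀ b : T.BoundaryEdge, ∃ i : ℤ, (prevEdge hT ^ i) (T.component b).out = b := by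
    intro b
    exact (component_eq_iff hT).1 (out_component _)
  choose i hi using h1
  refine ⟨fun b => Int.negOnePow (i b), fun b hb => ?_⟩
  have h2 := hi (prevEdge hT b)
  rw [component_prevEdge] at h2
  have h3 : (prevEdge hT ^ (i b + 1)) (T.component b).out = prevEdge hT b := by
    rw [add_comm, zpow_add, zpow_one, Equiv.Perm.mul_apply, hi]
  rw [← h3, zpow_prevEdge_eq_iff, out_component] at h2
  rw [← Int.negOnePow_succ, Int.negOnePow_eq_iff]
  rw [h3] at h2
  exact (Int.even_coe_nat _ |>.2 hb).trans_dvd h2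

section counts

variable {M : Type*} [AddCommGroup M]

theorem antiperiodic_zpow {ψ : T.BoundaryEdge → M} (hψ : ∀ b, ψ (prevEdge hT b) = -ψ b)
    (b : T.BoundaryEdge) (k : ℕ) : ψ ((prevEdge hT ^ k) b) = (-1 : ℤ) ^ k • ψ b := by
  induction k with
  | zero => simp
  | succ k ih =>
    rw [pow_succ', Equiv.Perm.mul_apply, hψ, ih, pow_succ', neg_one_mul, neg_smul]

/-- The functions on the boundary edges that change the sign from one boundary edge to the next are
zero on the components of odd length. -/
theorem antiperiodic_odd (h2 : ∀ m : M, 2 • m = 0 → m = 0) {ψ : T.BoundaryEdge → M}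
    (hψ : ∀ b, ψ (prevEdge hT b) = -ψ b) {b : T.BoundaryEdge}
    (hb : ¬ Even (T.componentSize (T.component b))) : ψ b = 0 := by
  -- Going once around the component, `ψ b` becomes `-ψ b`.
  have h1 := antiperiodic_zpow hT hψ b (T.componentSize (T.component b))
  have h3 : (prevEdge hT ^ T.componentSize (T.component b)) b = b := by
    have := (zpow_prevEdge_eq_iff hT (b := b) (i := T.componentSize (T.component b)) (j := 0)).2
      (by simp)
    simpa using this
  rw [h3, (Nat.not_even_iff_odd.1 hb).neg_one_pow, neg_smul, one_smul] at h1
  apply h2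
  rw [two_smul]
  nth_rewrite 1 [h1]
  simp

/-- Functions on the boundary edges that change the sign from one boundary edge to the next. -/
def Antiperiodic (M : Type*) [AddCommGroup M] : Type _ :=
  {ψ : T.BoundaryEdge → M // ∀ b, ψ (prevEdge hT b) = -ψ b}

theorem card_antiperiodic (h2 : ∀ m : M, 2 • m = 0 → m = 0) :
    Nat.card (Antiperiodic hT M) = Nat.card M ^ T.numEvenComponents := by
  classical
  obtain ⟨ε, hε⟩ := exists_alternating_sign hT
  -- The product of `ψ` and the alternating sign is constant on the components of even length.
  have hinv : ∀ (ψ : T.BoundaryEdge → M), (∀ b, ψ (prevEdge hT b) = -ψ b) →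
      ∀ b b', Even (T.componentSize (T.component b)) → T.component b = T.component b' →
      (ε b : ℤ) • ψ b = (ε b' : ℤ) • ψ b' := by
    intro ψ hψ b b' hb h
    let f : T.BoundaryEdge → M := fun b =>
      if Even (T.componentSize (T.component b)) then (ε b : ℤ) • ψ b else 0
    have hf : ∀ b b', T.NextBoundary b b' → f b = f b' := by
      intro b b' hbb
      rw [nextBoundary_iff hT, ← prevEdge_apply] at hbb
      subst hbb
      simp only [f, component_prevEdge]
      refine if_ctx_congr Iff.rfl (fun h => ?_) (fun _ => rfl)
      rw [hψ, hε _ h]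
      simp
    have h3 : Quot.lift f hf (T.component b) = Quot.lift f hf (T.component b') := by rw [h]
    have h4 : f b = f b' := h3
    simp only [f] at h4
    rwa [← h, if_pos hb, if_pos hb] at h4
  have hεε : ∀ b (m : M), (ε b : ℤ) • (ε b : ℤ) • m = m := by
    intro b m
    rw [← mul_smul, ← Units.val_mul, Int.units_mul_self]
    simp
  rw [numEvenComponents, ← Nat.card_fun]
  refine Nat.card_congr ⟨fun ψ C => (ε C.1.out : ℤ) • ψ.1 C.1.out,
    fun g => ⟨fun b => if hb : Even (T.componentSize (T.component b)) then
      (ε b : ℤ) • g ⟨T.component b, hb⟩ else 0, ?_⟩, ?_, ?_⟩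
  · intro b
    by_cases hb : Even (T.componentSize (T.component b))
    · have hb' : Even (T.componentSize (T.component (prevEdge hT b))) := by
        rwa [component_prevEdge]
      dsimp only
      rw [dif_pos hb, dif_pos hb', hε b hb]
      have : (⟨T.component (prevEdge hT b), hb'⟩ : {C // Even (T.componentSize C)}) =
          ⟨T.component b, hb⟩ := Subtype.ext (component_prevEdge hT b)
      rw [this]
      simp
    · have hb' : ¬ Even (T.componentSize (T.component (prevEdge hT b))) := by
        rwa [component_prevEdge]
      dsimp only
      rw [dif_neg hb, dif_neg hb', neg_zero]
  · intro ψ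
    refine Subtype.ext (funext fun b => ?_)
    dsimp only
    split_ifs with hb
    · rw [hinv ψ.1 ψ.2 (T.component b).out b (by rwa [out_component]) (out_component _), hεε]
    · exact (antiperiodic_odd hT h2 ψ.2 hb).symm
  · intro g
    funext C
    have hC : Even (T.componentSize (T.component C.1.out)) := by
      rw [out_component]
      exact C.2
    dsimp only
    rw [dif_pos hC, hεε]
    congr 1
    exact Subtype.ext (out_component C.1)

theorem card_periodic (M : Type*) :
    Nat.card {ψ : T.BoundaryEdge → M // ∀ b, ψ (prevEdge hT b) = ψ b} =
        Nat.card M ^ T.numComponents := by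
  rw [numComponents, ← Nat.card_fun]
  refine Nat.card_congr ⟨fun ψ => Quot.lift ψ.1 ?_, fun g => ⟨fun b => g (T.component b), ?_⟩, ?_,
      ?_⟩
  · intro b b' h
    rw [nextBoundary_iff hT, ← prevEdge_apply] at h
    rw [← h, ψ.2]
  · intro b
    dsimp only
    rw [component_prevEdge]
  · intro ψ
    rfl
  · intro g
    funext C
    induction C using Quot.ind with
    | mk b => rfl

end counts

end IdealTriangulation

/-! ### Skew normal forms and counts modulo `d` -/

namespace Matrix

variable {U V W : Type*} [Fintype W]

/-- Multiplication by an integer matrix on vectors modulo `d`. -/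
noncomputable def modMul (d : ℕ) (M : Matrix V W ℤ) : (W → ZMod d) →ₗ[ZMod d] (V → ZMod d) :=
  (M.map (Int.cast : ℤ → ZMod d)).mulVecLin

theorem modMul_apply (d : ℕ) (M : Matrix V W ℤ) (x : W → ZMod d) (v : V) :
    modMul d M x v = ∑ w, (M v w : ZMod d) * x w := rfl

theorem modMul_smul_one [DecidableEq W] (d : ℕ) (c : ℤ) (x : W → ZMod d) :
    modMul d (c • (1 : Matrix W W ℤ)) x = (c : ZMod d) • x := by
  funext v
  rw [modMul_apply]
  simp [Matrix.one_apply]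

theorem card_ker_mul_card_range_modMul (d : ℕ) [NeZero d] (M : Matrix V W ℤ) :
    Nat.card (LinearMap.ker (modMul d M)) * Nat.card (LinearMap.range (modMul d M)) =
      d ^ Fintype.card W := by
  have h := AddMonoidHom.card_ker_mul_card_range (modMul d M).toAddMonoidHom
  rw [Nat.card_fun, Nat.card_zmod, Nat.card_eq_fintype_card (α := W)] at h
  exact h

theorem card_ker_modMul_submatrix {U' : Type*} [Fintype U'] (d : ℕ) (M : Matrix V W ℤ) (e : U ≃ V)
    (f : U' ≃ W) : Nat.card (LinearMap.ker (modMul d (M.submatrix e f))) =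
      Nat.card (LinearMap.ker (modMul d M)) := by
  refine (Nat.card_congr ((f.arrowCongr (Equiv.refl (ZMod d))).subtypeEquiv fun x => ?_))
  have h : modMul d (M.submatrix e f) x =
      fun u => modMul d M (f.arrowCongr (Equiv.refl (ZMod d)) x) (e u) := by
    funext u
    rw [modMul_apply, modMul_apply, ← f.sum_comp]
    simp
  rw [LinearMap.mem_ker, LinearMap.mem_ker, h]
  constructor
  · intro h1
    funext v
    simpa using congrFun h1 (e.symm v)
  · intro h1
    rw [h1]
    rfl

variable [Fintype V]

theorem modMul_mul (d : ℕ) (M : Matrix U V ℤ) (N : Matrix V W ℤ) (x : W → ZMod d) :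
    modMul d (M * N) x = modMul d M (modMul d N x) := by
  have h : (M * N).map (Int.castRingHom (ZMod d)) =
      M.map (Int.castRingHom (ZMod d)) * N.map (Int.castRingHom (ZMod d)) := Matrix.map_mul
  change (M * N).map (Int.castRingHom (ZMod d)) *ᵥ x =
    M.map (Int.castRingHom (ZMod d)) *ᵥ (N.map (Int.castRingHom (ZMod d)) *ᵥ x)
  rw [h, Matrix.mulVec_mulVec]

theorem modMul_injective [DecidableEq W] {d : ℕ} {c : ℤ} (hc : IsUnit (c : ZMod d))
    {M : Matrix W V ℤ} {N : Matrix V W ℤ} (h : M * N = c • (1 : Matrix W W ℤ)) :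
    Function.Injective (modMul d N) := by
  intro x y hxy
  have h1 := congrArg (modMul d M) hxy
  rw [← modMul_mul, ← modMul_mul, h, modMul_smul_one, modMul_smul_one] at h1
  exact hc.smul_left_cancel.1 h1

theorem card_ker_modMul_comp {d : ℕ} {M : Matrix U V ℤ} {N : Matrix V W ℤ}
    (hM : Function.Injective (modMul d M)) :
    Nat.card (LinearMap.ker (modMul d (M * N))) = Nat.card (LinearMap.ker (modMul d N)) := by
  refine Nat.card_congr (Equiv.subtypeEquivRight fun x => ?_)
  rw [LinearMap.mem_ker, LinearMap.mem_ker, modMul_mul, map_eq_zero_iff _ hM]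

theorem card_ker_modMul_comp_bijective {d : ℕ} {M : Matrix U V ℤ} {N : Matrix V W ℤ}
    (hN : Function.Bijective (modMul d N)) :
    Nat.card (LinearMap.ker (modMul d (M * N))) = Nat.card (LinearMap.ker (modMul d M)) := by
  refine Nat.card_congr ((Equiv.ofBijective _ hN).subtypeEquiv fun x => ?_)
  rw [LinearMap.mem_ker, LinearMap.mem_ker, modMul_mul]
  rfl

theorem modMul_bijective_of_det {d : ℕ} {X : Matrix W W ℤ} [DecidableEq W]
    (hX : X.det = 1 ∨ X.det = -1) : Function.Bijective (modMul d X) := by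
  have h1 : IsUnit X.det := by
    rcases hX with h | h <;> rw [h] <;> simp
  have inj : ∀ {Y Z : Matrix W W ℤ}, Y * Z = 1 → ∀ x, modMul d Y (modMul d Z x) = x := by
    intro Y Z h x
    rw [← modMul_mul, h, ← one_smul ℤ (1 : Matrix W W ℤ), modMul_smul_one]
    simp
  exact Function.bijective_iff_has_inverse.2
    ⟨modMul d X⁻¹, inj (nonsing_inv_mul _ h1), inj (mul_nonsing_inv _ h1)⟩

end Matrix

theorem ZMod.card_annihilator (d : ℕ) [NeZero d] (z : ℕ) :
    Nat.card {x : ZMod d // (z : ZMod d) * x = 0} = d.gcd z := by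
  have h := AddMonoidHom.card_ker_mul_card_range (nsmulAddMonoidHom z : ZMod d →+ ZMod d)
  have h2 := IsAddCyclic.card_nsmulAddMonoidHom_range (ZMod d) z
  rw [Nat.card_zmod] at h h2
  rw [h2] at h
  have h3 : Nat.card {x : ZMod d // (z : ZMod d) * x = 0} =
      Nat.card (nsmulAddMonoidHom z : ZMod d →+ ZMod d).ker := by
    refine Nat.card_congr (Equiv.subtypeEquivRight fun x => ?_)
    rw [AddMonoidHom.mem_ker, nsmulAddMonoidHom_apply, nsmul_eq_mul]
  rw [h3]
  have h4 := Nat.div_mul_cancel (Nat.gcd_dvd_left d z)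
  have h5 : 0 < d / d.gcd z := Nat.div_pos (Nat.gcd_le_left _ (NeZero.pos d))
    (Nat.gcd_pos_of_pos_left _ (NeZero.pos d))
  have h6 : d / d.gcd z * Nat.card (nsmulAddMonoidHom z : ZMod d →+ ZMod d).ker =
      d / d.gcd z * d.gcd z := by rw [h4, mul_comm, h]
  exact Nat.eq_of_mul_eq_mul_left h5 h6

section skew

open Matrix

variable {V W : Type*} [Fintype V] [Fintype W]

open Classical in
/-- The block diagonal matrix of a skew normal form. -/
noncomputable def skewBlocks {k : ℕ} (m : ℕ) (h : Fin k → ℕ) :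
    Matrix ((Fin 2 × Fin k) ⊕ Fin m) ((Fin 2 × Fin k) ⊕ Fin m) ℤ :=
  Matrix.fromBlocks
    (Matrix.blockDiagonal fun i : Fin k => !![(0 : ℤ), (h i : ℤ); -(h i : ℤ), 0]) 0 0 0

theorem modMul_skewBlocks {k : ℕ} (m : ℕ) (h : Fin k → ℕ) (d : ℕ)
    (x : (Fin 2 × Fin k) ⊕ Fin m → ZMod d) :
    modMul d (skewBlocks m h) x = Sum.elim
      (fun a => ![(h a.2 : ZMod d) * x (Sum.inl (1, a.2)), -(h a.2 * x (Sum.inl (0, a.2)))] a.1)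
      (fun _ => 0) := by
  funext s
  rw [modMul_apply, Fintype.sum_sum_type]
  rcases s with ⟨a, i⟩ | j
  · simp only [skewBlocks, fromBlocks_apply₁₁, fromBlocks_apply₁₂, Matrix.blockDiagonal_apply,
      Fintype.sum_prod_type, Fin.sum_univ_two]
    fin_cases a <;> simp
  · simp [skewBlocks]

theorem card_ker_skewBlocks {k : ℕ} (m : ℕ) (h : Fin k → ℕ) (d : ℕ) [NeZero d] :
    Nat.card (LinearMap.ker (modMul d (skewBlocks m h))) = (∏ i, d.gcd (h i)) ^ 2 * d ^ m := by
  have e : LinearMap.ker (modMul d (skewBlocks m h)) ≃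
      (Fin 2 → ∀ i : Fin k, {x : ZMod d // (h i : ZMod d) * x = 0}) × (Fin m → ZMod d) :=
    { toFun := fun x => (fun a i => ⟨x.1 (Sum.inl (a, i)), by
          have h1 := x.2
          rw [LinearMap.mem_ker, modMul_skewBlocks] at h1
          have h2 := congrFun h1 (Sum.inl (1 - a, i))
          fin_cases a
          · simpa using h2
          · simpa using h2⟩, fun j => x.1 (Sum.inr j))
      invFun := fun y => ⟨Sum.elim (fun a => y.1 a.1 a.2) y.2, by
          rw [LinearMap.mem_ker, modMul_skewBlocks]
          funext s
          rcases s with ⟨a, i⟩ | j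
          · have h0 := (y.1 0 i).2
            have h1 := (y.1 1 i).2
            fin_cases a
            · simpa using h1
            · simpa using h0
          · rfl⟩
      left_inv := fun x => by
        refine Subtype.ext (funext fun s => ?_)
        rcases s with ⟨a, i⟩ | j <;> rfl
      right_inv := fun y => rfl }
  rw [Nat.card_congr e, Nat.card_prod, Nat.card_fun, Nat.card_pi, Nat.card_fun]
  simp only [ZMod.card_annihilator, Nat.card_fin, Nat.card_zmod]

open Classical in
/-- The factor `n` can be divided out of a skew normal form. -/
theorem IsSkewNormalForm.of_smul {n : ℕ} (hn : 0 < n) {M : Matrix V V ℤ} {k : ℕ} {h : Fin k → ℕ}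
    (hM : IsSkewNormalForm ((n : ℤ) • M) k h) :
    ∃ z : Fin k → ℕ, (∀ i, h i = n * z i) ∧ IsSkewNormalForm M k z := by
  obtain ⟨h1, h2, m, e, X, hX, hD⟩ := hM
  rw [Matrix.mul_smul, Matrix.smul_mul] at hD
  have h3 : ∀ i, (n : ℤ) ∣ h i := by
    intro i
    have h4 := congrFun (congrFun hD (Sum.inl (0, i))) (Sum.inl (1, i))
    change (n : ℤ) * (Xᵀ * M * X) (e (Sum.inl (0, i))) (e (Sum.inl (1, i))) = _ at h4
    simp only [fromBlocks_apply₁₁, Matrix.blockDiagonal_apply_eq] at h4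
    have h5 : (h i : ℤ) = n * (Xᵀ * M * X) (e (Sum.inl (0, i))) (e (Sum.inl (1, i))) := by
      simpa using h4.symm
    exact ⟨_, h5⟩
  have h3' : ∀ i, n ∣ h i := fun i => Int.natCast_dvd_natCast.1 (h3 i)
  choose z hz using h3'
  have hn' : (n : ℤ) ≠ 0 := by exact_mod_cast hn.ne'
  refine ⟨z, hz, fun i => ?_, fun i j hij => ?_, m, e, X, hX, ?_⟩
  · have := h1 i
    rw [hz] at this
    exact Nat.pos_of_mul_pos_left this
  · have := h2 i j hij
    rw [hz, hz] at this
    exact Nat.dvd_of_mul_dvd_mul_left hn this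
  · ext s t
    have h4 := congrFun (congrFun hD s) t
    refine mul_left_cancel₀ hn' ?_
    refine Eq.trans ?_ (h4.trans ?_)
    · rfl
    · rcases s with ⟨a, i⟩ | s <;> rcases t with ⟨b, j⟩ | t
      · simp only [fromBlocks_apply₁₁, Matrix.blockDiagonal_apply]
        split_ifs
        · rw [hz]
          fin_cases a <;> fin_cases b <;> simp
        · simp
      · simp
      · simp
      · simp

theorem eqUpToTwo_of_odd_primes {a b : ℕ} (ha : a ≠ 0) (hb : b ≠ 0)
    (h : ∀ q : ℕ, q.Prime → q ≠ 2 → a.factorization q = b.factorization q) : EqUpToTwo a b := by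
  have h1 : ordCompl[2] a = ordCompl[2] b := by
    refine Nat.eq_of_factorization_eq (Nat.ordCompl_pos 2 ha).ne' (Nat.ordCompl_pos 2 hb).ne' ?_
    intro q
    rw [Nat.factorization_ordCompl, Nat.factorization_ordCompl]
    by_cases hq : q = 2
    · subst hq
      simp
    · rw [Finsupp.erase_ne hq, Finsupp.erase_ne hq]
      by_cases hq' : q.Prime
      · exact h q hq' hq
      · rw [Nat.factorization_eq_zero_of_not_prime _ hq',
          Nat.factorization_eq_zero_of_not_prime _ hq']
  refine ⟨(a.factorization 2 : ℤ) - b.factorization 2, ?_⟩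
  have h2 := Nat.ordProj_mul_ordCompl_eq_self a 2
  have h3 := Nat.ordProj_mul_ordCompl_eq_self b 2
  rw [zpow_sub₀ two_ne_zero, zpow_natCast, zpow_natCast]
  rw [← h1] at h3
  have h2' : (a : ℚ) = 2 ^ a.factorization 2 * (ordCompl[2] a : ℕ) := by exact_mod_cast h2.symm
  have h3' : (b : ℚ) = 2 ^ b.factorization 2 * (ordCompl[2] a : ℕ) := by exact_mod_cast h3.symm
  rw [h3']
  nth_rewrite 1 [h2']
  field_simp

open Classical in
theorem IsSkewNormalForm.card_ker {M : Matrix V V ℤ} {k : ℕ} {h : Fin k → ℕ}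
    (hM : IsSkewNormalForm M k h) (d : ℕ) [NeZero d] :
    2 * k ≤ Fintype.card V ∧ Nat.card (LinearMap.ker (modMul d M)) =
      (∏ i, d.gcd (h i)) ^ 2 * d ^ (Fintype.card V - 2 * k) := by
  obtain ⟨h1, h2, m, e, X, hX, hD⟩ := hM
  have hm : Fintype.card V = 2 * k + m := by
    rw [← Fintype.card_congr e]
    simp
  refine ⟨by omega, ?_⟩
  have hX' : Xᵀ.det = 1 ∨ Xᵀ.det = -1 := by rwa [Matrix.det_transpose]
  have h3 := card_ker_skewBlocks m h d
  have h4 : skewBlocks m h = (Xᵀ * M * X).submatrix e e := hD.symm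
  rw [h4, card_ker_modMul_submatrix, card_ker_modMul_comp_bijective (modMul_bijective_of_det hX),
    card_ker_modMul_comp (modMul_bijective_of_det hX').1] at h3
  rw [h3, hm, Nat.add_sub_cancel_left]

/-- If a matrix has `s` rows divisible by `d`, its kernel modulo `d` is large. -/
theorem card_le_of_rows_dvd {d : ℕ} [NeZero d] (M : Matrix V W ℤ) (s : Finset V)
    (hs : ∀ v ∈ s, ∀ w, (d : ℤ) ∣ M v w) :
    d ^ Fintype.card W ≤ Nat.card (LinearMap.ker (modMul d M)) * d ^ (Fintype.card V - s.card) := by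
  classical
  rw [← card_ker_mul_card_range_modMul d M]
  refine Nat.mul_le_mul_left _ ?_
  have h1 : Nat.card ((sᶜ : Finset V) → ZMod d) = d ^ (Fintype.card V - s.card) := by
    rw [Nat.card_fun, Nat.card_zmod, Nat.card_eq_fintype_card, Fintype.card_coe, Finset.card_compl]
  rw [← h1]
  refine Nat.card_le_card_of_injective (fun y v => y.1 v.1) fun y y' h => ?_
  obtain ⟨y, x, rfl⟩ := y
  obtain ⟨y', x', rfl⟩ := y'
  have h2 : ∀ x : W → ZMod d, ∀ v ∈ s, modMul d M x v = 0 := by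
    intro x v hv
    rw [modMul_apply]
    refine Finset.sum_eq_zero fun w _ => ?_
    rw [(ZMod.intCast_zmod_eq_zero_iff_dvd _ _).2 (hs v hv w), zero_mul]
  refine Subtype.ext (funext fun v => ?_)
  by_cases hv : v ∈ s
  · dsimp only
    rw [h2 x v hv, h2 x' v hv]
  · exact congrFun h ⟨v, Finset.mem_compl.2 hv⟩

open Classical in
theorem transpose_mul_transpose_of_mul {n : ℕ} (hn : 0 < n) {K : Matrix V W ℤ} {H : Matrix W V ℤ}
    (hVW : Fintype.card V = Fintype.card W)
    (hKH : K * H = (2 * n : ℤ) • (1 : Matrix V V ℤ)) :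
    Kᵀ * Hᵀ = (2 * n : ℤ) • (1 : Matrix W W ℤ) := by
  rw [← Matrix.transpose_mul, Matrix.mul_eq_smul_one_comm hVW (by positivity) hKH,
    Matrix.transpose_smul, Matrix.transpose_one]

open Classical in
theorem modMul_transpose_bijective {n : ℕ} {K : Matrix V W ℤ} {H : Matrix W V ℤ}
    (hVW : Fintype.card V = Fintype.card W)
    (hKH : K * H = (2 * n : ℤ) • (1 : Matrix V V ℤ)) {q : ℕ} (hq : q.Prime) (hq2 : q ≠ 2)
    (hqn : ¬ q ∣ n) : Function.Bijective (modMul q Kᵀ) := by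
  have : Fact q.Prime := ⟨hq⟩
  have hKt' : Hᵀ * Kᵀ = (2 * n : ℤ) • (1 : Matrix V V ℤ) := by
    rw [← Matrix.transpose_mul, hKH, Matrix.transpose_smul, Matrix.transpose_one]
  have hu : IsUnit (((2 * n : ℤ) : ℤ) : ZMod q) := by
    rw [isUnit_iff_ne_zero, Ne, ZMod.intCast_zmod_eq_zero_iff_dvd]
    intro hd
    have hd' : q ∣ 2 * n := by exact_mod_cast hd
    rcases (Nat.Prime.dvd_mul hq).1 hd' with h2 | h2
    · exact hq2 ((Nat.prime_dvd_prime_iff_eq hq Nat.prime_two).1 h2)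
    · exact hqn h2
  refine (Fintype.bijective_iff_injective_and_card _).2 ⟨modMul_injective hu hKt', ?_⟩
  rw [Fintype.card_fun, Fintype.card_fun, hVW]

open Classical in
/-- The skew normal form of `n • (A * Kᵀ)` where `K` is invertible up to the factor `2 * n`, up to
powers of two, from the corank of `A` and the size of the range of `A * Kᵀ` modulo the divisors of
`n`. For an odd prime `q`, the invariant factors are prime to `q` if `q` does not divide `n`, since
the corank of `A * Kᵀ` is the same modulo `q` as over `ℚ`. If `q` divides `n`, the corank of `A`
bounds the power of `q` in the invariant factors from above by the one in `n`, and the size of the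
range modulo `q` and its powers then decides which of the invariant factors reach this bound. -/
theorem IsSkewNormalForm.eqUpToTwo {n : ℕ} (hn : 0 < n)
    {A K : Matrix V W ℤ} {H : Matrix W V ℤ}
    (hVW : Fintype.card V = Fintype.card W)
    (hKH : K * H = (2 * n : ℤ) • (1 : Matrix V V ℤ)) {t p l : ℕ} (hV : Fintype.card V = t + 2 * l)
    (hker : ∀ q : ℕ, q.Prime → q ≠ 2 → Nat.card (LinearMap.ker (modMul q A)) = q ^ t)
    (hrange : ∀ d : ℕ, Odd d → d ∣ n →
      Nat.card (LinearMap.range (modMul d (A * Kᵀ))) = d ^ (2 * p))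
    {k : ℕ} {h : Fin k → ℕ} (hM : IsSkewNormalForm ((n : ℤ) • (A * Kᵀ)) k h) :
    k = l ∧ ∃ z : Fin k → ℕ, (∀ i, h i = n * z i) ∧
      (∀ i : Fin k, (i : ℕ) < p → EqUpToTwo (z i) 1) ∧
      (∀ i : Fin k, p ≤ (i : ℕ) → EqUpToTwo (z i) n) := by
  obtain ⟨z, hz, hB⟩ := hM.of_smul hn
  have hKt := transpose_mul_transpose_of_mul hn hVW hKH
  have h2k : 2 * k ≤ Fintype.card V := (hB.card_ker 1).1
  have hz0 : ∀ i, z i ≠ 0 := fun i => (hB.1 i).ne'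
  have hbij : ∀ q : ℕ, q.Prime → q ≠ 2 → ¬ q ∣ n → Function.Bijective (modMul q Kᵀ) :=
    fun q hq hq2 hqn => modMul_transpose_bijective hVW hKH hq hq2 hqn
  have hcop : ∀ q : ℕ, q.Prime → q ≠ 2 → ¬ q ∣ n →
      (∏ i, q.gcd (z i)) ^ 2 * q ^ (Fintype.card V - 2 * k) = q ^ t := by
    intro q hq hq2 hqn
    have : NeZero q := ⟨hq.ne_zero⟩
    rw [← hker q hq hq2, ← card_ker_modMul_comp_bijective (hbij q hq hq2 hqn), (hB.card_ker q).2]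
  -- A large prime divides neither `n` nor the invariant factors.
  have hkl : Fintype.card V - 2 * k = t := by
    obtain ⟨q, hq1, hq⟩ := Nat.exists_infinite_primes (2 + n + ∏ i, z i + 1)
    have hP : 0 < ∏ i, z i := Finset.prod_pos fun i _ => hB.1 i
    have h1 := hcop q hq (by omega) (Nat.not_dvd_of_pos_of_lt hn (by omega))
    have h2 : ∏ i, q.gcd (z i) = 1 := by
      refine Finset.prod_eq_one fun i _ => (Nat.Prime.coprime_iff_not_dvd hq).2 ?_
      refine Nat.not_dvd_of_pos_of_lt (hB.1 i) ?_
      have := Nat.le_of_dvd hP (Finset.dvd_prod_of_mem z (Finset.mem_univ i))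
      omega
    rw [h2, one_pow, one_mul] at h1
    exact Nat.pow_right_injective hq.two_le h1
  have hk : k = l := by omega
  refine ⟨hk, z, hz, ?_⟩
  have hndvd : ∀ q : ℕ, q.Prime → q ≠ 2 → ¬ q ∣ n → ∀ i, ¬ q ∣ z i := by
    intro q hq hq2 hqn i hi
    have h1 := hcop q hq hq2 hqn
    rw [hkl] at h1
    have h2 : (∏ i, q.gcd (z i)) ^ 2 = 1 :=
      Nat.eq_of_mul_eq_mul_right (pow_pos hq.pos t) (by rw [h1, one_mul])
    have h3 : ∏ i, q.gcd (z i) = 1 := by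
      simpa using h2
    have h4 := Finset.prod_eq_one_iff.1 h3 i (Finset.mem_univ i)
    rw [Nat.gcd_eq_left hi] at h4
    exact hq.one_lt.ne' h4
  -- The kernel and the range modulo a divisor of `n` determine each other.
  have hprod : ∀ d : ℕ, Odd d → d ∣ n → (∏ i, d.gcd (z i)) * d ^ p = d ^ k := by
    intro d hd hdn
    have : NeZero d := ⟨hd.pos.ne'⟩
    have h1 := card_ker_mul_card_range_modMul d (A * Kᵀ)
    rw [hrange d hd hdn, (hB.card_ker d).2] at h1
    have h3 : (Fintype.card V) = (Fintype.card V - 2 * k) + 2 * k := by omega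
    have h2 : ((∏ i, d.gcd (z i)) * d ^ p) ^ 2 = (d ^ k) ^ 2 := by
      refine Nat.eq_of_mul_eq_mul_left (pow_pos hd.pos (Fintype.card V - 2 * k)) ?_
      rw [← pow_mul d k, ← pow_add, mul_comm k 2, ← h3, ← h1]
      ring
    exact Nat.pow_left_injective (n := 2) (by norm_num) h2
  -- If `z i` were divisible by a higher power of `q` than `n`, then, `K` being invertible up to
  -- `2 * n`, the `t + 2` rows of `Xᵀ * A` which belong to `z i` and to the zeros of the normal form
  -- would be zero modulo `q`, against the corank `t` of `A`.
  have hval : ∀ q : ℕ, q.Prime → q ≠ 2 → q ∣ n → ∀ i, ¬ q ^ (n.factorization q + 1) ∣ z i := by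
    intro q hq hq2 hqn i hi
    have : NeZero q := ⟨hq.ne_zero⟩
    obtain ⟨-, hchain, m, e, X, hX, hD⟩ := hB
    have hm : m = t := by
      have := Fintype.card_congr e
      simp at this
      omega
    have hX1 : IsUnit X.det := by
      rcases hX with h | h <;> rw [h] <;> simp
    have hX' : Xᵀ.det = 1 ∨ Xᵀ.det = -1 := by rwa [Matrix.det_transpose]
    have hG : Xᵀ * (A * Kᵀ) * X * (X⁻¹ * Hᵀ) = (2 * n : ℤ) • (Xᵀ * A) := by
      rw [Matrix.mul_assoc, ← Matrix.mul_assoc X, Matrix.mul_nonsing_inv _ hX1, Matrix.one_mul,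
        ← Matrix.mul_assoc, Matrix.mul_assoc _ Kᵀ, hKt, Matrix.mul_smul, Matrix.mul_one]
    let ι : Fin 2 ⊕ Fin m → V := fun s => e (Sum.map (fun a => (a, i)) id s)
    have hι : Function.Injective ι := by
      refine e.injective.comp (Sum.map_injective.2 ⟨fun a b hab => ?_, Function.injective_id⟩)
      exact (Prod.ext_iff.1 hab).1
    have hrow : ∀ s v, ((q ^ (n.factorization q + 1) : ℕ) : ℤ) ∣
        (Xᵀ * (A * Kᵀ) * X) (ι s) v := by
      intro s v
      obtain ⟨u, rfl⟩ := e.surjective v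
      have h1 := congrFun (congrFun hD (Sum.map (fun a => (a, i)) id s)) u
      rw [Matrix.submatrix_apply] at h1
      change _ ∣ (Xᵀ * (A * Kᵀ) * X) (e (Sum.map (fun a => (a, i)) id s)) (e u)
      rw [h1]
      rcases s with a | s
      · rcases u with ⟨b, j⟩ | u
        · simp only [Sum.map_inl, fromBlocks_apply₁₁, Matrix.blockDiagonal_apply]
          split_ifs with hij
          · have h2 : (q : ℤ) ^ (n.factorization q + 1) ∣ z i := by exact_mod_cast hi
            fin_cases a <;> fin_cases b <;> simp [h2]
          · exact dvd_zero _
        · exact dvd_zero _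
      · rcases u with ⟨b, j⟩ | u <;> exact dvd_zero _
    have hrow2 : ∀ s w, (q : ℤ) ∣ (Xᵀ * A) (ι s) w := by
      intro s w
      have h1 : ((q ^ (n.factorization q + 1) : ℕ) : ℤ) ∣
          (Xᵀ * (A * Kᵀ) * X * (X⁻¹ * Hᵀ)) (ι s) w := by
        rw [Matrix.mul_apply]
        exact Finset.dvd_sum fun v _ => (hrow s v).mul_right _
      rw [hG, Matrix.smul_apply, smul_eq_mul] at h1
      have h2 : (n : ℤ) = ((q ^ n.factorization q : ℕ) : ℤ) * (ordCompl[q] n : ℕ) := by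
        exact_mod_cast (Nat.ordProj_mul_ordCompl_eq_self n q).symm
      have hq0 : ((q ^ n.factorization q : ℕ) : ℤ) ≠ 0 := by
        exact_mod_cast (pow_pos hq.pos _).ne'
      rw [pow_succ, Nat.cast_mul, h2, show (2 * (((q ^ n.factorization q : ℕ) : ℤ) *
        ((ordCompl[q] n : ℕ) : ℤ)) * (Xᵀ * A) (ι s) w) = ((q ^ n.factorization q : ℕ) : ℤ) *
        (((2 * ordCompl[q] n : ℕ) : ℤ) * (Xᵀ * A) (ι s) w) by push_cast; ring] at h1
      have h3 := Int.dvd_of_mul_dvd_mul_left hq0 h1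
      refine (Int.Prime.dvd_mul' hq h3).resolve_left fun h4 => ?_
      rw [Int.natCast_dvd_natCast] at h4
      rcases (Nat.Prime.dvd_mul hq).1 h4 with h5 | h5
      · exact hq2 ((Nat.prime_dvd_prime_iff_eq hq Nat.prime_two).1 h5)
      · exact Nat.not_dvd_ordCompl hq hn.ne' h5
    have h4 := card_le_of_rows_dvd (d := q) (Xᵀ * A) (Finset.univ.map ⟨ι, hι⟩) (by
      intro v hv w
      obtain ⟨s, -, rfl⟩ := Finset.mem_map.1 hv
      exact hrow2 s w)
    rw [card_ker_modMul_comp (modMul_bijective_of_det hX').1, hker q hq hq2, ← pow_add,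
      Finset.card_map, Finset.card_univ, Fintype.card_sum, Fintype.card_fin, Fintype.card_fin] at h4
    have h5 := (Nat.pow_le_pow_iff_right hq.one_lt).1 h4
    have h6 := i.2
    omega
  have hpk : ∀ q : ℕ, q.Prime → q ≠ 2 → q ∣ n → p ≤ k := by
    intro q hq hq2 hqn
    have h1 := hprod q (hq.odd_of_ne_two hq2) hqn
    exact (Nat.pow_dvd_pow_iff_le_right hq.one_lt).1 ⟨_, h1.symm.trans (mul_comm _ _)⟩
  -- If `q` divided `z i` for some `i < p`, it would divide all the later ones too, and the product
  -- in `hprod` would be too large.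
  have hsmall : ∀ q : ℕ, q.Prime → q ≠ 2 → q ∣ n → ∀ i : Fin k, (i : ℕ) < p → ¬ q ∣ z i := by
    intro q hq hq2 hqn i hi hqi
    have h1 := hprod q (hq.odd_of_ne_two hq2) hqn
    have h2 : ∏ j : Fin k, (if i ≤ j then q else 1) ≤ ∏ j, q.gcd (z j) := by
      refine Finset.prod_le_prod' fun j _ => ?_
      split_ifs with hij
      · rw [Nat.gcd_eq_left (hqi.trans (hB.2.1 i j hij))]
      · exact Nat.gcd_pos_of_pos_left _ hq.pos
    rw [Finset.prod_ite, Finset.prod_const_one, Finset.prod_const, mul_one,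
      show Finset.univ.filter (fun j => i ≤ j) = Finset.Ici i by ext; simp, Fin.card_Ici] at h2
    have h3 := Nat.mul_le_mul_right (q ^ p) h2
    rw [h1, ← pow_add] at h3
    have h4 := (Nat.pow_le_pow_iff_right hq.one_lt).1 h3
    have h6 := i.2
    omega
  -- The first `p` factors of the product in `hprod` are `1` for `d = q ^ v`, so that the others all
  -- have to be equal to `d`.
  have hlarge : ∀ q : ℕ, q.Prime → q ≠ 2 → q ∣ n → ∀ i : Fin k, p ≤ (i : ℕ) →
      q ^ n.factorization q ∣ z i := by
    intro q hq hq2 hqn i hi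
    set d := q ^ n.factorization q with hd
    have hd0 : 0 < d := pow_pos hq.pos _
    have h1 := hprod d ((hq.odd_of_ne_two hq2).pow) (Nat.ordProj_dvd n q)
    have hle : ∀ j : Fin k, d.gcd (z j) * (if (j : ℕ) < p then d else 1) ≤ d := by
      intro j
      split_ifs with hj
      · have : d.gcd (z j) = 1 :=
          Nat.Coprime.pow_left _ ((Nat.Prime.coprime_iff_not_dvd hq).2 (hsmall q hq hq2 hqn j hj))
        rw [this, one_mul]
      · rw [mul_one]
        exact Nat.gcd_le_left _ hd0
    have h2 : ∏ j : Fin k, (if (j : ℕ) < p then d else 1) = d ^ p := by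
      rw [Finset.prod_ite, Finset.prod_const_one, Finset.prod_const, mul_one,
          Fin.card_filter_val_lt,
        min_eq_right (hpk q hq hq2 hqn)]
    rw [← h2, ← Finset.prod_mul_distrib] at h1
    have h3 : d.gcd (z i) = d := by
      by_contra hne
      have h4 : ∏ j : Fin k, (d.gcd (z j) * if (j : ℕ) < p then d else 1) < ∏ _j : Fin k, d := by
        refine Finset.prod_lt_prod (fun j _ => ?_) (fun j _ => hle j) ⟨i, Finset.mem_univ i, ?_⟩
        · exact mul_pos (Nat.gcd_pos_of_pos_left _ hd0) (by split_ifs <;> omega)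
        · rw [if_neg (by omega), mul_one]
          exact lt_of_le_of_ne (Nat.gcd_le_left _ hd0) hne
      rw [h1, Finset.prod_const, Finset.card_univ, Fintype.card_fin] at h4
      exact lt_irrefl _ h4
    rw [← h3]
    exact Nat.gcd_dvd_right _ _
  constructor
  · intro i hi
    refine eqUpToTwo_of_odd_primes (hz0 i) one_ne_zero fun q hq hq2 => ?_
    rw [Nat.factorization_one, Finsupp.zero_apply]
    refine Nat.factorization_eq_zero_of_not_dvd ?_
    by_cases hqn : q ∣ n
    · exact hsmall q hq hq2 hqn i hi
    · exact hndvd q hq hq2 hqn i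
  · intro i hi
    refine eqUpToTwo_of_odd_primes (hz0 i) hn.ne' fun q hq hq2 => ?_
    by_cases hqn : q ∣ n
    · refine le_antisymm ?_ ((hq.pow_dvd_iff_le_factorization (hz0 i)).1 (hlarge q hq hq2 hqn i hi))
      by_contra hlt
      exact hval q hq hq2 hqn i ((hq.pow_dvd_iff_le_factorization (hz0 i)).2 (by omega))
    · rw [Nat.factorization_eq_zero_of_not_dvd hqn,
        Nat.factorization_eq_zero_of_not_dvd (hndvd q hq hq2 hqn i)]

open Classical in
/-- An integral vector `x` such that `x H` is divisible by `n` is in the row space of `K` modulo the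
odd numbers, if `K` and `H` are inverse to each other up to the factor `2 * n`. -/
theorem mem_range_modMul_transpose {n : ℕ} (hn : 0 < n) {K : Matrix V W ℤ} {H : Matrix W V ℤ}
    (hVW : Fintype.card V = Fintype.card W)
    (hKH : K * H = (2 * n : ℤ) • (1 : Matrix V V ℤ)) (x : W → ℤ)
    (hx : ∀ v, (n : ℤ) ∣ ∑ w, x w * H w v) {d : ℕ} (hd : IsUnit (2 : ZMod d)) :
    (fun w => (x w : ZMod d)) ∈ LinearMap.range (modMul d Kᵀ) := by
  choose y hy using hx
  have h1 := Matrix.mul_eq_smul_one_comm hVW (by positivity : (2 * n : ℤ) ≠ 0) hKH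
  have h2 : ∀ w, ∑ v, y v * K v w = 2 * x w := by
    intro w
    have hn' : (n : ℤ) ≠ 0 := by exact_mod_cast hn.ne'
    refine mul_left_cancel₀ hn' ?_
    calc (n : ℤ) * ∑ v, y v * K v w = ∑ v, (∑ u, x u * H u v) * K v w := by
          rw [Finset.mul_sum]
          exact Finset.sum_congr rfl fun v _ => by rw [hy, mul_assoc]
      _ = ∑ u, x u * (H * K) u w := by
          simp only [Finset.sum_mul, Matrix.mul_apply, Finset.mul_sum]
          rw [Finset.sum_comm]
          exact Finset.sum_congr rfl fun u _ => Finset.sum_congr rfl fun v _ => mul_assoc _ _ _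
      _ = n * (2 * x w) := by
          rw [h1]
          simp only [Matrix.smul_apply, Matrix.one_apply, smul_eq_mul, mul_ite, mul_one, mul_zero,
            Finset.sum_ite_eq', Finset.mem_univ, if_true]
          ring
  have h3 : (2 : ZMod d) • (fun w => (x w : ZMod d)) = modMul d Kᵀ fun v => (y v : ZMod d) := by
    funext w
    rw [modMul_apply, Pi.smul_apply, smul_eq_mul]
    have h4 := congrArg (Int.cast : ℤ → ZMod d) (h2 w)
    push_cast at h4
    rw [← h4]
    exact Finset.sum_congr rfl fun v _ => mul_comm _ _
  obtain ⟨u, hu⟩ := hd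
  have h5 : (fun w => (x w : ZMod d)) = (↑u⁻¹ : ZMod d) • (2 : ZMod d) •
      (fun w => (x w : ZMod d)) := by
    rw [← hu, smul_smul, Units.inv_mul, one_smul]
  rw [h5, h3]
  exact Submodule.smul_mem _ _ ⟨_, rfl⟩

end skew

/-! ### Ranks of skew-symmetric matrices -/

section evenRank

open Matrix

variable {V W : Type*} [Fintype W]

theorem Matrix.card_range_modMul_eq_pow (q : ℕ) [Fact q.Prime] (S : Matrix V W ℤ) :
    Nat.card (LinearMap.range (modMul q S)) =
      q ^ Module.finrank (ZMod q) (LinearMap.range (modMul q S)) := by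
  rw [Module.natCard_eq_pow_finrank (K := ZMod q), Nat.card_zmod]

variable [Fintype V]

/-- A skew-symmetric matrix has even rank modulo an odd prime: its restriction to a complement of
the kernel is nondegenerate and skew-symmetric. -/
theorem Matrix.even_finrank_range_modMul {q : ℕ} [Fact q.Prime] (hq : q ≠ 2) {S : Matrix V V ℤ}
    (hS : Sᵀ = -S) : Even (Module.finrank (ZMod q) (LinearMap.range (modMul q S))) := by
  classical
  set L := modMul q S with hL
  have hskew : ∀ x y : V → ZMod q, x ⬝ᵥ L y = -(y ⬝ᵥ L x) := by
    intro x y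
    simp only [dotProduct, hL, modMul_apply, Finset.mul_sum]
    rw [Finset.sum_comm, ← Finset.sum_neg_distrib]
    refine Finset.sum_congr rfl fun v _ => ?_
    rw [← Finset.sum_neg_distrib]
    refine Finset.sum_congr rfl fun w _ => ?_
    have h1 : S w v = -S v w := congrFun (congrFun hS v) w
    rw [h1]
    push_cast
    ring
  obtain ⟨C, hC⟩ := Submodule.exists_isCompl (LinearMap.ker L)
  have hfin : Module.finrank (ZMod q) (LinearMap.range L) = Module.finrank (ZMod q) C := by
    have h1 := LinearMap.finrank_range_add_finrank_ker L
    have h2 := Submodule.finrank_add_eq_of_isCompl hC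
    omega
  rw [hfin]
  set m := Module.finrank (ZMod q) C
  let w : Module.Basis (Fin m) (ZMod q) C := Module.finBasis (ZMod q) C
  let N : Matrix (Fin m) (Fin m) (ZMod q) := fun i j => (w i : V → ZMod q) ⬝ᵥ L (w j)
  have hN : Nᵀ = -N := by
    ext i j
    exact hskew _ _
  have hdet : N.det ≠ 0 := by
    intro h0
    obtain ⟨x, hx, hNx⟩ := Matrix.exists_mulVec_eq_zero_iff.2 h0
    set y : C := ∑ j, x j • w j with hy
    have h1 : ∀ i, (w i : V → ZMod q) ⬝ᵥ L y = 0 := by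
      intro i
      have h2 := congrFun hNx i
      simp only [mulVec, N, Pi.zero_apply] at h2
      rw [← h2, hy]
      simp only [AddSubmonoidClass.coe_finsetSum, map_sum, Submodule.coe_smul, map_smul]
      rw [dotProduct_sum]
      simp only [dotProduct_smul, smul_eq_mul]
      exact Finset.sum_congr rfl fun j _ => mul_comm _ _
    have h3 : ∀ c ∈ C, c ⬝ᵥ L y = 0 := by
      intro c hc
      rw [← show ((⟨c, hc⟩ : C) : V → ZMod q) = c from rfl, ← w.sum_repr ⟨c, hc⟩]
      simp only [AddSubmonoidClass.coe_finsetSum, Submodule.coe_smul]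
      rw [sum_dotProduct]
      refine Finset.sum_eq_zero fun i _ => ?_
      rw [smul_dotProduct, h1, smul_zero]
    have h4 : ∀ u, u ⬝ᵥ L y = 0 := by
      intro u
      have hu : u ∈ LinearMap.ker L ⊔ C := by
        rw [hC.sup_eq_top]
        trivial
      obtain ⟨a, ha, c, hc, rfl⟩ := Submodule.mem_sup.1 hu
      rw [add_dotProduct, h3 c hc, hskew, LinearMap.mem_ker.1 ha, dotProduct_zero, neg_zero,
        add_zero]
    have h5 : L y = 0 := by
      funext v
      have := h4 (Pi.single v 1)
      rwa [single_one_dotProduct] at this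
    have h6 : (y : V → ZMod q) = 0 := by
      have := hC.inf_eq_bot
      exact (Submodule.mem_bot (ZMod q)).1 (this ▸ ⟨h5, y.2⟩)
    have h7 : y = 0 := Subtype.ext h6
    rw [hy] at h7
    exact hx (funext fun i => Fintype.linearIndependent_iff.1 w.linearIndependent x h7 i)
  by_contra hodd
  rw [Nat.not_even_iff_odd] at hodd
  have h1 := congrArg Matrix.det hN
  rw [Matrix.det_transpose, Matrix.det_neg, Fintype.card_fin, hodd.neg_one_pow] at h1
  have h2 : (2 : ZMod q) * N.det = 0 := by linear_combination h1
  rcases mul_eq_zero.1 h2 with h | h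
  · have h3 : ((2 : ℕ) : ZMod q) = 0 := by exact_mod_cast h
    rw [ZMod.natCast_eq_zero_iff] at h3
    exact hq ((Nat.prime_dvd_prime_iff_eq (Fact.out) Nat.prime_two).1 h3)
  · exact hdet h

open Classical in
/-- A parity condition from the even rank of a skew-symmetric matrix `A * Kᵀ`, in the setting of
`IsSkewNormalForm.eqUpToTwo`. -/
theorem exists_card_eq_add_two_mul {n : ℕ} (hn : 0 < n) {A K : Matrix V W ℤ} {H : Matrix W V ℤ}
    (hVW : Fintype.card V = Fintype.card W)
    (hKH : K * H = (2 * n : ℤ) • (1 : Matrix V V ℤ)) (hskew : (A * Kᵀ)ᵀ = -(A * Kᵀ)) {t : ℕ}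
    (hker : ∀ q : ℕ, q.Prime → q ≠ 2 → Nat.card (LinearMap.ker (modMul q A)) = q ^ t) :
    ∃ l, Fintype.card V = t + 2 * l := by
  obtain ⟨q, hq1, hq⟩ := Nat.exists_infinite_primes (n + 3)
  have : Fact q.Prime := ⟨hq⟩
  obtain ⟨l, hl⟩ := Matrix.even_finrank_range_modMul (q := q) (by omega) hskew
  have h1 := card_ker_mul_card_range_modMul q (A * Kᵀ)
  rw [card_ker_modMul_comp_bijective (modMul_transpose_bijective hVW hKH hq (by omega)
    (Nat.not_dvd_of_pos_of_lt hn (by omega))), hker q hq (by omega),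
    Matrix.card_range_modMul_eq_pow, hl, ← pow_add] at h1
  have h2 := Nat.pow_right_injective hq.two_le h1
  exact ⟨l, by omega⟩

end evenRank

/-! ### The kernel on balanced vectors -/

namespace IdealTriangulation

open Matrix

variable {F : Type*} {T : IdealTriangulation F} (hT : T.NoInteriorPuncture)
  {R : Type*} [CommRing R]

/-- A cocycle is determined by the boundary: twice its value on a side is the difference of its
values on the boundary edges where the two paths of left turns from the ends of the side exit. -/
def IsBoundaryDetermined (φ : F × Fin 3 → R) : Prop :=
  ∀ h, 2 * φ h = φ (exit hT h).1 - φ (exit hT (rot h)).1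

/-- The cocycle with given antiperiodic values on the boundary; `i2` stands for the inverse of
`2`. -/
noncomputable def ofBoundary (i2 : R) (ψ : T.BoundaryEdge → R) (h : F × Fin 3) : R :=
  i2 * (ψ (exit hT h) - ψ (exit hT (rot h)))

theorem ofBoundary_mem (i2 : R) (ψ : T.BoundaryEdge → R) : ofBoundary hT i2 ψ ∈ cocycles T R := by
  refine ⟨fun h hh => ?_, fun f => ?_⟩
  · have h1 := exit_rot_glue hT hh
    have h2 := exit_rot_glue hT (T.glue_ne_iff.2 hh)
    rw [T.glue_glue] at h2
    simp only [ofBoundary, h1, h2]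
    ring
  · simp only [ofBoundary, rot, zero_add, show (1 : Fin 3) + 1 = 2 from rfl,
      show (2 : Fin 3) + 1 = 0 from rfl]
    ring

theorem ofBoundary_boundary [Fintype F] {i2 : R} (hi : i2 * 2 = 1) {ψ : T.BoundaryEdge → R}
    (hψ : ∀ b, ψ (prevEdge hT b) = -ψ b) (b : T.BoundaryEdge) : ofBoundary hT i2 ψ b.1 = ψ b := by
  rw [ofBoundary, exit_boundary, ← prevEdge_apply, hψ]
  linear_combination ψ b * hi

variable [Fintype F]

/-- A cocycle determined by the boundary is antiperiodic on the boundary, and any antiperiodic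
function arises. -/
theorem card_boundaryDetermined (h2 : IsUnit (2 : R)) :
    Nat.card {φ : cocycles T R // IsBoundaryDetermined hT φ.1} =
      Nat.card R ^ T.numEvenComponents := by
  obtain ⟨i2, hi⟩ := h2.exists_left_inv
  rw [← card_antiperiodic hT (M := R) (fun m hm => by
    rw [nsmul_eq_mul] at hm
    push_cast at hm
    linear_combination i2 * hm - m * hi)]
  refine Nat.card_congr
    { toFun := fun φ => ⟨fun b => φ.1.1 b.1, fun b => ?_⟩
      invFun := fun ψ => ⟨⟨ofBoundary hT i2 ψ.1, ofBoundary_mem hT i2 ψ.1⟩, fun h => ?_⟩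
      left_inv := fun φ => ?_
      right_inv := fun ψ => ?_ }
  · have h1 := φ.2 b.1
    rw [exit_boundary, ← prevEdge_apply] at h1
    linear_combination h1
  · dsimp only
    rw [ofBoundary_boundary hT hi ψ.2, ofBoundary_boundary hT hi ψ.2, ofBoundary]
    linear_combination (ψ.1 (exit hT h) - ψ.1 (exit hT (rot h))) * hi
  · refine Subtype.ext (Subtype.ext (funext fun h => ?_))
    have h1 := φ.2 h
    simp only [ofBoundary]
    rw [← h1]
    linear_combination φ.1.1 h * hi
  · exact Subtype.ext (funext fun b => ofBoundary_boundary hT hi ψ.2 b)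

/-- The size of the range of `A * Kᵀ` modulo `d`, if the row space of `K` is parametrized by
cocycles. -/
theorem card_range_mul_pow {V W : Type*} [Fintype V] [Fintype W] {d : ℕ} [NeZero d]
    (hd : IsUnit (2 : ZMod d)) (A K : Matrix V W ℤ)
    (Φ : cocycles T (ZMod d) →ₗ[ZMod d] (W → ZMod d))
    (hΦ : LinearMap.range Φ = LinearMap.range (modMul d Kᵀ))
    (hker : ∀ φ, modMul d A (Φ φ) = 0 ↔ IsBoundaryDetermined hT φ.1) :
    Nat.card (LinearMap.range (modMul d (A * Kᵀ))) * d ^ (T.numEvenComponents + Nat.card F) =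
      d ^ Nat.card T.Edge := by
  have h1 := AddMonoidHom.card_ker_mul_card_range ((modMul d A).comp Φ).toAddMonoidHom
  have h2 : Nat.card ((modMul d A).comp Φ).toAddMonoidHom.ker = d ^ T.numEvenComponents := by
    have := card_boundaryDetermined hT hd
    rw [Nat.card_zmod] at this
    rw [← this]
    exact Nat.card_congr (Equiv.subtypeEquivRight hker)
  have h3 : Nat.card ((modMul d A).comp Φ).toAddMonoidHom.range =
      Nat.card (LinearMap.range (modMul d (A * Kᵀ))) := by
    have h4 : modMul d (A * Kᵀ) = (modMul d A).comp (modMul d Kᵀ) :=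
      LinearMap.ext fun x => modMul_mul d A Kᵀ x
    rw [h4, LinearMap.range_comp, ← hΦ, ← LinearMap.range_comp]
    rfl
  have h5 := card_cocycles (T := T) (R := ZMod d) hT
  rw [Nat.card_zmod] at h5
  rw [← h5, ← h1, h2, h3, pow_add]
  ring

variable {n : ℕ}

/-- The value of the reduced end matrix at a balanced vector. -/
theorem endMatrix_mulVec_balanced (hn : (n : R) = 0) {φ : F × Fin 3 → R} (hφ : φ ∈ cocycles T R)
    (f : F) (c : SmallVertex n) (a : Fin 3) :
    ((endMatrix hT n).map (Int.cast : ℤ → R)).mulVec (balanced n φ) (T.vertex f c) =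
      c.coord a * (φ (exit hT (f, a)).1 - φ (exit hT (f, a + 1)).1 - 2 * φ (f, a)) -
      c.coord (a + 2) * (φ (exit hT (f, a + 1)).1 - φ (exit hT (f, a + 2)).1
        - 2 * φ (f, a + 1)) := by
  rw [endMatrix_mulVec, balanced_vertex hn hφ f c a, sum_fin_three _ a,
    sideVal_balanced hn hφ _ (c.coord_lt _).le, sideVal_balanced hn hφ _ (c.coord_lt _).le,
    sideVal_balanced hn hφ _ (c.coord_lt _).le]
  have h1 := coord_sum_cast hn c a
  linear_combination φ (exit hT (f, a + 1)).1 * h1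

theorem endMatrix_mulVec_balanced_eq_zero_iff (h2 : 2 ≤ n) (hn : (n : R) = 0)
    {φ : F × Fin 3 → R} (hφ : φ ∈ cocycles T R) :
    ((endMatrix hT n).map (Int.cast : ℤ → R)).mulVec (balanced n φ) = 0 ↔
      IsBoundaryDetermined hT φ := by
  constructor
  · rintro h ⟨f, a⟩
    -- At this vertex, the factors `c a` and `c (a + 2)` in the value of the end matrix are `1`
    -- and `0`.
    have h3 := congrFun h (T.vertex f (sideVertex a (w := 1) one_pos (by omega)))
    rw [endMatrix_mulVec_balanced hT hn hφ f _ a, sideVertex_coord, sideVertex_coord_add_two,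
      Pi.zero_apply] at h3
    rw [rot]
    push_cast at h3
    linear_combination -h3
  · intro h
    funext u
    obtain ⟨f, c, rfl⟩ := exists_vertex u
    have h3 := h (f, 0)
    have h4 := h (f, 1)
    simp only [rot, zero_add, show (1 : Fin 3) + 1 = 2 from rfl] at h3 h4
    rw [endMatrix_mulVec_balanced hT hn hφ f c 0]
    simp only [zero_add, Pi.zero_apply]
    linear_combination -(c.coord 0 : R) * h3 + (c.coord 2 : R) * h4

/-- Modulo the odd divisors of `n`, the rows of `Kbar` generate the balanced vectors. -/
theorem range_balancedHom (hT : T.NoInteriorPuncture) (hn : 0 < n) {d : ℕ} (hdn : d ∣ n)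
    (hd : IsUnit (2 : ZMod d)) :
    LinearMap.range ((balancedHom T (ZMod d) n).comp (cocycles T (ZMod d)).subtype) =
      LinearMap.range (modMul d (T.Kbar n)ᵀ) := by
  classical
  have hn0 : ((n : ℕ) : ZMod d) = 0 := (ZMod.natCast_eq_zero_iff _ _).2 hdn
  refine le_antisymm ?_ ?_
  · rintro _ ⟨⟨φ, hφ⟩, rfl⟩
    obtain ⟨ψ, hψ, hψφ⟩ := exists_lift_cocycle hT d hφ
    have h1 := mem_range_modMul_transpose hn (K := T.Kbar n) (H := invMatrix T n) rfl
      (by convert Kbar_mul_invMatrix hT) (balanced (T := T) n ψ) (fun v => by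
        rw [← ZMod.intCast_zmod_eq_zero_iff_dvd]
        have h2 := balanced_vecMul_invMatrix (R := ZMod n) (by simp)
          (map_mem_cocycles (Int.castRingHom (ZMod n)) hψ) v
        rw [← h2]
        push_cast
        refine Finset.sum_congr rfl fun u _ => ?_
        simp [balanced]) hd
    convert h1 using 1
    funext u
    simp [balancedHom, balanced, hψφ]
  · rintro _ ⟨y, rfl⟩
    have h1 : modMul d (T.Kbar n)ᵀ y = ∑ u, y u •
        balancedHom T (ZMod d) n (rowCocycle T (ZMod d) u.out.1 u.out.2) := by
      funext v
      rw [modMul_apply, Finset.sum_apply]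
      refine Finset.sum_congr rfl fun u _ => ?_
      have hu : T.vertex (Quot.out u).1 (Quot.out u).2 = u := Quot.out_eq u
      have h2 := Kbar_row_eq_balanced (R := ZMod d) hT hn0 u.out.1 u.out.2 v
      rw [hu] at h2
      rw [Matrix.transpose_apply, h2, mul_comm]
      rfl
    rw [h1]
    refine Submodule.sum_mem _ fun u _ => Submodule.smul_mem _ _
      ⟨⟨rowCocycle T (ZMod d) u.out.1 u.out.2, rowCocycle_mem hT hn0 _ _⟩, rfl⟩

theorem _root_.ZMod.isUnit_two_of_odd {d : ℕ} (hd : Odd d) : IsUnit (2 : ZMod d) := by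
  have := (ZMod.isUnit_iff_coprime 2 d).2 (Nat.coprime_two_left.2 hd)
  exact_mod_cast this

theorem card_range_endMatrix (h2 : 2 ≤ n) {d : ℕ} (hd : Odd d) (hdn : d ∣ n) :
    Nat.card (LinearMap.range (modMul d (endMatrix hT n * (T.Kbar n)ᵀ))) *
      d ^ (T.numEvenComponents + Nat.card F) = d ^ Nat.card T.Edge := by
  have : NeZero d := ⟨hd.pos.ne'⟩
  have hn0 : ((n : ℕ) : ZMod d) = 0 := (ZMod.natCast_eq_zero_iff _ _).2 hdn
  exact card_range_mul_pow hT (ZMod.isUnit_two_of_odd hd) _ _ _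
    (range_balancedHom hT (by omega) hdn (ZMod.isUnit_two_of_odd hd))
    fun φ => endMatrix_mulVec_balanced_eq_zero_iff hT h2 hn0 φ.2

end IdealTriangulation

/-! ### The kernel of the reduced end matrix -/

namespace IdealTriangulation

open Matrix

variable {F : Type*} {T : IdealTriangulation F} (hT : T.NoInteriorPuncture)
  {R : Type*} [CommRing R] {n : ℕ}

/-- A function on the small vertices of the boundary, by boundary edge `b = (f, a)` and coordinate
`w` in position `a`. The values for `w = 1, …, n - 1` are `y 0 b, …, y (n - 2) b`, and those for
other `w` are `0`. -/
def boundaryValue (y : Fin (n - 1) → T.BoundaryEdge → R) (b : T.BoundaryEdge) (w : ℕ) : R :=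
  if h : 0 < w ∧ w < n then y ⟨w - 1, by omega⟩ b else 0

theorem boundaryValue_succ (y : Fin (n - 1) → T.BoundaryEdge → R) (b : T.BoundaryEdge)
    (i : Fin (n - 1)) : boundaryValue y b (i + 1) = y i b := by
  have := i.2
  exact dif_pos ⟨by omega, by omega⟩

theorem boundaryValue_sideVal (x : T.Vbar n → R) (h : T.BoundaryEdge → F × Fin 3)
    (b : T.BoundaryEdge) (w : ℕ) :
    boundaryValue (n := n) (fun i b => sideVal x (h b) (i + 1)) b w = sideVal x (h b) w := by
  unfold boundaryValue
  split_ifs with hw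
  · dsimp only
    rw [show w - 1 + 1 = w by omega]
  · rcases Nat.eq_zero_or_pos w with rfl | h0
    · rw [sideVal_zero]
    · rw [sideVal_of_le]
      omega

/-- The function on the small vertices with given values on the boundary that is annihilated by the
end matrix; `i2` stands for the inverse of `2`. -/
noncomputable def ofBoundaryValue (n : ℕ) (i2 : R) (y : Fin (n - 1) → T.BoundaryEdge → R)
    (u : T.Vbar n) : R :=
  i2 * ∑ a, boundaryValue y (exit hT (u.out.1, a)) (u.out.2.coord a)

theorem ofBoundaryValue_vertex (i2 : R) (y : Fin (n - 1) → T.BoundaryEdge → R) (f : F)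
    (c : SmallVertex n) : ofBoundaryValue hT n i2 y (T.vertex f c) =
      i2 * ∑ a, boundaryValue y (exit hT (f, a)) (c.coord a) := by
  have hu : T.vertex (Quot.out (T.vertex f c)).1 (Quot.out (T.vertex f c)).2 = T.vertex f c :=
    Quot.out_eq (T.vertex f c)
  unfold ofBoundaryValue
  rcases vertex_eq_iff.1 hu with h | ⟨a, a', h1, h2, h3, h4, h5, h6⟩
  · rw [Prod.mk.injEq] at h
    rw [h.1, h.2]
  · dsimp only at h1 h2 h3 h4 h5 h6
    have h7 : T.glue ((Quot.out (T.vertex f c)).1, a) ≠ ((Quot.out (T.vertex f c)).1, a) := by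
      rw [h1]
      exact h2
    have h8 := exit_rot_glue hT h7
    have h9 := exit_rot_glue hT (T.glue_ne_iff.2 h7)
    rw [T.glue_glue] at h9
    rw [h1] at h8 h9
    simp only [rot] at h8 h9
    rw [sum_fin_three _ a, sum_fin_three _ a', h3, h4, h5, h6, h8, h9]
    simp [boundaryValue]
    ring

variable [Fintype F]

/-- Functions invariant under the square of `prevEdge` are sums of a periodic and an antiperiodic
function. -/
theorem card_two_periodic (h2 : IsUnit (2 : R)) :
    Nat.card {u : T.BoundaryEdge → R // ∀ b, u (prevEdge hT (prevEdge hT b)) = u b} =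
      Nat.card R ^ (T.numComponents + T.numEvenComponents) := by
  obtain ⟨i2, hi⟩ := h2.exists_left_inv
  rw [pow_add, ← card_antiperiodic hT (M := R) (fun m hm => by
    rw [nsmul_eq_mul] at hm
    push_cast at hm
    linear_combination i2 * hm - m * hi), ← card_periodic hT, ← Nat.card_prod]
  refine Nat.card_congr
    { toFun := fun u => (⟨fun b => u.1 b + u.1 (prevEdge hT b), fun b => ?_⟩,
        ⟨fun b => u.1 b - u.1 (prevEdge hT b), fun b => ?_⟩)
      invFun := fun x => ⟨fun b => i2 * (x.1.1 b + x.2.1 b), fun b => ?_⟩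
      left_inv := fun u => ?_
      right_inv := fun x => ?_ }
  · dsimp only
    rw [u.2, add_comm]
  · dsimp only
    rw [u.2]
    ring
  · dsimp only
    rw [x.1.2, x.1.2, x.2.2, x.2.2, neg_neg]
  · refine Subtype.ext (funext fun b => ?_)
    dsimp only
    linear_combination u.1 b * hi
  · refine Prod.ext (Subtype.ext (funext fun b => ?_)) (Subtype.ext (funext fun b => ?_))
    · dsimp only
      rw [x.1.2, x.2.2]
      linear_combination x.1.1 b * hi
    · dsimp only
      rw [x.1.2, x.2.2]
      linear_combination x.2.1 b * hi

/-- Functions on the small vertices of the boundary that are reversed when one passes to the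
preceding boundary edge. -/
def Reversing (R : Type*) (N : ℕ) : Type _ :=
  {y : Fin N → T.BoundaryEdge → R // ∀ i b, y i.rev (prevEdge hT b) = y i b}

/-- A reversing function is given by its values in the first half of the positions, which are
invariant under the square of `prevEdge`, and in the middle position if there is one, where it is
periodic. -/
theorem card_reversing (h2 : IsUnit (2 : R)) (N : ℕ) :
    Nat.card (Reversing hT R N) = Nat.card R ^
      ((T.numComponents + T.numEvenComponents) * (N / 2) + T.numComponents * (N % 2)) := by
  rw [pow_add, pow_mul, pow_mul, ← card_two_periodic hT h2, ← card_periodic hT (M := R)]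
  conv_rhs => rw [← Nat.card_fin (N / 2), ← Nat.card_fin (N % 2), ← Nat.card_fun, ← Nat.card_fun,
    ← Nat.card_prod]
  have hlow : ∀ j : Fin (N / 2), (j : ℕ) < N := fun j => by have := j.2; omega
  have hmid : ∀ j : Fin (N % 2), N / 2 < N := fun j => by have := j.2; omega
  refine Nat.card_congr
    { toFun := fun y => (fun j => ⟨y.1 ⟨j, hlow j⟩, fun b => ?_⟩,
        fun j => ⟨y.1 ⟨N / 2, hmid j⟩, fun b => ?_⟩)
      invFun := fun x => ⟨fun i b => if h : (i : ℕ) < N / 2 then (x.1 ⟨i, h⟩).1 b else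
        if h' : N - 1 - i < N / 2 then (x.1 ⟨N - 1 - i, h'⟩).1 (prevEdge hT b) else
          (x.2 ⟨0, by omega⟩).1 b, fun i b => ?_⟩
      left_inv := fun y => ?_
      right_inv := fun x => ?_ }
  · have h1 := y.2 ⟨j, hlow j⟩ b
    have h3 := y.2 (Fin.rev ⟨j, hlow j⟩) (prevEdge hT b)
    rw [Fin.rev_rev] at h3
    rw [h3, h1]
  · have h1 := y.2 ⟨N / 2, hmid j⟩ b
    have h3 : Fin.rev ⟨N / 2, hmid j⟩ = ⟨N / 2, hmid j⟩ := by
      ext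
      have := j.2
      simp only [Fin.val_rev]
      omega
    rwa [h3] at h1
  · have hi := i.2
    have hr : (i.rev : ℕ) = N - 1 - i := by
      rw [Fin.val_rev]
      omega
    dsimp only
    simp only [hr]
    rcases lt_trichotomy (2 * (i : ℕ) + 1) N with h | h | h
    · have e : N - 1 - (N - 1 - i) = (i : ℕ) := by omega
      simp only [e]
      rw [dif_neg (by omega), dif_pos (by omega), dif_pos (by omega)]
      exact (x.1 _).2 b
    · rw [dif_neg (by omega), dif_neg (by omega), dif_neg (by omega), dif_neg (by omega)]
      exact (x.2 _).2 b
    · rw [dif_pos (by omega), dif_neg (by omega), dif_pos (by omega)]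
  · refine Subtype.ext (funext fun i => funext fun b => ?_)
    have hi := i.2
    have hr : (i.rev : ℕ) = N - 1 - i := by
      rw [Fin.val_rev]
      omega
    dsimp only
    split_ifs with h h'
    · rfl
    · exact (congrArg (fun j => y.1 j (prevEdge hT b)) (Fin.ext hr.symm)).trans (y.2 i b)
    · have : (⟨N / 2, hmid ⟨0, by omega⟩⟩ : Fin N) = i := by
        ext
        dsimp only
        omega
      rw [this]
  · refine Prod.ext (funext fun j => Subtype.ext (funext fun b => ?_))
      (funext fun j => Subtype.ext (funext fun b => ?_))
    · exact dif_pos j.2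
    · have hj := j.2
      dsimp only
      rw [dif_neg (by omega), dif_neg (by omega)]
      have : (⟨0, by omega⟩ : Fin (N % 2)) = j := Fin.ext (by dsimp only; omega)
      rw [this]

theorem sideVal_ofBoundaryValue {i2 : R} (hi : i2 * 2 = 1) {y : Fin (n - 1) → T.BoundaryEdge → R}
    (hy : ∀ i b, y i.rev (prevEdge hT b) = y i b) (b : T.BoundaryEdge) (w : ℕ) :
    sideVal (ofBoundaryValue hT n i2 y) b.1 w = boundaryValue y b w := by
  rcases Nat.eq_zero_or_pos w with rfl | h0
  · rw [sideVal_zero]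
    simp [boundaryValue]
  rcases le_or_gt n w with hw | hw
  · rw [sideVal_of_le _ _ hw, boundaryValue, dif_neg (by omega)]
  rw [sideVal_eq _ _ h0 hw, ofBoundaryValue_vertex, sum_fin_three _ b.1.2, sideVertex_coord,
    sideVertex_coord_add_one, sideVertex_coord_add_two]
  have h1 : exit hT (b.1.1, b.1.2) = b := exit_boundary hT b
  have h2 : exit hT (b.1.1, b.1.2 + 1) = prevEdge hT b := rfl
  have h3 : boundaryValue y (prevEdge hT b) (n - w) = boundaryValue y b w := by
    rw [boundaryValue, boundaryValue, dif_pos (by omega), dif_pos (by omega)]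
    refine (congrArg (fun j => y j (prevEdge hT b)) (Fin.ext ?_)).trans (hy ⟨w - 1, by omega⟩ b)
    simp only [Fin.val_rev]
    omega
  have h4 : boundaryValue y (exit hT (b.1.1, b.1.2 + 2)) 0 = 0 := by simp [boundaryValue]
  rw [h1, h2, h3, h4]
  linear_combination boundaryValue y b w * hi

/-- A vector in the kernel of the end matrix is determined by its values on the boundary, and these
are reversing, as follows from the equations at the vertices of the boundary. -/
theorem card_ker_endMatrix_eq (h2 : IsUnit (2 : R)) :
    Nat.card {x : T.Vbar n → R // ((endMatrix hT n).map (Int.cast : ℤ → R)).mulVec x = 0} =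
      Nat.card (Reversing hT R (n - 1)) := by
  obtain ⟨i2, hi⟩ := h2.exists_left_inv
  refine Nat.card_congr
    { toFun := fun x => ⟨fun i b => sideVal x.1 b.1 (i + 1), fun i b => ?_⟩
      invFun := fun y => ⟨ofBoundaryValue hT n i2 y.1, ?_⟩
      left_inv := fun x => ?_
      right_inv := fun y => ?_ }
  · have hin := i.2
    have h0 : 0 < (i : ℕ) + 1 := by omega
    have hw : (i : ℕ) + 1 < n := by omega
    have h1 := congrFun x.2 (T.vertex b.1.1 (sideVertex b.1.2 h0 hw))
    rw [endMatrix_mulVec, sum_fin_three _ b.1.2, ← sideVal_eq x.1 b.1, sideVertex_coord,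
      sideVertex_coord_add_one, sideVertex_coord_add_two, sideVal_zero, Pi.zero_apply] at h1
    have h3 : exit hT (b.1.1, b.1.2) = b := exit_boundary hT b
    have h4 : exit hT (b.1.1, b.1.2 + 1) = prevEdge hT b := rfl
    have h5 : ((i.rev : Fin (n - 1)) : ℕ) + 1 = n - (i + 1) := by
      rw [Fin.val_rev]
      omega
    dsimp only
    rw [h3, h4] at h1
    rw [h5]
    linear_combination h1
  · funext u
    obtain ⟨f, c, rfl⟩ := exists_vertex u
    rw [endMatrix_mulVec]
    simp only [sideVal_ofBoundaryValue hT hi y.2]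
    rw [ofBoundaryValue_vertex, Pi.zero_apply]
    linear_combination (-∑ a, boundaryValue y.1 (exit hT (f, a)) (c.coord a)) * hi
  · refine Subtype.ext (funext fun u => ?_)
    obtain ⟨f, c, rfl⟩ := exists_vertex u
    dsimp only
    rw [ofBoundaryValue_vertex]
    have h1 := congrFun x.2 (T.vertex f c)
    rw [endMatrix_mulVec, Pi.zero_apply] at h1
    simp only [boundaryValue_sideVal x.1 (fun b => b.1)]
    linear_combination i2 * h1 + x.1 (T.vertex f c) * hi
  · refine Subtype.ext (funext fun i => funext fun b => ?_)
    dsimp only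
    rw [sideVal_ofBoundaryValue hT hi y.2, boundaryValue_succ]

theorem card_ker_modMul_endMatrix {q : ℕ} (hq : q.Prime) (hq2 : q ≠ 2) :
    Nat.card (LinearMap.ker (modMul q (endMatrix hT n))) =
      q ^ ((T.numComponents + T.numEvenComponents) * ((n - 1) / 2)
        + T.numComponents * ((n - 1) % 2)) := by
  have h2 := ZMod.isUnit_two_of_odd (hq.odd_of_ne_two hq2)
  rw [← Nat.card_zmod q, ← card_reversing hT h2, ← card_ker_endMatrix_eq hT h2, Nat.card_zmod]
  rfl

end IdealTriangulation

/-! ### Counting edges, components and small vertices -/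

namespace IdealTriangulation

open Matrix

section counts

variable {F : Type*} {T : IdealTriangulation F}

open Classical in
/-- The edges with an orientation are the sides of the faces, the boundary edges being counted
twice. -/
theorem card_edge [Finite F] : 2 * Nat.card T.Edge = 3 * Nat.card F + T.numBoundaryEdges := by
  let g : T.Edge × Fin 2 → (F × Fin 3) ⊕ T.BoundaryEdge := fun x =>
    if x.2 = 0 then Sum.inl x.1.out else
      if hb : T.glue x.1.out = x.1.out then Sum.inr ⟨x.1.out, hb⟩ else Sum.inl (T.glue x.1.out)
  have hmk : ∀ e : T.Edge, (Quot.mk _ e.out : T.Edge) = e := fun e => Quot.out_eq e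
  have hg : Function.Bijective g := by
    constructor
    · rintro ⟨e, i⟩ ⟨e', i'⟩ h
      have key : ∀ e e' : T.Edge, e.out = T.glue e'.out → T.glue e'.out = e'.out := by
        intro e e' h1
        have h2 : e = e' := by
          rw [← hmk e, ← hmk e']
          exact (edge_eq_iff.2 (Or.inr h1)).symm
        rw [← h1, h2]
      have hout : ∀ e e' : T.Edge, e.out = e'.out → e = e' := fun e e' h1 => by
        rw [← hmk e, ← hmk e', h1]
      simp only [g] at h
      split_ifs at h with h1 h2 h3 h4 h5 h6 h7
      · rw [hout _ _ (Sum.inl_injective h), h1, h2]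
      · exact (h3 (key _ _ (Sum.inl_injective h))).elim
      · have h8 : e = e' := hout _ _ (congrArg Subtype.val (Sum.inr_injective h))
        rw [h8, show i = i' by omega]
      · exact (h4 (key _ _ (Sum.inl_injective h).symm)).elim
      · have h8 : e = e' := hout _ _ (T.glue_injective (Sum.inl_injective h))
        rw [h8, show i = i' by omega]
    · rintro (h | b)
      · rcases out_edge (T := T) h with h1 | h1
        · exact ⟨(Quot.mk _ h, 0), by simp [g, h1]⟩
        · by_cases hb : T.glue h = h
          · rw [hb] at h1
            exact ⟨(Quot.mk _ h, 0), by simp [g, h1]⟩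
          · refine ⟨(Quot.mk _ h, 1), ?_⟩
            simp only [g]
            rw [if_neg (by simp), dif_neg]
            · rw [h1, T.glue_glue]
            · rw [h1, T.glue_glue]
              exact fun h => hb h.symm
      · refine ⟨(Quot.mk _ b.1, 1), ?_⟩
        have h1 : (Quot.mk _ b.1 : T.Edge).out = b.1 := by
          rcases out_edge (T := T) b.1 with h1 | h1
          · exact h1
          · rw [h1, b.2]
        simp only [g]
        rw [if_neg (by simp), dif_pos]
        · exact congrArg _ (Subtype.ext h1)
        · rw [h1, b.2]
  have h1 := Nat.card_eq_of_bijective g hg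
  have : Finite T.Edge := Finite.of_surjective _ Quot.mk_surjective
  rw [Nat.card_prod, Nat.card_sum, Nat.card_prod, Nat.card_fin, Nat.card_fin] at h1
  rw [numBoundaryEdges]
  omega

/-- The arc around a puncture ends in a single boundary edge. -/
theorem card_puncture (hT : T.NoInteriorPuncture) : Nat.card T.Puncture = T.numBoundaryEdges := by
  refine Nat.card_congr ⟨Quot.lift (exit hT) ?_, fun b => Quot.mk _ b.1, ?_, ?_⟩
  · rintro h _ ⟨h1, rfl⟩
    exact (exit_rot_glue hT h1).symm
  · intro p
    induction p using Quot.ind with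
    | mk h =>
      have h1 : ∀ {x y}, Relation.ReflTransGen T.Step x y →
          (Quot.mk _ y : T.Puncture) = Quot.mk _ x := by
        intro x y h
        induction h with
        | refl => rfl
        | tail _ h ih => exact (Quot.sound h).symm.trans ih
      exact h1 (reflTransGen_exit hT h)
  · exact fun b => exit_boundary hT b

theorem r_eq (hT : T.NoInteriorPuncture) : T.r = (Nat.card T.Edge : ℤ) - Nat.card F := by
  rw [r, eulerChar, card_puncture hT]
  ring

theorem numEvenComponents_le [Finite F] : T.numEvenComponents ≤ T.numComponents := by
  have : Finite T.BoundaryComponent := Finite.of_surjective _ Quot.mk_surjective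
  exact Nat.card_le_card_of_injective _ Subtype.val_injective

theorem numBoundaryEdges_le [Finite F] : T.numBoundaryEdges ≤ Nat.card T.Edge := by
  have : Finite T.Edge := Finite.of_surjective _ Quot.mk_surjective
  refine Nat.card_le_card_of_injective (fun b : T.BoundaryEdge => (Quot.mk _ b.1 : T.Edge)) ?_
  intro b b' h
  rcases edge_eq_iff.1 h with h1 | h1
  · exact Subtype.ext h1.symm
  · rw [b.2] at h1
    exact Subtype.ext h1.symm

theorem numComponents_le [Finite F] : T.numComponents ≤ T.numBoundaryEdges :=
  Nat.card_le_card_of_injective (fun C => C.out) fun C C' h => by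
    rw [← out_component C, ← out_component C']
    exact congrArg _ h

/-- Boundary edges of the same face lie on the same boundary component, so that there are at least
as many faces as boundary components. -/
theorem numComponents_le_card (hT : T.NoInteriorPuncture) [Fintype F] :
    T.numComponents ≤ Nat.card F := by
  refine Nat.card_le_card_of_injective (fun C => C.out.1.1) fun C C' h => ?_
  have key : ∀ b b' : T.BoundaryEdge, b'.1 = rot b.1 → T.component b' = T.component b := by
    intro b b' h1
    rw [← component_prevEdge hT b, prevEdge_apply, ← h1, exit_boundary]
  dsimp only at h
  rw [← out_component C, ← out_component C']
  rcases fin_three_cases C.out.1.2 C'.out.1.2 with h1 | h1 | h1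
  · exact congrArg _ (Subtype.ext (Prod.ext h h1))
  · exact key _ _ (Prod.ext h h1)
  · refine (key _ _ (Prod.ext h.symm ?_)).symm
    rw [rot, h1, add_assoc]
    simp

end counts

section small

variable {n : ℕ}

/-- The small vertices in the interior of a face. -/
abbrev InteriorVertex (n : ℕ) : Type := {c : SmallVertex n // ∀ a, c.coord a ≠ 0}

theorem card_interiorVertex : Nat.card (InteriorVertex n) = (n - 1).choose 2 := by
  have e : InteriorVertex n ≃ Σ s : Fin (n - 1), Fin s :=
    { toFun := fun c => ⟨⟨c.1.coord 0 + c.1.coord 1 - 1, by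
          have h0 := c.2 2
          have h1 := c.1.coord_sum
          have h2 := c.2 0
          omega⟩, ⟨c.1.coord 0 - 1, by
          have h1 := c.2 0
          have h2 := c.2 1
          dsimp only
          omega⟩⟩
      invFun := fun x => ⟨SmallVertex.ofCoord ![x.2 + 1, x.1 - x.2, n - 1 - x.1] (by
          have h1 := x.1.2
          have h2 := x.2.2
          intro a
          fin_cases a <;> simp <;> omega) (by
          have h1 := x.1.2
          have h2 := x.2.2
          simp
          omega), by
          have h1 := x.1.2
          have h2 := x.2.2
          intro a
          rw [SmallVertex.coord_ofCoord]
          fin_cases a <;> simp <;> omega⟩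
      left_inv := fun c => by
        have h0 := c.2 0
        have h1 := c.2 1
        have h2 := c.2 2
        have h3 := c.1.coord_sum
        refine Subtype.ext (SmallVertex.coord_injective ?_)
        dsimp only
        rw [SmallVertex.coord_ofCoord]
        funext a
        fin_cases a
        · simp
          omega
        · simp
          omega
        · simp
          omega
      right_inv := fun x => by
        obtain ⟨⟨s, hs⟩, ⟨j, hj⟩⟩ := x
        dsimp only at hj
        have e1 : j + 1 + (s - j) - 1 = s := by omega
        simp only [SmallVertex.coord_ofCoord]
        refine Sigma.ext (Fin.ext e1) ((Fin.heq_ext_iff e1).2 rfl) }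
  rw [Nat.card_congr e, Nat.card_sigma]
  simp only [Nat.card_fin]
  rw [Fin.sum_univ_eq_sum_range (fun i => i), Finset.sum_range_id, Nat.choose_two_right]

variable {F : Type*} {T : IdealTriangulation F}

theorem vertex_sideVertex_inj {h h' : F × Fin 3} {w w' : ℕ} {h0 : 0 < w} {hw : w < n}
    {h0' : 0 < w'} {hw' : w' < n}
    (e : T.vertex h.1 (sideVertex h.2 h0 hw) = T.vertex h'.1 (sideVertex h'.2 h0' hw')) :
    (h = h' ∧ w = w') ∨ (T.glue h = h' ∧ T.glue h ≠ h) := by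
  rcases vertex_eq_iff.1 e with h1 | ⟨a, a', h1, h2, h3, h4, -, -⟩
  · rw [Prod.mk.injEq] at h1
    have h2 : h.2 = h'.2 := by
      refine SmallVertex.side_unique (sideVertex_coord_add_two h.2 h0 hw) ?_
      rw [h1.2]
      exact sideVertex_coord_add_two _ _ _
    refine Or.inl ⟨Prod.ext h1.1 h2, ?_⟩
    rw [← sideVertex_coord h.2 h0 hw, h1.2, h2, sideVertex_coord]
  · right
    have h5 := SmallVertex.side_unique h3 (sideVertex_coord_add_two h.2 h0 hw)
    have h6 := SmallVertex.side_unique h4 (sideVertex_coord_add_two h'.2 h0' hw')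
    subst h5 h6
    exact ⟨h1, by rw [h1]; exact h2⟩

theorem sideVertex_of_coord {c : SmallVertex n} {a : Fin 3} (h : c.coord (a + 2) = 0) :
    ∃ (h0 : 0 < c.coord a) (hw : c.coord a < n), sideVertex a h0 hw = c := by
  have h1 := c.coord_sum' a
  have h2 := c.coord_lt (a + 1)
  refine ⟨by omega, c.coord_lt a, SmallVertex.eq_of_coord a (sideVertex_coord _ _ _) ?_⟩
  rw [sideVertex_coord_add_one]
  omega

theorem interior_ne {f g : F} {c d : SmallVertex n} (hc : ∀ a, c.coord a ≠ 0)
    (h : T.vertex f c = T.vertex g d) : f = g ∧ c = d := by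
  rcases vertex_eq_iff.1 h with h1 | ⟨a, a', -, -, h3, -, -, -⟩
  · rwa [Prod.mk.injEq] at h1
  · exact (hc _ h3).elim

/-- Small vertices lie in the interior of an edge or of a face. -/
theorem card_vbar [Finite F] : Nat.card (T.Vbar n) =
    Nat.card T.Edge * (n - 1) + Nat.card F * (n - 1).choose 2 := by
  have : Finite T.Edge := Finite.of_surjective _ Quot.mk_surjective
  let g : (T.Edge × Fin (n - 1)) ⊕ (F × InteriorVertex n) → T.Vbar n :=
    Sum.elim (fun x => T.vertex x.1.out.1 (sideVertex x.1.out.2 (w := x.2 + 1) (by omega)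
      (by have := x.2.2; omega))) (fun x => T.vertex x.1 x.2.1)
  have hmk : ∀ e : T.Edge, (Quot.mk _ e.out : T.Edge) = e := fun e => Quot.out_eq e
  have hg : Function.Bijective g := by
    constructor
    · rintro (⟨e, i⟩ | ⟨f, c⟩) (⟨e', i'⟩ | ⟨f', c'⟩) h
      · rcases vertex_sideVertex_inj h with ⟨h1, h2⟩ | ⟨h1, h2⟩
        · have h3 : e = e' := by rw [← hmk e, ← hmk e', h1]
          have h4 : (i : ℕ) + 1 = i' + 1 := h2
          rw [h3, show i = i' from Fin.ext (by omega)]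
        · have h3 : e = e' := by
            rw [← hmk e, ← hmk e', ← h1]
            exact edge_eq_iff.2 (Or.inr rfl)
          exact (h2 (h1.trans (by rw [h3]))).elim
      · have h1 := (interior_ne c'.2 h.symm).2
        exact (c'.2 (e.out.2 + 2) (by rw [h1]; exact sideVertex_coord_add_two _ _ _)).elim
      · have h1 := (interior_ne c.2 h).2
        exact (c.2 (e'.out.2 + 2) (by rw [h1]; exact sideVertex_coord_add_two _ _ _)).elim
      · have h1 := interior_ne c.2 h
        exact congrArg _ (Prod.ext h1.1 (Subtype.ext h1.2))
    · intro u
      obtain ⟨f, c, rfl⟩ := exists_vertex u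
      by_cases hc : ∀ a, c.coord a ≠ 0
      · exact ⟨Sum.inr (f, ⟨c, hc⟩), rfl⟩
      · push Not at hc
        obtain ⟨a', ha'⟩ := hc
        obtain ⟨a, rfl⟩ : ∃ a : Fin 3, a' = a + 2 := ⟨a' + 1, by rw [add_assoc]; simp⟩
        obtain ⟨h0, hw, hs⟩ := sideVertex_of_coord ha'
        have hsurj : ∀ (h : F × Fin 3) (w : ℕ) (h0 : 0 < w) (hw : w < n) (e : T.Edge),
            e.out = h → ∃ x, g x = T.vertex h.1 (sideVertex h.2 h0 hw) := by
          rintro h w h0 hw e rfl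
          refine ⟨Sum.inl (e, ⟨w - 1, by omega⟩), ?_⟩
          simp only [g, Sum.elim_inl, Nat.sub_add_cancel h0]
        rw [← hs]
        rcases out_edge (T := T) (f, a) with h1 | h1
        · exact hsurj (f, a) _ h0 hw _ h1
        · by_cases hb : T.glue (f, a) = (f, a)
          · rw [hb] at h1
            exact hsurj (f, a) _ h0 hw _ h1
          · obtain ⟨x, hx⟩ := hsurj _ (n - c.coord a) (by omega) (by omega) _ h1
            exact ⟨x, hx.trans (vertex_sideVertex_glue hb h0 hw _ _)⟩
  rw [← Nat.card_eq_of_bijective g hg, Nat.card_sum, Nat.card_prod, Nat.card_prod, Nat.card_fin,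
    card_interiorVertex]

/-- The number of small vertices not on certain boundary edges. -/
theorem card_not_on_boundary [Finite F] {I : Type*} [Finite I] (β : I → F × Fin 3)
    (hβ : Function.Injective β) (hb : ∀ i, T.glue (β i) = β i) :
    Nat.card {v : T.Vbar n // ∀ (i : I) (c : SmallVertex n), v = T.vertex (β i).1 c →
      c.coord ((β i).2 + 2) ≠ 0} + Nat.card I * (n - 1) = Nat.card (T.Vbar n) := by
  classical
  rw [← Nat.card_congr (Equiv.sumCompl fun v : T.Vbar n => ∀ (i : I) (c : SmallVertex n),
    v = T.vertex (β i).1 c → c.coord ((β i).2 + 2) ≠ 0), Nat.card_sum]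
  congr 1
  rw [show Nat.card I * (n - 1) = Nat.card (I × Fin (n - 1)) by rw [Nat.card_prod, Nat.card_fin]]
  refine Nat.card_eq_of_bijective (fun x : I × Fin (n - 1) =>
    ⟨T.vertex (β x.1).1 (sideVertex (β x.1).2 (w := x.2 + 1) (by omega)
      (by have := x.2.2; omega)), fun h => h x.1 _ rfl (sideVertex_coord_add_two _ _ _)⟩) ⟨?_, ?_⟩
  · rintro ⟨i, j⟩ ⟨i', j'⟩ h
    rcases vertex_sideVertex_inj (congrArg Subtype.val h) with ⟨h1, h2⟩ | ⟨-, h2⟩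
    · exact Prod.ext (hβ h1) (Fin.ext (Nat.add_right_cancel h2))
    · exact (h2 (hb i)).elim
  · rintro ⟨v, hv⟩
    push Not at hv
    obtain ⟨i, c, rfl, hc⟩ := hv
    obtain ⟨h0, hw, hs⟩ := sideVertex_of_coord hc
    refine ⟨(i, ⟨c.coord (β i).2 - 1, by omega⟩), Subtype.ext ?_⟩
    dsimp only
    conv_rhs => rw [← hs]
    simp only [Nat.sub_add_cancel h0]

end small

end IdealTriangulation

/-! ### The reduced matrix -/

theorem triQ_antisymm (c d : Fin 3 → ℕ) : triQ c d = -triQ d c := by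
  have h1 : ¬ (SmallArrow c d ∧ SmallArrow d c) := by
    rw [smallArrow_iff, smallArrow_iff]
    omega
  have h2 : (∃ a, c a = 0 ∧ d a = 0) ↔ ∃ a, d a = 0 ∧ c a = 0 := by
    simp only [and_comm]
  unfold triQ
  simp only [h2]
  by_cases h3 : SmallArrow c d
  · rw [if_pos h3, if_neg fun h => h1 ⟨h3, h⟩, if_pos h3, neg_neg]
  · rw [if_neg h3]
    by_cases h4 : SmallArrow d c
    · rw [if_pos h4, if_pos h4]
    · rw [if_neg h4, if_neg h4, if_neg h3, neg_zero]

namespace IdealTriangulation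

open Matrix

variable {F : Type*} {T : IdealTriangulation F} {n : ℕ}

/-- The corank of the reduced end matrix modulo odd primes. -/
noncomputable def reducedCorank (T : IdealTriangulation F) (n : ℕ) : ℕ :=
  (T.numComponents + T.numEvenComponents) * ((n - 1) / 2) + T.numComponents * ((n - 1) % 2)

theorem reducedCorank_cast (h2 : 2 ≤ n) : (reducedCorank T n : ℤ) =
    (T.numEvenComponents : ℤ) * ((n : ℤ) - 1)
      + ((T.numComponents : ℤ) - T.numEvenComponents) * ((n / 2 : ℕ) : ℤ) := by
  rw [reducedCorank]
  rcases Nat.even_or_odd' n with ⟨m, rfl | rfl⟩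
  · obtain ⟨m, rfl⟩ : ∃ m', m = m' + 1 := ⟨m - 1, by omega⟩
    have e1 : (2 * (m + 1) - 1) / 2 = m := by omega
    have e2 : (2 * (m + 1) - 1) % 2 = 1 := by omega
    have e3 : (2 * (m + 1)) / 2 = m + 1 := by omega
    rw [e1, e2, e3]
    push_cast
    ring
  · have e1 : (2 * m + 1 - 1) / 2 = m := by omega
    have e2 : (2 * m + 1 - 1) % 2 = 0 := by omega
    have e3 : (2 * m + 1) / 2 = m := by omega
    rw [e1, e2, e3]
    push_cast
    ring

variable [Fintype F]

theorem Qbar_transpose : (T.Qbar n)ᵀ = -T.Qbar n := by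
  classical
  ext u v
  rw [Matrix.transpose_apply, Matrix.neg_apply, Qbar, Qbar, ← Finset.sum_neg_distrib]
  refine Finset.sum_congr rfl fun f _ => ?_
  rw [Finset.sum_comm, ← Finset.sum_neg_distrib]
  refine Finset.sum_congr rfl fun c _ => ?_
  rw [← Finset.sum_neg_distrib]
  refine Finset.sum_congr rfl fun d _ => ?_
  rw [triQ_antisymm d.coord]
  by_cases h : T.vertex f c = u ∧ T.vertex f d = v
  · rw [if_pos h, if_pos h.symm]
  · rw [if_neg h, if_neg fun h' => h h'.symm, neg_zero]

theorem _root_.Matrix.skew_of_smul {V W : Type*} [Fintype V] [Fintype W] (hn : 0 < n)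
    {A K : Matrix V W ℤ} {Q : Matrix W W ℤ} (hQ : Qᵀ = -Q) (h : K * Q = (n : ℤ) • A) :
    (A * Kᵀ)ᵀ = -(A * Kᵀ) := by
  have hn' : (n : ℤ) ≠ 0 := by exact_mod_cast hn.ne'
  have h1 : (n : ℤ) • (A * Kᵀ) = K * Q * Kᵀ := by rw [h, Matrix.smul_mul]
  have h2 : (K * Q * Kᵀ)ᵀ = -(K * Q * Kᵀ) := by
    rw [Matrix.transpose_mul, Matrix.transpose_mul, Matrix.transpose_transpose, hQ,
      Matrix.neg_mul, Matrix.mul_neg, Matrix.mul_assoc]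
  rw [← h1, Matrix.transpose_smul, ← smul_neg] at h2
  ext i j
  have h3 := congrFun (congrFun h2 i) j
  rw [Matrix.smul_apply, Matrix.smul_apply, smul_eq_mul, smul_eq_mul] at h3
  exact mul_left_cancel₀ hn' h3

variable (hT : T.NoInteriorPuncture)

theorem Pbar_eq : T.Pbar n = (n : ℤ) • (endMatrix hT n * (T.Kbar n)ᵀ) := by
  rw [Pbar, Kbar_mul_Qbar hT, Matrix.smul_mul]

/-- The number of boundary components of even length has the parity of the number of edges minus
the number of faces: for `n = 3`, the difference is the rank of a skew-symmetric matrix modulo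
`3`. -/
theorem exists_card_edge_eq (hT : T.NoInteriorPuncture) :
    ∃ p, Nat.card T.Edge = T.numEvenComponents + Nat.card F + 2 * p := by
  have : Fact (Nat.Prime 3) := ⟨Nat.prime_three⟩
  have h1 := card_range_endMatrix hT (n := 3) (by norm_num) (d := 3) (by decide) dvd_rfl
  obtain ⟨p, hp⟩ := Matrix.even_finrank_range_modMul (q := 3) (by norm_num)
    (Matrix.skew_of_smul (by norm_num : 0 < 3) (Qbar_transpose (T := T)) (Kbar_mul_Qbar hT))
  rw [Matrix.card_range_modMul_eq_pow, hp, ← pow_add] at h1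
  have h2 := Nat.pow_right_injective (by norm_num : 2 ≤ 3) h1
  exact ⟨p, by omega⟩

theorem card_range_endMatrix_eq (h2 : 2 ≤ n) {p : ℕ}
    (hp : Nat.card T.Edge = T.numEvenComponents + Nat.card F + 2 * p) {d : ℕ} (hd : Odd d)
    (hdn : d ∣ n) :
    Nat.card (LinearMap.range (modMul d (endMatrix hT n * (T.Kbar n)ᵀ))) = d ^ (2 * p) := by
  have h1 := card_range_endMatrix hT h2 hd hdn
  rw [hp, pow_add d (T.numEvenComponents + Nat.card F), mul_comm] at h1
  exact Nat.eq_of_mul_eq_mul_left (pow_pos hd.pos _) h1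

theorem exists_card_vbar_eq (hT : T.NoInteriorPuncture) (hn : 0 < n) :
    ∃ l, Nat.card (T.Vbar n) = reducedCorank T n + 2 * l := by
  classical
  rw [Nat.card_eq_fintype_card]
  refine exists_card_eq_add_two_mul hn rfl (A := endMatrix hT n) (K := T.Kbar n)
    (H := invMatrix T n) (by convert Kbar_mul_invMatrix hT) ?_ ?_
  · exact Matrix.skew_of_smul hn Qbar_transpose (Kbar_mul_Qbar hT)
  · exact fun q hq hq2 => card_ker_modMul_endMatrix hT hq hq2

theorem reduced_skewNormalForm (hT : T.NoInteriorPuncture) (h2 : 2 ≤ n) {p l : ℕ}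
    (hp : Nat.card T.Edge = T.numEvenComponents + Nat.card F + 2 * p)
    (hl : Nat.card (T.Vbar n) = reducedCorank T n + 2 * l) {k : ℕ} {h : Fin k → ℕ}
    (hM : IsSkewNormalForm (T.Pbar n) k h) :
    k = l ∧ ∃ z : Fin k → ℕ, (∀ i, h i = n * z i) ∧
      (∀ i : Fin k, (i : ℕ) < p → EqUpToTwo (z i) 1) ∧
      (∀ i : Fin k, p ≤ (i : ℕ) → EqUpToTwo (z i) n) := by
  classical
  rw [Pbar_eq hT] at hM
  rw [Nat.card_eq_fintype_card] at hl
  exact hM.eqUpToTwo (by omega) rfl (H := invMatrix T n) (by convert Kbar_mul_invMatrix hT) hl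
    (fun q hq hq2 => card_ker_modMul_endMatrix hT hq hq2)
    (fun d hd hdn => card_range_endMatrix_eq hT h2 hp hd hdn)

theorem two_mul_choose_two (m : ℕ) : (2 * m.choose 2 : ℤ) = m * (m - 1) := by
  rcases m with - | m
  · simp
  · rw [Nat.choose_two_right, ← Nat.cast_two, ← Nat.cast_mul,
      Nat.mul_div_cancel' (Nat.even_mul_pred_self _).two_dvd]
    push_cast
    simp

theorem card_vbar_eq (hT : T.NoInteriorPuncture) (h2 : 2 ≤ n) :
    (Nat.card (T.Vbar n) : ℤ) =
      ((n : ℤ) ^ 2 - 1) * T.r - (n.choose 2 : ℤ) * T.numBoundaryEdges := by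
  have h3 := two_mul_choose_two n
  have h4 := two_mul_choose_two (n - 1)
  have h5 := card_edge (T := T)
  rw [r_eq hT, card_vbar]
  zify [(by omega : 1 ≤ n)] at *
  have h6 : (T.numBoundaryEdges : ℤ) = 2 * Nat.card T.Edge - 3 * Nat.card F := by linarith
  rw [h6]
  linarith [mul_comm (1 : ℤ) 1, congrArg (· * (Nat.card F : ℤ)) h4,
    congrArg (· * (2 * Nat.card T.Edge - 3 * Nat.card F : ℤ)) h3]

theorem le_of_card_eq (hT : T.NoInteriorPuncture) (h2 : 2 ≤ n) {p l : ℕ}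
    (hp : Nat.card T.Edge = T.numEvenComponents + Nat.card F + 2 * p)
    (hl : Nat.card (T.Vbar n) = reducedCorank T n + 2 * l) : p ≤ l := by
  have b1 := numComponents_le_card hT
  have b2 := numComponents_le (T := T)
  have b3 := numBoundaryEdges_le (T := T)
  have b4 := numEvenComponents_le (T := T)
  have h3 := reducedCorank_cast (T := T) h2
  rw [card_vbar] at hl
  -- Twice the difference of `l` and `p`. For `n = 2`, it is nonnegative since there are at least as
  -- many faces as boundary components.
  have h4 : 0 ≤ ((n : ℤ) - 2) * (Nat.card T.Edge - T.numEvenComponents)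
      + Nat.card F * ((n - 1).choose 2 + 1)
      - ((T.numComponents : ℤ) - T.numEvenComponents) * ((n / 2 : ℕ) : ℤ) := by
    rcases h2.eq_or_lt with rfl | h5
    · have e : (((2 - 1 : ℕ).choose 2 : ℕ) : ℤ) = 0 := rfl
      have b5 : (T.numComponents : ℤ) ≤ Nat.card F := by exact_mod_cast b1
      rw [e, show ((2 / 2 : ℕ) : ℤ) = 1 from rfl]
      push_cast
      linarith [Int.natCast_nonneg T.numEvenComponents]
    · have h6 : ((n / 2 : ℕ) : ℤ) ≤ (n : ℤ) - 2 := by omega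
      have h7 : (0 : ℤ) ≤ (T.numComponents : ℤ) - T.numEvenComponents := by omega
      have h8 : (T.numComponents : ℤ) - T.numEvenComponents ≤
          Nat.card T.Edge - T.numEvenComponents := by omega
      have h9 := mul_le_mul h8 h6 (by positivity) (h7.trans h8)
      have h10 : (0 : ℤ) ≤ Nat.card F * ((n - 1).choose 2 + 1) := by positivity
      linarith
  have h5 : ((Nat.card T.Edge * (n - 1) + Nat.card F * (n - 1).choose 2 : ℕ) : ℤ) =
      (reducedCorank T n + 2 * l : ℕ) := by rw [hl]
  have h6 : (Nat.card T.Edge : ℤ) = T.numEvenComponents + Nat.card F + 2 * p := by exact_mod_cast hp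
  push_cast [Nat.cast_sub (by omega : 1 ≤ n)] at h5
  rw [h3] at h5
  have h7 : (0 : ℤ) ≤ 2 * (l - p) := by linarith
  omega

end IdealTriangulation

/-! ### The extended triangulation -/

namespace IdealTriangulation

open Matrix

section extendGeometry

variable {F : Type*} {T : IdealTriangulation F} {n : ℕ}

theorem extend_glue_boundary (b : T.BoundaryEdge) :
    T.extend.glue (Sum.inl b.1.1, b.1.2) = (Sum.inr b, 0) := dif_pos b.2

theorem extend_glue_inl {f : F} {a : Fin 3} (h : T.glue (f, a) ≠ (f, a)) :
    T.extend.glue (Sum.inl f, a) = (Sum.inl (T.glue (f, a)).1, (T.glue (f, a)).2) := dif_neg h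

theorem extend_glue_inr_zero (b : T.BoundaryEdge) :
    T.extend.glue (Sum.inr b, 0) = (Sum.inl b.1.1, b.1.2) := by
  simp [extend, extendGlue]

theorem extend_glue_inr (b : T.BoundaryEdge) {a : Fin 3} (ha : a ≠ 0) :
    T.extend.glue (Sum.inr b, a) = (Sum.inr b, a) := if_neg ha

theorem extend_reflTransGen {h h' : F × Fin 3} (hh : Relation.ReflTransGen T.Step h h') :
    Relation.ReflTransGen T.extend.Step (Sum.inl h.1, h.2) (Sum.inl h'.1, h'.2) := by
  refine hh.lift (fun h : F × Fin 3 => ((Sum.inl h.1, h.2) : (F ⊕ T.BoundaryEdge) × Fin 3)) ?_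
  rintro ⟨f, a⟩ _ ⟨h1, rfl⟩
  refine ⟨?_, ?_⟩
  · rw [extend_glue_inl h1]
    intro h2
    have h3 : (T.glue (f, a)).2 = a := congrArg (fun x => x.2) h2
    exact h1 (Prod.ext (Sum.inl_injective (congrArg Prod.fst h2)) h3)
  · rw [extend_glue_inl h1]
    rfl

theorem extend_exit_inl_aux (hT : T.NoInteriorPuncture) (h : F × Fin 3) :
    Relation.ReflTransGen T.extend.Step (Sum.inl h.1, h.2) (Sum.inr (exit hT h), 1) := by
  refine (extend_reflTransGen (reflTransGen_exit hT h)).tail ⟨?_, ?_⟩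
  · rw [extend_glue_boundary]
    intro h2
    exact Sum.inr_ne_inl (congrArg Prod.fst h2)
  · rw [extend_glue_boundary]
    rfl

theorem extend_exit_inr_aux (hT : T.NoInteriorPuncture) (b : T.BoundaryEdge) :
    Relation.ReflTransGen T.extend.Step (Sum.inr b, 0) (Sum.inr (exit hT (rot b.1)), 1) := by
  refine (extend_exit_inl_aux hT (rot b.1)).head ⟨?_, ?_⟩
  · rw [extend_glue_inr_zero]
    intro h2
    exact Sum.inl_ne_inr (congrArg Prod.fst h2)
  · rw [extend_glue_inr_zero]
    rfl

theorem extend_noInteriorPuncture (hT : T.NoInteriorPuncture) :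
    T.extend.NoInteriorPuncture := by
  rintro ⟨f | b, a⟩
  · exact ⟨_, extend_glue_inr _ (by decide), extend_exit_inl_aux hT (f, a)⟩
  · by_cases ha : a = 0
    · subst ha
      exact ⟨_, extend_glue_inr _ (by decide), extend_exit_inr_aux hT b⟩
    · exact ⟨_, extend_glue_inr b ha, Relation.ReflTransGen.refl⟩

/-- The two boundary sides of the triangle attached to a boundary edge. -/
def attachedEdge (b : T.BoundaryEdge) (a : Fin 3) (ha : a ≠ 0) : T.extend.BoundaryEdge :=
  ⟨(Sum.inr b, a), extend_glue_inr b ha⟩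

theorem extend_boundaryEdge (β : T.extend.BoundaryEdge) :
    ∃ b a ha, β = attachedEdge (T := T) b a ha := by
  obtain ⟨⟨f | b, a⟩, hβ⟩ := β
  · by_cases hb : T.glue (f, a) = (f, a)
    · have := extend_glue_boundary ⟨(f, a), hb⟩
      rw [hβ] at this
      exact (Sum.inl_ne_inr (congrArg Prod.fst this)).elim
    · rw [extend_glue_inl hb] at hβ
      have h3 : (T.glue (f, a)).2 = a := congrArg (fun x => x.2) hβ
      exact (hb (Prod.ext (Sum.inl_injective (congrArg Prod.fst hβ)) h3)).elim
  · refine ⟨b, a, ?_, rfl⟩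
    rintro rfl
    rw [extend_glue_inr_zero] at hβ
    exact Sum.inl_ne_inr (congrArg Prod.fst hβ)

theorem extend_numBoundaryEdges : T.extend.numBoundaryEdges = 2 * T.numBoundaryEdges := by
  have h : Function.Bijective fun x : T.BoundaryEdge × Fin 2 =>
      attachedEdge x.1 x.2.succ (Fin.succ_ne_zero _) := by
    constructor
    · rintro ⟨b, a⟩ ⟨b', a'⟩ h
      have h1 := congrArg Subtype.val h
      simp only [attachedEdge, Prod.mk.injEq, Sum.inr.injEq, Fin.succ_inj] at h1
      exact Prod.ext h1.1 h1.2
    · intro β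
      obtain ⟨b, a, ha, rfl⟩ := extend_boundaryEdge β
      obtain ⟨a', rfl⟩ := Fin.exists_succ_eq.2 ha
      exact ⟨(b, a'), rfl⟩
  rw [numBoundaryEdges, ← Nat.card_eq_of_bijective _ h, Nat.card_prod, Nat.card_fin, mul_comm]
  rfl

variable (hT : T.NoInteriorPuncture)

theorem extend_exit_inl (f : F) (a : Fin 3) :
    exit (extend_noInteriorPuncture hT) (Sum.inl f, a) =
      attachedEdge (exit hT (f, a)) 1 (by decide) :=
  exit_eq_of_reflTransGen _ (extend_exit_inl_aux hT (f, a))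

theorem extend_exit_inr_zero [Fintype F] (b : T.BoundaryEdge) :
    exit (extend_noInteriorPuncture hT) (Sum.inr b, 0) =
      attachedEdge (prevEdge hT b) 1 (by decide) :=
  exit_eq_of_reflTransGen _ (extend_exit_inr_aux hT b)

theorem extend_exit_inr (b : T.BoundaryEdge) {a : Fin 3} (ha : a ≠ 0) :
    exit (extend_noInteriorPuncture hT) (Sum.inr b, a) = attachedEdge b a ha :=
  exit_eq_of_reflTransGen _ Relation.ReflTransGen.refl

/-- A small vertex of an attached triangle not on the side of attachment has no other
representative. -/
theorem vertex_inr_eq {b : T.BoundaryEdge} {c : SmallVertex n} (hc : c.coord 2 ≠ 0)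
    {g : F ⊕ T.BoundaryEdge} {d : SmallVertex n}
    (h : T.extend.vertex (Sum.inr b) c = T.extend.vertex g d) : g = Sum.inr b ∧ d = c := by
  rcases vertex_eq_iff.1 h with h1 | ⟨a, a', h1, h2, h3, -, -, -⟩
  · rw [Prod.mk.injEq] at h1
    exact ⟨h1.1.symm, h1.2.symm⟩
  · dsimp only at h1 h2 h3
    by_cases ha : a = 0
    · subst ha
      exact (hc h3).elim
    · rw [extend_glue_inr b ha] at h1
      exact (h2 h1.symm).elim

theorem mem_aVertex_iff {g : F ⊕ T.BoundaryEdge} {c : SmallVertex n} :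
    (∀ (b : T.BoundaryEdge) (d : SmallVertex n),
      T.extend.vertex g c = T.extend.vertex (Sum.inr b) d → d.coord 0 ≠ 0) ↔
      ∀ b, g = Sum.inr b → c.coord 0 ≠ 0 := by
  constructor
  · rintro h b rfl
    exact h b c rfl
  · intro h b d hd h1
    have h2 : d.coord 2 ≠ 0 := by
      have := d.coord_sum
      have := d.coord_lt 1
      omega
    obtain ⟨rfl, rfl⟩ := vertex_inr_eq h2 hd.symm
    exact h b rfl h1

/-- The `A`-vertices that lie in a face of the original triangulation. -/
noncomputable def aVertexInl (f : F) (c : SmallVertex n) : T.AVertex n :=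
  ⟨T.extend.vertex (Sum.inl f) c, mem_aVertex_iff.2 fun _ h => (Sum.inl_ne_inr h).elim⟩

/-- The `A`-vertices that lie in an attached triangle. -/
noncomputable def aVertexInr (b : T.BoundaryEdge) (c : SmallVertex n) (hc : c.coord 0 ≠ 0) :
    T.AVertex n :=
  ⟨T.extend.vertex (Sum.inr b) c, mem_aVertex_iff.2 fun _ _ => hc⟩

theorem aVertex_cases (v : T.AVertex n) :
    (∃ f c, v = aVertexInl f c) ∨ ∃ b c hc, v = aVertexInr b c hc := by
  obtain ⟨v, hv⟩ := v
  obtain ⟨f | b, c, rfl⟩ := exists_vertex v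
  · exact Or.inl ⟨f, c, rfl⟩
  · exact Or.inr ⟨b, c, hv b c rfl, rfl⟩

end extendGeometry

/-! ### The change of variables -/

section change

variable {F : Type*} {T : IdealTriangulation F} {n : ℕ} {R : Type*} [CommRing R]

/-- Between `A`-vertices, the change of variables is the identity. -/
theorem changeMatrix_val [DecidableEq (T.AVertex n)] (v w : T.AVertex n) :
    T.changeMatrix n v w.1 = (1 : Matrix (T.AVertex n) (T.AVertex n) ℤ) v w := by
  rw [changeMatrix, Matrix.one_apply]
  by_cases h : v = w
  · rw [if_pos h, if_pos (by rw [h])]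
  · rw [if_neg h, if_neg (fun h' => h (Subtype.ext h'.symm)), if_neg]
    rintro ⟨b, c, d, -, h4, -, h6, -⟩
    exact w.2 b d h4 h6

variable [Fintype F]

theorem changeMatrix_inl (x : T.extend.Vbar n → R) (f : F) (c : SmallVertex n) :
    ∑ u, (T.changeMatrix n (aVertexInl f c) u : R) * x u = x (T.extend.vertex (Sum.inl f) c) := by
  classical
  rw [Finset.sum_eq_single (T.extend.vertex (Sum.inl f) c)]
  · simp [changeMatrix, aVertexInl]
  · intro u _ hu
    rw [changeMatrix, if_neg (show ¬ u = (aVertexInl f c).1 from hu), if_neg]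
    · simp
    · rintro ⟨b, c', d, h1, -, h2, -, -⟩
      exact Sum.inl_ne_inr (vertex_inr_eq h2 h1.symm).1
  · simp

/-- In an attached triangle, the change of variables subtracts the value at the point of the side
`e 1` that `IsShift` assigns to the vertex. -/
theorem changeMatrix_inr (x : T.extend.Vbar n → R) (b : T.BoundaryEdge) (c : SmallVertex n)
    (hc : c.coord 0 ≠ 0) : ∑ u, (T.changeMatrix n (aVertexInr b c hc) u : R) * x u =
      x (T.extend.vertex (Sum.inr b) c) -
        sideVal x (Sum.inr b, 1) (c.coord 0 + c.coord 1) := by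
  classical
  have h1 : ∀ u, ((T.changeMatrix n (aVertexInr b c hc) u : ℤ) : R) * x u =
      (if u = T.extend.vertex (Sum.inr b) c then x u else 0) -
        (if T.IsShift n (T.extend.vertex (Sum.inr b) c) u then x u else 0) := by
    intro u
    rw [changeMatrix]
    by_cases h2 : u = T.extend.vertex (Sum.inr b) c
    · rw [if_pos (show u = (aVertexInr b c hc).1 from h2), if_pos h2, if_neg]
      · simp
      · rintro ⟨b', c', d, h3, h4, h5, h6, -⟩
        obtain ⟨h7, h8⟩ := vertex_inr_eq h5 h3.symm
        subst h8
        rw [h2] at h4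
        obtain ⟨-, h9⟩ := vertex_inr_eq h5 h4
        rw [h9] at h6
        exact hc h6
    · rw [if_neg (show ¬ u = (aVertexInr b c hc).1 from h2), if_neg h2]
      by_cases h3 : T.IsShift n (T.extend.vertex (Sum.inr b) c) u
      · rw [if_pos (show T.IsShift n (aVertexInr b c hc).1 u from h3), if_pos h3]
        simp
      · rw [if_neg (show ¬ T.IsShift n (aVertexInr b c hc).1 u from h3), if_neg h3]
        simp
  simp only [h1, Finset.sum_sub_distrib]
  congr 1
  · simp
  · have hs := c.coord_sum
    by_cases h2 : c.coord 2 = 0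
    · rw [sideVal_of_le _ _ (by omega)]
      refine Finset.sum_eq_zero fun u _ => if_neg ?_
      rintro ⟨b', c', d, h3, -, h5, -, -⟩
      obtain ⟨-, h8⟩ := vertex_inr_eq h5 h3.symm
      rw [← h8] at h5
      exact h5 h2
    · have h0 : 0 < c.coord 0 + c.coord 1 := by omega
      have hw : c.coord 0 + c.coord 1 < n := by omega
      rw [sideVal_eq _ _ h0 hw]
      have e0 : (sideVertex (n := n) 1 h0 hw).coord 0 = 0 := sideVertex_coord_add_two 1 h0 hw
      have e2 : (sideVertex (n := n) 1 h0 hw).coord 2 = c.coord 2 := by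
        have : (sideVertex (n := n) 1 h0 hw).coord 2 = n - (c.coord 0 + c.coord 1) :=
          sideVertex_coord_add_one 1 h0 hw
        omega
      rw [Finset.sum_eq_single (T.extend.vertex (Sum.inr b) (sideVertex 1 h0 hw))]
      · exact if_pos ⟨b, c, _, rfl, rfl, h2, e0, e2⟩
      · intro u _ hu
        refine if_neg ?_
        rintro ⟨b', c', d, h3, rfl, h5, h6, h7⟩
        obtain ⟨h8, rfl⟩ := vertex_inr_eq h5 h3.symm
        rw [Sum.inr.injEq] at h8
        subst h8
        refine hu (congrArg _ (SmallVertex.eq_of_coord 2 (by omega) ?_))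
        exact h6.trans e0.symm
      · simp

variable (hT : T.NoInteriorPuncture)

/-- No elongated graph of a vertex of a face of the original triangulation reaches the side `e 2` of
an attached triangle. -/
theorem Kbar_outer_inl (hT : T.NoInteriorPuncture) (f : F) (c : SmallVertex n)
    (b : T.BoundaryEdge) {d : SmallVertex n} (hd : d.coord 1 = 0) :
    T.extend.Kbar n (T.extend.vertex (Sum.inl f) c) (T.extend.vertex (Sum.inr b) d) = 0 := by
  classical
  have h20 : (2 : Fin 3) ≠ 0 := by decide
  have hd' : d.coord ((attachedEdge b 2 h20).1.2 + 2) = 0 := by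
    have e : (2 : Fin 3) + 2 = 1 := by decide
    change d.coord ((2 : Fin 3) + 2) = 0
    rw [e, hd]
  have h := Kbar_boundary (extend_noInteriorPuncture hT) (Sum.inl f) c
    (attachedEdge b 2 h20) (d := d) hd'
  refine h.trans (Finset.sum_eq_zero fun a _ => if_neg ?_)
  rw [extend_exit_inl hT]
  intro h1
  have h2 := congrArg (fun β : T.extend.BoundaryEdge => β.1.2) h1
  exact absurd h2 (by simp [attachedEdge])

open Classical in
/-- The elongated graph of a vertex of an attached triangle reaches the side `e 2` of this triangle
only by its main segment. -/
theorem Kbar_outer_inr (hT : T.NoInteriorPuncture) (b' : T.BoundaryEdge) (c : SmallVertex n)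
    (b : T.BoundaryEdge) {d : SmallVertex n} (hd : d.coord 1 = 0) :
    T.extend.Kbar n (T.extend.vertex (Sum.inr b') c) (T.extend.vertex (Sum.inr b) d) =
      if b' = b then greenSide n (c.coord 2) (d.coord 2) else 0 := by
  have h20 : (2 : Fin 3) ≠ 0 := by decide
  have hd' : d.coord ((attachedEdge b 2 h20).1.2 + 2) = 0 := by
    have e : (2 : Fin 3) + 2 = 1 := by decide
    change d.coord ((2 : Fin 3) + 2) = 0
    rw [e, hd]
  have h := Kbar_boundary (extend_noInteriorPuncture hT) (Sum.inr b') c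
    (attachedEdge b 2 h20) (d := d) hd'
  refine h.trans ?_
  rw [Fin.sum_univ_three, extend_exit_inr_zero hT,
      extend_exit_inr hT b' (by decide : (1 : Fin 3) ≠ 0),
    extend_exit_inr hT b' (by decide : (2 : Fin 3) ≠ 0), if_neg, if_neg, zero_add, zero_add]
  · by_cases hb : b' = b
    · rw [if_pos (by rw [hb]), if_pos hb]
      rfl
    · rw [if_neg, if_neg hb]
      intro h1
      have h2 := congrArg (fun β : T.extend.BoundaryEdge => β.1.1) h1
      exact hb (Sum.inr_injective h2)
  · intro h1
    have h2 := congrArg (fun β : T.extend.BoundaryEdge => β.1.2) h1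
    exact absurd h2 (by simp [attachedEdge])
  · intro h1
    have h2 := congrArg (fun β : T.extend.BoundaryEdge => β.1.2) h1
    exact absurd h2 (by simp [attachedEdge])

/-- The columns of `C * Kbar` at the vertices that are not `X`-vertices are zero. -/
theorem changeMatrix_mul_Kbar_outer (hT : T.NoInteriorPuncture) (v : T.AVertex n)
    (b : T.BoundaryEdge) {d : SmallVertex n} (hd : d.coord 1 = 0) :
    (T.changeMatrix n * T.extend.Kbar n) v (T.extend.vertex (Sum.inr b) d) = 0 := by
  classical
  rw [Matrix.mul_apply]
  rcases aVertex_cases v with ⟨f, c, rfl⟩ | ⟨b', c, hc, rfl⟩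
  · have h := changeMatrix_inl (fun u => T.extend.Kbar n u (T.extend.vertex (Sum.inr b) d)) f c
    simp only [Int.cast_id] at h
    rw [h, Kbar_outer_inl hT f c b hd]
  · have h := changeMatrix_inr (fun u => T.extend.Kbar n u (T.extend.vertex (Sum.inr b) d)) b' c hc
    simp only [Int.cast_id] at h
    have hs := c.coord_sum
    rw [h, Kbar_outer_inr hT b' c b hd, sub_eq_zero]
    by_cases h2 : c.coord 2 = 0
    · rw [sideVal_of_le _ _ (by omega), h2, greenSide_zero_left, ite_self]
    · have h0 : 0 < c.coord 0 + c.coord 1 := by omega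
      have hw : c.coord 0 + c.coord 1 < n := by omega
      have e2 : (sideVertex (n := n) 1 h0 hw).coord 2 = c.coord 2 := by
        have : (sideVertex (n := n) 1 h0 hw).coord 2 = n - (c.coord 0 + c.coord 1) :=
          sideVertex_coord_add_one 1 h0 hw
        omega
      rw [sideVal_eq _ _ h0 hw, Kbar_outer_inr hT b' _ b hd, e2]

/-- A sum over all small vertices of terms that vanish off the `X`-vertices. -/
theorem sum_xVertex {M : Type*} [AddCommMonoid M] {g : T.extend.Vbar n → M}
    (hg : ∀ (b : T.BoundaryEdge) (d : SmallVertex n), d.coord 1 = 0 →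
      g (T.extend.vertex (Sum.inr b) d) = 0) : ∑ x : T.XVertex n, g x.1 = ∑ u, g u := by
  classical
  refine Finset.sum_of_injOn Subtype.val (Subtype.val_injective.injOn) (fun _ _ => by simp) ?_
    (fun _ _ => rfl)
  intro u _ hu
  have h1 : ¬ ∀ (b : T.BoundaryEdge) (c : SmallVertex n),
      u = T.extend.vertex (Sum.inr b) c → c.coord 1 ≠ 0 := fun h =>
    hu ⟨⟨u, h⟩, by simp, rfl⟩
  push Not at h1
  obtain ⟨b, c, rfl, hc⟩ := h1
  exact hg b c hc

/-- The inverse of `K` up to the factor `2 n`. -/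
noncomputable def invMatrixX (T : IdealTriangulation F) (n : ℕ) :
    Matrix (T.XVertex n) (T.AVertex n) ℤ :=
  (invMatrix T.extend n).submatrix Subtype.val Subtype.val

theorem K_mul_invMatrixX (hT : T.NoInteriorPuncture) [DecidableEq (T.AVertex n)] :
    T.K n * invMatrixX T n = (2 * n : ℤ) • (1 : Matrix (T.AVertex n) (T.AVertex n) ℤ) := by
  classical
  ext v w
  rw [Matrix.mul_apply]
  have h1 := sum_xVertex (g := fun u => (T.changeMatrix n * T.extend.Kbar n) v u *
    invMatrix T.extend n u w.1) (fun b d hd => by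
      rw [changeMatrix_mul_Kbar_outer hT v b hd, zero_mul])
  refine h1.trans ?_
  rw [← Matrix.mul_apply, Matrix.mul_assoc, Kbar_mul_invMatrix (extend_noInteriorPuncture hT),
    Matrix.mul_smul, Matrix.mul_one, Matrix.smul_apply, Matrix.smul_apply, changeMatrix_val]

/-- The quotient of `K * Q` by `n`. -/
noncomputable def endMatrixX (hT : T.NoInteriorPuncture) (n : ℕ) :
    Matrix (T.AVertex n) (T.XVertex n) ℤ :=
  (T.changeMatrix n * endMatrix (extend_noInteriorPuncture hT) n).submatrix id Subtype.val

theorem K_mul_Q : T.K n * T.Q n = (n : ℤ) • endMatrixX hT n := by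
  ext v w
  rw [Matrix.mul_apply]
  have h1 := sum_xVertex (g := fun u => (T.changeMatrix n * T.extend.Kbar n) v u *
    T.extend.Qbar n u w.1) (fun b d hd => by
      rw [changeMatrix_mul_Kbar_outer hT v b hd, zero_mul])
  refine h1.trans ?_
  rw [← Matrix.mul_apply, Matrix.mul_assoc, Kbar_mul_Qbar (extend_noInteriorPuncture hT),
    Matrix.mul_smul]
  rfl

theorem P_eq : T.P n = (n : ℤ) • (endMatrixX hT n * (T.K n)ᵀ) := by
  rw [P, K_mul_Q hT, Matrix.smul_mul]

theorem Q_transpose : (T.Q n)ᵀ = -T.Q n := by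
  rw [Q, Matrix.transpose_submatrix, Qbar_transpose]
  rfl

theorem card_xVertex_add : Nat.card (T.XVertex n) + T.numBoundaryEdges * (n - 1) =
    Nat.card (T.extend.Vbar n) :=
  card_not_on_boundary (T := T.extend) (n := n)
    (fun b : T.BoundaryEdge => ((Sum.inr b, 2) : (F ⊕ T.BoundaryEdge) × Fin 3))
    (fun b b' h => Sum.inr_injective (congrArg Prod.fst h)) (fun b => extend_glue_inr b (by decide))

theorem card_aVertex_add : Nat.card (T.AVertex n) + T.numBoundaryEdges * (n - 1) =
    Nat.card (T.extend.Vbar n) :=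
  card_not_on_boundary (T := T.extend) (n := n)
    (fun b : T.BoundaryEdge => ((Sum.inr b, 1) : (F ⊕ T.BoundaryEdge) × Fin 3))
    (fun b b' h => Sum.inr_injective (congrArg Prod.fst h)) (fun b => extend_glue_inr b (by decide))

theorem card_aVertex_eq_card_xVertex :
    Fintype.card (T.AVertex n) = Fintype.card (T.XVertex n) := by
  have h1 := card_xVertex_add (T := T) (n := n)
  have h2 := card_aVertex_add (T := T) (n := n)
  rw [Nat.card_eq_fintype_card] at h1 h2
  omega

theorem card_aVertex (hT : T.NoInteriorPuncture) (h2 : 2 ≤ n) :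
    (Fintype.card (T.AVertex n) : ℤ) = ((n : ℤ) ^ 2 - 1) * T.r := by
  have h1 := card_aVertex_add (T := T) (n := n)
  have h3 := card_edge (T := T)
  have h4 := card_edge (T := T.extend)
  have h5 := two_mul_choose_two (n - 1)
  rw [extend_numBoundaryEdges, Nat.card_sum] at h4
  change 2 * _ = 3 * (Nat.card F + T.numBoundaryEdges) + _ at h4
  rw [card_vbar, Nat.card_sum, Nat.card_eq_fintype_card (α := T.AVertex n)] at h1
  change _ = _ + (Nat.card F + T.numBoundaryEdges) * _ at h1
  have h6 : (Nat.card T.extend.Edge : ℤ) = Nat.card T.Edge + 2 * T.numBoundaryEdges := by omega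
  have h7 : (T.numBoundaryEdges : ℤ) = 2 * Nat.card T.Edge - 3 * Nat.card F := by omega
  have h8 := congrArg (Nat.cast : ℕ → ℤ) h1
  push_cast [Nat.cast_sub (by omega : 1 ≤ n)] at h8 h5
  rw [h6, h7] at h8
  rw [r_eq hT]
  linear_combination h8 + ((Nat.card T.Edge : ℤ) - Nat.card F) * h5

end change

end IdealTriangulation

/-! ### The kernel of the end matrix -/

namespace IdealTriangulation

open Matrix

variable {F : Type*} {T : IdealTriangulation F} {n : ℕ} {R : Type*} [CommRing R]

open Classical in
/-- Extension by zero of a function on the `X`-vertices to all small vertices. -/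
noncomputable def extendX (y : T.XVertex n → R) (u : T.extend.Vbar n) : R :=
  if h : ∀ (b : T.BoundaryEdge) (c : SmallVertex n), u = T.extend.vertex (Sum.inr b) c →
    c.coord 1 ≠ 0 then y ⟨u, h⟩ else 0

theorem extendX_val (y : T.XVertex n → R) (x : T.XVertex n) : extendX y x.1 = y x := dif_pos x.2

theorem extendX_outer (y : T.XVertex n → R) (b : T.BoundaryEdge) {d : SmallVertex n}
    (hd : d.coord 1 = 0) : extendX y (T.extend.vertex (Sum.inr b) d) = 0 :=
  dif_neg fun h => h b d rfl hd

theorem extendX_restrict {x : T.extend.Vbar n → R}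
    (hx : ∀ (b : T.BoundaryEdge) (d : SmallVertex n), d.coord 1 = 0 →
      x (T.extend.vertex (Sum.inr b) d) = 0) : extendX (fun v : T.XVertex n => x v.1) = x := by
  funext u
  rw [extendX]
  split_ifs with h
  · rfl
  · push Not at h
    obtain ⟨b, c, rfl, hc⟩ := h
    exact (hx b c hc).symm

theorem sideVal_outer {x : T.extend.Vbar n → R}
    (hx : ∀ (b : T.BoundaryEdge) (d : SmallVertex n), d.coord 1 = 0 →
      x (T.extend.vertex (Sum.inr b) d) = 0) (b : T.BoundaryEdge) (w : ℕ) :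
    sideVal x (Sum.inr b, 2) w = 0 := by
  refine Finset.sum_eq_zero fun d _ => ?_
  split_ifs with h
  · exact hx b d h.2
  · rfl

theorem boundaryValue_zero (y : Fin (n - 1) → T.BoundaryEdge → R) (b : T.BoundaryEdge) :
    boundaryValue y b 0 = 0 := by simp [boundaryValue]

/-- Values on the boundary sides of the attached triangles, the same ones on both sides of a
triangle, in opposite orders. -/
def outerValue {N : ℕ} (y : Fin N → T.BoundaryEdge → R) (i : Fin N) (β : T.extend.BoundaryEdge) :
    R :=
  Sum.elim (fun _ => 0) (fun b => if β.1.2 = 1 then y i b else y i.rev b) β.1.1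

theorem boundaryValue_outer_two (y : Fin (n - 1) → T.BoundaryEdge → R) (b : T.BoundaryEdge)
    {w : ℕ} (hw : w ≤ n) : boundaryValue (outerValue y) (attachedEdge b 2 (by decide)) w =
      boundaryValue y b (n - w) := by
  unfold boundaryValue
  split_ifs with h1 h2 h2
  · refine congrArg (fun i => y i b) (Fin.ext ?_)
    simp only [Fin.val_rev]
    omega
  · omega
  · omega
  · rfl

variable (hT : T.NoInteriorPuncture)

/-- The function on the small vertices of the extended triangulation given by antiperiodic values
on the boundary. -/
noncomputable def ofOuterValue (n : ℕ) (i2 : R) (y : Fin (n - 1) → T.BoundaryEdge → R) :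
    T.extend.Vbar n → R :=
  ofBoundaryValue (extend_noInteriorPuncture hT) n i2 (outerValue y)

theorem ofOuterValue_inl (i2 : R) (y : Fin (n - 1) → T.BoundaryEdge → R) (f : F)
    (c : SmallVertex n) : ofOuterValue hT n i2 y (T.extend.vertex (Sum.inl f) c) =
      i2 * ∑ a, boundaryValue y (exit hT (f, a)) (c.coord a) := by
  rw [ofOuterValue, ofBoundaryValue_vertex]
  simp only [extend_exit_inl hT]
  rfl

variable [Fintype F]

theorem sum_endMatrixX (y : T.XVertex n → R) (v : T.AVertex n) :
    ∑ w, (endMatrixX hT n v w : R) * y w = ∑ u, (T.changeMatrix n v u : R) *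
      ((endMatrix (extend_noInteriorPuncture hT) n).map (Int.cast : ℤ → R)).mulVec
        (extendX y) u := by
  simp only [endMatrixX, Matrix.submatrix_apply, Matrix.mul_apply, Int.cast_sum, Int.cast_mul,
    Finset.sum_mul, id]
  rw [Finset.sum_comm]
  refine Finset.sum_congr rfl fun u _ => ?_
  have h := sum_xVertex (g := fun w =>
    (endMatrix (extend_noInteriorPuncture hT) n u w : R) * extendX y w)
    (fun b d hd => by rw [extendX_outer y b hd, mul_zero])
  simp only [extendX_val] at h
  simp only [Matrix.mulVec, dotProduct, Matrix.map_apply]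
  rw [← h, Finset.mul_sum]
  exact Finset.sum_congr rfl fun w _ => mul_assoc _ _ _

theorem endMatrixX_inl (y : T.XVertex n → R) (f : F) (c : SmallVertex n) :
    ∑ w, (endMatrixX hT n (aVertexInl f c) w : R) * y w =
      -2 * extendX y (T.extend.vertex (Sum.inl f) c) +
        ∑ a, sideVal (extendX y) (Sum.inr (exit hT (f, a)), 1) (c.coord a) := by
  rw [sum_endMatrixX, changeMatrix_inl, endMatrix_mulVec]
  simp only [extend_exit_inl hT]
  rfl

theorem endMatrix_extend_inr (x : T.extend.Vbar n → R) (b : T.BoundaryEdge) (c : SmallVertex n) :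
    ((endMatrix (extend_noInteriorPuncture hT) n).map (Int.cast : ℤ → R)).mulVec x
      (T.extend.vertex (Sum.inr b) c) = -2 * x (T.extend.vertex (Sum.inr b) c) +
        sideVal x (Sum.inr (prevEdge hT b), 1) (c.coord 0) +
        sideVal x (Sum.inr b, 1) (c.coord 1) + sideVal x (Sum.inr b, 2) (c.coord 2) := by
  rw [endMatrix_mulVec, Fin.sum_univ_three, extend_exit_inr_zero hT,
    extend_exit_inr hT b (by decide : (1 : Fin 3) ≠ 0),
    extend_exit_inr hT b (by decide : (2 : Fin 3) ≠ 0), add_assoc, add_assoc, add_assoc]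
  rfl

theorem endMatrixX_inr (y : T.XVertex n → R) (b : T.BoundaryEdge) (c : SmallVertex n)
    (hc : c.coord 0 ≠ 0) : ∑ w, (endMatrixX hT n (aVertexInr b c hc) w : R) * y w =
      -2 * extendX y (T.extend.vertex (Sum.inr b) c) +
        sideVal (extendX y) (Sum.inr (prevEdge hT b), 1) (c.coord 0) +
        sideVal (extendX y) (Sum.inr b, 1) (c.coord 1) +
        sideVal (extendX y) (Sum.inr b, 1) (c.coord 0 + c.coord 1) := by
  have h2 := sideVal_outer (fun b d => extendX_outer y b (d := d))
  have h1 : ∀ w, sideVal (((endMatrix (extend_noInteriorPuncture hT) n).map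
      (Int.cast : ℤ → R)).mulVec (extendX y)) (Sum.inr b, 1) w =
        -sideVal (extendX y) (Sum.inr b, 1) w := by
    intro w
    rcases Nat.eq_zero_or_pos w with rfl | h0
    · rw [sideVal_zero, sideVal_zero, neg_zero]
    rcases le_or_gt n w with hw | hw
    · rw [sideVal_of_le _ _ hw, sideVal_of_le _ _ hw, neg_zero]
    have e0 : (sideVertex (n := n) 1 h0 hw).coord 0 = 0 := sideVertex_coord_add_two 1 h0 hw
    have e1 : (sideVertex (n := n) 1 h0 hw).coord 1 = w := sideVertex_coord 1 h0 hw
    rw [sideVal_eq _ _ h0 hw, endMatrix_extend_inr hT, e0, e1, sideVal_zero, h2,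
      sideVal_eq (extendX y) _ h0 hw]
    ring
  rw [sum_endMatrixX, changeMatrix_inr, endMatrix_extend_inr hT, h1, h2]
  ring

theorem ofOuterValue_inr (i2 : R) (y : Fin (n - 1) → T.BoundaryEdge → R) (b : T.BoundaryEdge)
    (c : SmallVertex n) : ofOuterValue hT n i2 y (T.extend.vertex (Sum.inr b) c) =
      i2 * (boundaryValue y (prevEdge hT b) (c.coord 0) + boundaryValue y b (c.coord 1)
        + boundaryValue y b (c.coord 0 + c.coord 1)) := by
  have hs := c.coord_sum
  rw [ofOuterValue, ofBoundaryValue_vertex, Fin.sum_univ_three, extend_exit_inr_zero hT,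
    extend_exit_inr hT b (by decide : (1 : Fin 3) ≠ 0),
    extend_exit_inr hT b (by decide : (2 : Fin 3) ≠ 0),
    boundaryValue_outer_two y b (c.coord_lt 2).le,
    show n - c.coord 2 = c.coord 0 + c.coord 1 by omega]
  rfl

theorem boundaryValue_antiperiodic {y : Fin (n - 1) → T.BoundaryEdge → R}
    (hy : ∀ i b, y i (prevEdge hT b) = -y i b) (b : T.BoundaryEdge) (w : ℕ) :
    boundaryValue y (prevEdge hT b) w = -boundaryValue y b w := by
  unfold boundaryValue
  split_ifs
  · exact hy _ _
  · rw [neg_zero]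

theorem ofOuterValue_outer (i2 : R) {y : Fin (n - 1) → T.BoundaryEdge → R}
    (hy : ∀ i b, y i (prevEdge hT b) = -y i b) (b : T.BoundaryEdge) (d : SmallVertex n)
    (hd : d.coord 1 = 0) : ofOuterValue hT n i2 y (T.extend.vertex (Sum.inr b) d) = 0 := by
  rw [ofOuterValue_inr, hd, boundaryValue_antiperiodic hT hy, boundaryValue_zero, add_zero,
    add_zero, neg_add_cancel, mul_zero]

theorem sideVal_ofOuterValue {i2 : R} (hi : i2 * 2 = 1) (y : Fin (n - 1) → T.BoundaryEdge → R)
    (b : T.BoundaryEdge) (w : ℕ) :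
    sideVal (ofOuterValue hT n i2 y) (Sum.inr b, 1) w = boundaryValue y b w := by
  rcases Nat.eq_zero_or_pos w with rfl | h0
  · rw [sideVal_zero, boundaryValue_zero]
  rcases le_or_gt n w with hw | hw
  · rw [sideVal_of_le _ _ hw, boundaryValue, dif_neg (by omega)]
  have e0 : (sideVertex (n := n) 1 h0 hw).coord 0 = 0 := sideVertex_coord_add_two 1 h0 hw
  have e1 : (sideVertex (n := n) 1 h0 hw).coord 1 = w := sideVertex_coord 1 h0 hw
  rw [sideVal_eq _ _ h0 hw, ofOuterValue_inr, e0, e1, zero_add, boundaryValue_zero, zero_add]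
  linear_combination boundaryValue y b w * hi

/-- A vector in the kernel of the end matrix is determined by its values on the sides `e 1` of the
attached triangles, and these are antiperiodic in each position, as follows from the equations at
the vertices of the sides `e 2`. -/
theorem card_ker_endMatrixX_eq (h2 : IsUnit (2 : R)) :
    Nat.card {x : T.XVertex n → R // ∀ v, ∑ w, (endMatrixX hT n v w : R) * x w = 0} =
      Nat.card (Fin (n - 1) → Antiperiodic hT R) := by
  obtain ⟨i2, hi⟩ := h2.exists_left_inv
  have hbv : ∀ (x : T.XVertex n → R) (b : T.BoundaryEdge) (w : ℕ), boundaryValue (n := n)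
      (fun i b => sideVal (extendX x) ((Sum.inr b, 1) : (F ⊕ T.BoundaryEdge) × Fin 3) (i + 1)) b w =
        sideVal (extendX x) (Sum.inr b, 1) w := by
    intro x b w
    unfold boundaryValue
    split_ifs with hw
    · dsimp only
      rw [show w - 1 + 1 = w by omega]
    · rcases Nat.eq_zero_or_pos w with rfl | h0
      · rw [sideVal_zero]
      · rw [sideVal_of_le]
        omega
  refine Nat.card_congr
    { toFun := fun x i => ⟨fun b => sideVal (extendX x.1) (Sum.inr b, 1) (i + 1), fun b => ?_⟩
      invFun := fun y => ⟨fun v => ofOuterValue hT n i2 (fun i => (y i).1) v.1, fun v => ?_⟩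
      left_inv := fun x => ?_
      right_inv := fun y => ?_ }
  · have hin := i.2
    have h0 : 0 < n - ((i : ℕ) + 1) := by omega
    have hw : n - ((i : ℕ) + 1) < n := by omega
    have e1 : (sideVertex (n := n) 2 h0 hw).coord 1 = 0 := sideVertex_coord_add_two 2 h0 hw
    have e0 : (sideVertex (n := n) 2 h0 hw).coord 0 = i + 1 := by
      have : (sideVertex (n := n) 2 h0 hw).coord 0 = n - (n - (i + 1)) :=
        sideVertex_coord_add_one 2 h0 hw
      omega
    have h1 := x.2 (aVertexInr b (sideVertex 2 h0 hw) (by omega))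
    rw [endMatrixX_inr, extendX_outer _ _ e1, e0, e1, sideVal_zero, add_zero] at h1
    dsimp only
    linear_combination h1
  · have hy : ∀ i b, (y i).1 (prevEdge hT b) = -(y i).1 b := fun i => (y i).2
    have he : extendX (fun v : T.XVertex n => ofOuterValue hT n i2 (fun i => (y i).1) v.1) =
        ofOuterValue hT n i2 (fun i => (y i).1) :=
      extendX_restrict (ofOuterValue_outer hT i2 hy)
    rcases aVertex_cases v with ⟨f, c, rfl⟩ | ⟨b, c, hc, rfl⟩
    · rw [endMatrixX_inl, he, ofOuterValue_inl]
      simp only [sideVal_ofOuterValue hT hi]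
      linear_combination (-∑ a, boundaryValue (fun i => (y i).1) (exit hT (f, a)) (c.coord a)) * hi
    · rw [endMatrixX_inr, he, ofOuterValue_inr, sideVal_ofOuterValue hT hi,
        sideVal_ofOuterValue hT hi, sideVal_ofOuterValue hT hi]
      linear_combination (-(boundaryValue (fun i => (y i).1) (prevEdge hT b) (c.coord 0) +
        boundaryValue (fun i => (y i).1) b (c.coord 1) +
        boundaryValue (fun i => (y i).1) b (c.coord 0 + c.coord 1))) * hi
  · refine Subtype.ext (funext fun v => ?_)
    obtain ⟨v, hv⟩ := v
    dsimp only
    rw [← extendX_val x.1 ⟨v, hv⟩]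
    dsimp only
    obtain ⟨f | b, c, rfl⟩ := exists_vertex v
    · rw [ofOuterValue_inl]
      have h1 := x.2 (aVertexInl f c)
      rw [endMatrixX_inl] at h1
      simp only [hbv]
      linear_combination i2 * h1 + extendX x.1 (T.extend.vertex (Sum.inl f) c) * hi
    · rw [ofOuterValue_inr]
      simp only [hbv]
      by_cases hc : c.coord 0 = 0
      · rw [hc, sideVal_zero, zero_add, zero_add]
        have h3 : sideVal (extendX x.1) ((Sum.inr b, 1) : (F ⊕ T.BoundaryEdge) × Fin 3)
            (c.coord 1) = extendX x.1 (T.extend.vertex (Sum.inr b) c) :=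
          sideVal_coord (extendX x.1) (Sum.inr b : F ⊕ T.BoundaryEdge) (a := 1) hc
        rw [h3]
        linear_combination extendX x.1 (T.extend.vertex (Sum.inr b) c) * hi
      · have h1 := x.2 (aVertexInr b c hc)
        rw [endMatrixX_inr] at h1
        linear_combination i2 * h1 + extendX x.1 (T.extend.vertex (Sum.inr b) c) * hi
  · funext i
    refine Subtype.ext (funext fun b => ?_)
    have hy : ∀ i b, (y i).1 (prevEdge hT b) = -(y i).1 b := fun i => (y i).2
    dsimp only
    rw [extendX_restrict (ofOuterValue_outer hT i2 hy), sideVal_ofOuterValue hT hi,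
      boundaryValue_succ]

theorem card_ker_modMul_endMatrixX {q : ℕ} (hq : q.Prime) (hq2 : q ≠ 2) :
    Nat.card (LinearMap.ker (modMul q (endMatrixX hT n))) =
      q ^ (T.numEvenComponents * (n - 1)) := by
  have h2 := ZMod.isUnit_two_of_odd (hq.odd_of_ne_two hq2)
  obtain ⟨i2, hi⟩ := h2.exists_left_inv
  have h3 := card_antiperiodic hT (M := ZMod q) (fun m hm => by
    rw [nsmul_eq_mul] at hm
    push_cast at hm
    linear_combination i2 * hm - m * hi)
  have h4 := card_ker_endMatrixX_eq hT (n := n) h2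
  rw [Nat.card_fun, h3, Nat.card_zmod, Nat.card_fin, ← pow_mul] at h4
  rw [← h4]
  exact Nat.card_congr (Equiv.subtypeEquivRight fun x => funext_iff)

end IdealTriangulation

/-! ### The rows of `K` and the skew normal forms -/

namespace IdealTriangulation

open Matrix

section extendCochain

variable {F : Type*} {T : IdealTriangulation F} {n : ℕ} {R : Type*} [CommRing R]

/-- The extension of a cocycle to the attached triangles by zero on their sides `e 2`. -/
def extendCochain (φ : F × Fin 3 → R) (h : (F ⊕ T.BoundaryEdge) × Fin 3) : R :=
  Sum.elim (fun f => φ (f, h.2)) (fun b => ![-φ b.1, φ b.1, 0] h.2) h.1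

theorem extendCochain_mem {φ : F × Fin 3 → R} (hφ : φ ∈ cocycles T R) :
    extendCochain φ ∈ cocycles T.extend R := by
  refine ⟨?_, ?_⟩
  · rintro ⟨f | b, a⟩ hh
    · by_cases hb : T.glue (f, a) = (f, a)
      · have h1 := extend_glue_boundary ⟨(f, a), hb⟩
        dsimp only at h1
        rw [h1]
        rfl
      · rw [extend_glue_inl hb]
        exact hφ.1 _ hb
    · by_cases ha : a = 0
      · subst ha
        rw [extend_glue_inr_zero]
        simp [extendCochain]
      · exact (hh (extend_glue_inr b ha)).elim
  · rintro (f | b)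
    · exact hφ.2 f
    · simp [extendCochain]

/-- The cocycles of the extended triangulation that vanish on the sides `e 2` of the attached
triangles are extensions of cocycles. -/
theorem exists_eq_extendCochain {ρ : (F ⊕ T.BoundaryEdge) × Fin 3 → R}
    (hρ : ρ ∈ cocycles T.extend R) (h0 : ∀ b : T.BoundaryEdge, ρ (Sum.inr b, 2) = 0) :
    ∃ φ ∈ cocycles T R, ρ = extendCochain φ := by
  refine ⟨fun h => ρ (Sum.inl h.1, h.2), ⟨?_, fun f => hρ.2 (Sum.inl f)⟩, ?_⟩
  · rintro ⟨f, a⟩ hh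
    have h1 := hρ.1 (Sum.inl f, a) (by
      rw [extend_glue_inl hh]
      intro h2
      have h3 : (T.glue (f, a)).2 = a := congrArg (fun x => x.2) h2
      exact hh (Prod.ext (Sum.inl_injective (congrArg Prod.fst h2)) h3))
    rw [extend_glue_inl hh] at h1
    exact h1
  · have h1 : ∀ b : T.BoundaryEdge, ρ (Sum.inr b, 0) = -ρ (Sum.inl b.1.1, b.1.2) := by
      intro b
      have h2 := hρ.1 (Sum.inl b.1.1, b.1.2) (by
        rw [extend_glue_boundary]
        intro h2
        exact Sum.inr_ne_inl (congrArg Prod.fst h2))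
      rwa [extend_glue_boundary] at h2
    funext x
    obtain ⟨f | b, a⟩ := x
    · rfl
    · fin_cases a
      · exact h1 b
      · have h2 := hρ.2 (Sum.inr b)
        rw [h0, h1] at h2
        change ρ (Sum.inr b, 1) = ρ (Sum.inl b.1.1, b.1.2)
        linear_combination h2
      · exact h0 b

theorem balanced_outer (hn : (n : R) = 0) {ρ : (F ⊕ T.BoundaryEdge) × Fin 3 → R}
    (hρ : ρ ∈ cocycles T.extend R) (b : T.BoundaryEdge) {d : SmallVertex n}
    (hd : d.coord 1 = 0) :
    balanced n ρ (T.extend.vertex (Sum.inr b) d) = d.coord 2 * ρ (Sum.inr b, 2) := by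
  rw [balanced_vertex hn hρ _ _ 2, show (2 : Fin 3) + 2 = 1 by decide, hd]
  simp

theorem balanced_extendCochain_outer (hn : (n : R) = 0) {φ : F × Fin 3 → R}
    (hφ : φ ∈ cocycles T R) (b : T.BoundaryEdge) (d : SmallVertex n) (hd : d.coord 1 = 0) :
    balanced n (extendCochain φ) (T.extend.vertex (Sum.inr b) d) = 0 := by
  rw [balanced_outer hn (extendCochain_mem hφ) b hd]
  exact mul_zero _

end extendCochain

variable {F : Type*} [Fintype F] {T : IdealTriangulation F} {n : ℕ}

/-- The balanced functions on the `X`-vertices given by cocycles of the original triangulation. -/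
noncomputable def balancedX (T : IdealTriangulation F) (R : Type*) [CommRing R] (n : ℕ) :
    cocycles T R →ₗ[R] (T.XVertex n → R) where
  toFun φ v := balanced n (extendCochain φ.1) v.1
  map_add' φ ψ := by
    have h : extendCochain (T := T) (φ.1 + ψ.1) = extendCochain φ.1 + extendCochain ψ.1 := by
      funext x
      obtain ⟨f | b, a⟩ := x
      · rfl
      · fin_cases a <;> simp [extendCochain, add_comm]
    funext v
    exact congrFun ((congrArg _ h).trans (balanced_add _ _)) v.1
  map_smul' r φ := by
    have h : extendCochain (T := T) (r • φ.1) = r • extendCochain φ.1 := by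
      funext x
      obtain ⟨f | b, a⟩ := x
      · rfl
      · fin_cases a <;> simp [extendCochain]
    funext v
    exact congrFun ((congrArg _ h).trans (balanced_smul _ _)) v.1

/-- Modulo the odd divisors of `n`, the rows of `K` generate the balanced vectors of the cocycles of
the original triangulation. -/
theorem range_balancedX (hT : T.NoInteriorPuncture) (h2 : 2 ≤ n) {d : ℕ} (hdn : d ∣ n)
    (hd : IsUnit (2 : ZMod d)) :
    LinearMap.range (balancedX T (ZMod d) n) = LinearMap.range (modMul d (T.K n)ᵀ) := by
  classical
  have hT' := extend_noInteriorPuncture hT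
  have hn0 : ((n : ℕ) : ZMod d) = 0 := (ZMod.natCast_eq_zero_iff _ _).2 hdn
  refine le_antisymm ?_ ?_
  · rintro _ ⟨⟨φ, hφ⟩, rfl⟩
    obtain ⟨ψ, hψ, hψφ⟩ := exists_lift_cocycle hT d hφ
    have h1 := mem_range_modMul_transpose (n := n) (by omega) (K := T.K n) (H := invMatrixX T n)
      card_aVertex_eq_card_xVertex (by convert K_mul_invMatrixX hT)
      (fun v => balanced n (extendCochain (T := T) ψ) v.1) (fun v => by
        rw [← ZMod.intCast_zmod_eq_zero_iff_dvd]
        have hψn := map_mem_cocycles (Int.castRingHom (ZMod n)) hψ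
        have h3 := balanced_vecMul_invMatrix (T := T.extend) (R := ZMod n) (by simp)
          (extendCochain_mem hψn) v.1
        rw [← h3, ← sum_xVertex (g := fun u => balanced n (extendCochain (T := T)
          fun h => Int.castRingHom (ZMod n) (ψ h)) u * (invMatrix T.extend n u v.1 : ZMod n))
          (fun b d hd => by
            rw [balanced_extendCochain_outer (by simp) hψn b d hd, zero_mul])]
        push_cast
        refine Finset.sum_congr rfl fun u _ => ?_
        have h4 : ∀ h, ((extendCochain (T := T) ψ h : ℤ) : ZMod n) =
            extendCochain (fun h => Int.castRingHom (ZMod n) (ψ h)) h := by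
          rintro ⟨f | b, a⟩
          · rfl
          · fin_cases a <;> simp [extendCochain]
        simp [balanced, h4, invMatrixX]) hd
    convert h1 using 1
    funext u
    have h4 : ∀ h, ((extendCochain (T := T) ψ h : ℤ) : ZMod d) = extendCochain φ h := by
      rintro ⟨f | b, a⟩
      · exact hψφ _
      · fin_cases a <;> simp [extendCochain, hψφ]
    simp [balancedX, balanced, h4]
  · rintro _ ⟨y, rfl⟩
    set ρ : (F ⊕ T.BoundaryEdge) × Fin 3 → ZMod d := ∑ v, ∑ u,
      (y v * (T.changeMatrix n v u : ZMod d)) •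
        rowCocycle T.extend (ZMod d) (Quot.out u).1 (Quot.out u).2 with hρ
    have hρm : ρ ∈ cocycles T.extend (ZMod d) :=
      Submodule.sum_mem _ fun v _ => Submodule.sum_mem _ fun u _ =>
        Submodule.smul_mem _ _ (rowCocycle_mem hT' hn0 _ _)
    have h1 : ∀ w, balanced n ρ w =
        ∑ v, y v * ((T.changeMatrix n * T.extend.Kbar n) v w : ZMod d) := by
      intro w
      have h3 : balancedHom T.extend (ZMod d) n ρ w = ∑ v, ∑ u,
          (y v * (T.changeMatrix n v u : ZMod d)) * balanced n
            (rowCocycle T.extend (ZMod d) (Quot.out u).1 (Quot.out u).2) w := by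
        simp only [hρ, map_sum, map_smul, Finset.sum_apply, Pi.smul_apply, smul_eq_mul]
        rfl
      refine h3.trans (Finset.sum_congr rfl fun v _ => ?_)
      rw [Matrix.mul_apply, Int.cast_sum, Finset.mul_sum]
      refine Finset.sum_congr rfl fun u _ => ?_
      have hu : T.extend.vertex (Quot.out u).1 (Quot.out u).2 = u := Quot.out_eq u
      have h4 := Kbar_row_eq_balanced (R := ZMod d) hT' hn0 (Quot.out u).1 (Quot.out u).2 w
      rw [hu] at h4
      rw [← h4]
      push_cast
      ring
    -- The balanced function of `ρ` is `-ρ (b, 2)` at the vertex of the side `e 2` with coordinate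
    -- `n - 1` in position `2`, where the rows of `K` vanish.
    have h0 : ∀ b : T.BoundaryEdge, ρ (Sum.inr b, 2) = 0 := by
      intro b
      have e1 : (sideVertex (n := n) 2 (w := n - 1) (by omega) (by omega)).coord 1 = 0 :=
        sideVertex_coord_add_two 2 _ _
      have e2 : (sideVertex (n := n) 2 (w := n - 1) (by omega) (by omega)).coord 2 = n - 1 :=
        sideVertex_coord 2 _ _
      have h3 := h1 (T.extend.vertex (Sum.inr b) (sideVertex 2 (w := n - 1) (by omega) (by omega)))
      rw [balanced_outer hn0 hρm b e1, e2, Nat.cast_sub (by omega : 1 ≤ n), hn0] at h3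
      simp only [changeMatrix_mul_Kbar_outer hT _ b e1, Int.cast_zero, mul_zero,
        Finset.sum_const_zero, Nat.cast_one, zero_sub, neg_mul, one_mul, neg_eq_zero] at h3
      exact h3
    obtain ⟨φ, hφ, hφρ⟩ := exists_eq_extendCochain hρm h0
    refine ⟨⟨φ, hφ⟩, ?_⟩
    funext w
    change balanced n (extendCochain φ) w.1 = _
    rw [← hφρ, h1, modMul_apply]
    exact Finset.sum_congr rfl fun v _ => mul_comm _ _

variable (hT : T.NoInteriorPuncture)

/-- On balanced vectors, the end matrix and its reduced version have the same kernel. -/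
theorem modMul_endMatrixX_balancedX (h2 : 2 ≤ n) {d : ℕ} (hdn : d ∣ n)
    (φ : cocycles T (ZMod d)) :
    modMul d (endMatrixX hT n) (balancedX T (ZMod d) n φ) = 0 ↔ IsBoundaryDetermined hT φ.1 := by
  have hn0 : ((n : ℕ) : ZMod d) = 0 := (ZMod.natCast_eq_zero_iff _ _).2 hdn
  obtain ⟨φ, hφ⟩ := φ
  have hm := extendCochain_mem hφ
  have he : extendX (balancedX T (ZMod d) n ⟨φ, hφ⟩) = balanced n (extendCochain φ) :=
    extendX_restrict (balanced_extendCochain_outer hn0 hφ)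
  have hinl : ∀ (f : F) (c : SmallVertex n),
      modMul d (endMatrixX hT n) (balancedX T (ZMod d) n ⟨φ, hφ⟩) (aVertexInl f c) =
        ((endMatrix hT n).map (Int.cast : ℤ → ZMod d)).mulVec (balanced n φ) (T.vertex f c) := by
    intro f c
    refine (endMatrixX_inl hT (balancedX T (ZMod d) n ⟨φ, hφ⟩) f c).trans ?_
    rw [he, endMatrix_mulVec, balanced_vertex hn0 hm _ _ 0, balanced_vertex hn0 hφ _ _ 0]
    simp only [sideVal_balanced hn0 hm _ (c.coord_lt _).le,
      sideVal_balanced hn0 hφ _ (c.coord_lt _).le]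
    rfl
  rw [← endMatrix_mulVec_balanced_eq_zero_iff hT h2 hn0 hφ]
  constructor
  · intro h
    funext u
    obtain ⟨f, c, rfl⟩ := exists_vertex u
    rw [← hinl, h]
    rfl
  · intro h
    funext v
    rcases aVertex_cases v with ⟨f, c, rfl⟩ | ⟨b, c, hc, rfl⟩
    · rw [hinl, h]
      rfl
    · refine (endMatrixX_inr hT (balancedX T (ZMod d) n ⟨φ, hφ⟩) b c hc).trans ?_
      have h3 := (endMatrix_mulVec_balanced_eq_zero_iff hT h2 hn0 hφ).1 h b.1
      rw [exit_boundary, ← prevEdge_apply] at h3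
      have h4 := coord_sum_cast hn0 c 0
      have hs := c.coord_sum
      rw [he, balanced_vertex hn0 hm _ _ 0, sideVal_balanced hn0 hm _ (c.coord_lt _).le,
        sideVal_balanced hn0 hm _ (c.coord_lt _).le, sideVal_balanced hn0 hm _ (by omega)]
      have e0 : extendCochain φ ((Sum.inr b, 0) : (F ⊕ T.BoundaryEdge) × Fin 3) = -φ b.1 := rfl
      have e1 : ∀ b : T.BoundaryEdge,
          extendCochain φ ((Sum.inr b, 1) : (F ⊕ T.BoundaryEdge) × Fin 3) = φ b.1 := fun b => rfl
      simp only [zero_add] at h4 ⊢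
      rw [e0, e1, e1]
      push_cast
      rw [Pi.zero_apply]
      linear_combination (c.coord 0 : ZMod d) * h3 + 2 * φ b.1 * h4

theorem card_range_endMatrixX (h2 : 2 ≤ n) {p : ℕ}
    (hp : Nat.card T.Edge = T.numEvenComponents + Nat.card F + 2 * p) {d : ℕ} (hd : Odd d)
    (hdn : d ∣ n) :
    Nat.card (LinearMap.range (modMul d (endMatrixX hT n * (T.K n)ᵀ))) = d ^ (2 * p) := by
  have : NeZero d := ⟨hd.pos.ne'⟩
  have h1 := card_range_mul_pow hT (ZMod.isUnit_two_of_odd hd) (endMatrixX hT n) (T.K n)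
    (balancedX T (ZMod d) n) (range_balancedX hT h2 hdn (ZMod.isUnit_two_of_odd hd))
    (modMul_endMatrixX_balancedX hT h2 hdn)
  rw [hp, pow_add d (T.numEvenComponents + Nat.card F), mul_comm] at h1
  exact Nat.eq_of_mul_eq_mul_left (pow_pos hd.pos _) h1

/-- The corank of the end matrix has the parity of the number of vertices. -/
theorem exists_card_aVertex_eq (hT : T.NoInteriorPuncture) (hn : 0 < n) :
    ∃ l, Fintype.card (T.AVertex n) = T.numEvenComponents * (n - 1) + 2 * l := by
  classical
  refine exists_card_eq_add_two_mul hn card_aVertex_eq_card_xVertex (A := endMatrixX hT n)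
    (K := T.K n) (H := invMatrixX T n) (by convert K_mul_invMatrixX hT) ?_ ?_
  · exact Matrix.skew_of_smul hn Q_transpose (K_mul_Q hT)
  · exact fun q hq hq2 => card_ker_modMul_endMatrixX hT hq hq2

theorem skewNormalForm_P (hT : T.NoInteriorPuncture) (h2 : 2 ≤ n) {p l : ℕ}
    (hp : Nat.card T.Edge = T.numEvenComponents + Nat.card F + 2 * p)
    (hl : Fintype.card (T.AVertex n) = T.numEvenComponents * (n - 1) + 2 * l) {k : ℕ}
    {h : Fin k → ℕ} (hM : IsSkewNormalForm (T.P n) k h) :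
    k = l ∧ ∃ z : Fin k → ℕ, (∀ i, h i = n * z i) ∧
      (∀ i : Fin k, (i : ℕ) < p → EqUpToTwo (z i) 1) ∧
      (∀ i : Fin k, p ≤ (i : ℕ) → EqUpToTwo (z i) n) := by
  classical
  rw [P_eq hT] at hM
  exact hM.eqUpToTwo (by omega) card_aVertex_eq_card_xVertex (H := invMatrixX T n)
    (by convert K_mul_invMatrixX hT) hl
    (fun q hq hq2 => card_ker_modMul_endMatrixX hT hq hq2)
    (fun d hd hdn => card_range_endMatrixX hT h2 hp hd hdn)

end IdealTriangulation

theorem proposition7 {F : Type*} [Fintype F] (T : IdealTriangulation F)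
    (hT : T.NoInteriorPuncture) (n : ℕ) (hn : 2 ≤ n) :
    (∃ p q : ℕ,
      2 * (p : ℤ) = T.r - T.numEvenComponents ∧
      2 * (q : ℤ) = (n : ℤ) ^ 2 * T.r - (T.numEvenComponents : ℤ) * n - 2 * T.r
        + 2 * T.numEvenComponents ∧
      ∀ (k : ℕ) (h : Fin k → ℕ), IsSkewNormalForm (T.P n) k h →
        k = p + q ∧
        ∃ z : Fin k → ℕ, (∀ i, h i = n * z i) ∧
          (∀ i : Fin k, (i : ℕ) < p → EqUpToTwo (z i) 1) ∧
          (∀ i : Fin k, p ≤ (i : ℕ) → EqUpToTwo (z i) n)) ∧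
    (T.IsBoundaryAdapted →
      (Nat.card (T.Vbar n) : ℤ) =
        ((n : ℤ) ^ 2 - 1) * T.r - (n.choose 2 : ℤ) * T.numBoundaryEdges ∧
      ∃ p l : ℕ,
        2 * (p : ℤ) = T.r - T.numEvenComponents ∧
        2 * (l : ℤ) = (Nat.card (T.Vbar n) : ℤ) - (T.numEvenComponents : ℤ) * ((n : ℤ) - 1)
          - ((T.numComponents : ℤ) - T.numEvenComponents) * ((n / 2 : ℕ) : ℤ) ∧
        p ≤ l ∧
        ∀ (k : ℕ) (h : Fin k → ℕ), IsSkewNormalForm (T.Pbar n) k h →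
          k = l ∧
          ∃ z : Fin k → ℕ, (∀ i, h i = n * z i) ∧
            (∀ i : Fin k, (i : ℕ) < p → EqUpToTwo (z i) 1) ∧
            (∀ i : Fin k, p ≤ (i : ℕ) → EqUpToTwo (z i) n)) := by
  obtain ⟨p, hp⟩ := IdealTriangulation.exists_card_edge_eq hT
  have hp' : 2 * (p : ℤ) = T.r - T.numEvenComponents := by
    rw [IdealTriangulation.r_eq hT, hp]
    push_cast
    ring
  refine ⟨?_, fun _ => ⟨IdealTriangulation.card_vbar_eq hT hn, ?_⟩⟩
  · obtain ⟨l, hl⟩ := IdealTriangulation.exists_card_aVertex_eq hT (n := n) (by omega)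
    have h1 := IdealTriangulation.card_aVertex hT hn
    have h2 : ((T.numEvenComponents * (n - 1) + 2 * l : ℕ) : ℤ) = ((n : ℤ) ^ 2 - 1) * T.r := by
      rw [← h1, hl]
    push_cast [Nat.cast_sub (by omega : 1 ≤ n)] at h2
    have hpl : p ≤ l := by
      have h3 : (T.r : ℤ) = T.numEvenComponents + 2 * p := by linarith
      have h4 : (2 : ℤ) ≤ n := by exact_mod_cast hn
      rw [h3] at h2
      have h5 : (0 : ℤ) ≤ T.numEvenComponents * ((n - 1) * n) := by
        have : (0 : ℤ) ≤ (n - 1) * n := by nlinarith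
        positivity
      have h6 : (0 : ℤ) ≤ p * ((n : ℤ) ^ 2 - 2) := by
        have : (0 : ℤ) ≤ (n : ℤ) ^ 2 - 2 := by nlinarith
        positivity
      have h7 : (0 : ℤ) ≤ 2 * (l - p) := by linarith
      omega
    refine ⟨p, l - p, hp', ?_, fun k h hM => ?_⟩
    · rw [Nat.cast_sub hpl]
      linarith
    · rw [Nat.add_sub_cancel' hpl]
      exact IdealTriangulation.skewNormalForm_P hT hn hp hl hM
  · obtain ⟨l, hl⟩ := IdealTriangulation.exists_card_vbar_eq hT (n := n) (by omega)
    refine ⟨p, l, hp', ?_, IdealTriangulation.le_of_card_eq hT hn hp hl, fun k h hM =>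
      IdealTriangulation.reduced_skewNormalForm hT hn hp hl hM⟩
    have h1 := IdealTriangulation.reducedCorank_cast (T := T) hn
    push_cast [hl] at h1 ⊢
    linarith
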